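/- A \emph{dynamic set sampler} is a randomized data structure supporting $\mathrm{init}(n,p)$ for $p\in[0,1]^n$; $\mathrm{set}(i,\alpha)$ for $i\in[n]$, $\alpha\in[0,1]$, which sets $p_i\gets\alpha$; and $\mathrm{sample}()$, which returns a random $T\subseteq[n]$ containing each $i\in[n]$ independently with probability $p_i$. An \emph{output-adaptive adversary} chooses (possibly at random) each request as a function of the previous requests and the previously returned sets, but not of the internal state. \textbf{Algorithm A.} The state consists of $n$, $p\in[0,1]^n$, a time $\tau$, sets $T_1,\dots,T_n\subseteq[n]$ and times $\tau_1,\dots,\tau_n\in[n+1]$. \begin{itemize} \item $\mathrm{init}(n,p)$: store $n,p$; put $\tau\gets1$, $T_i\gets\emptyset$, $\tau_i\gets n+1$ for all $i$; then call $\mathrm{set}(i,p_i)$ for $i=1,\dots,n$. \item $\mathrm{set}(i,\alpha)$: if $\tau_i\ne n+1$, remove $i$ from $T_{\tau_i}$. Put $p_i\gets\alpha$. For $j=\tau,\dots,n$: independently with probability $p_i$, add $i$ to $T_j$, put $\tau_i\gets j$ and return. If the loop ends without returning, put $\tau_i\gets n+1$. \item $\mathrm{sample}()$: put $T\gets T_\tau$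 and $\tau\gets\tau+1$. If $\tau<n+1$, call $\mathrm{set}(i,p_i)$ for all $i\in T$; otherwise put $\tau\gets1$ and call $\mathrm{set}(i,p_i)$ for all $i\in[n]$. Return $T$. \end{itemize} \textbf{Theorem.} (1) Algorithm A is a dynamic set sampler, even against output-adaptive adversaries: for all $n\ge1$, all initial $p\in[0,1]^n$, every output-adaptive adversary and every $k$, the law of the transcript (requests and returned sets) of the first $k$ requests is the same as for the ideal data structure that stores the current $p$ and answers every $\mathrm{sample}()$ with a fresh set, independent of the past, that contains each $i$ independently with the current probability $p_i$. (2) Algorithm A has an efficient implementation on the word RAM. The machine has $w$-bit words and performs in one unit of time each of: an arithmetic, bitwise or comparison operation on words, a memory access at an address computed at run time, the drawing of a uniformly random word, the output of a word. For every constant $\kappa\in\mathbb N$ there are a program and a constant $C$ such that the following holds for all $n\ge1$, all word sizes $w$ with $n<2^w$, and all $p_{\min}>0$ with $\log_2(1/p_{\min})\le\kappa w$. Assume that all probabilities, the initial $p_i$ as well as those in the requests $\mathrm{set}(i,\alpha)$, are at least $p_{\min}$ and are fixed-point numbers with $\kappa$ fractional words (integer multiples of $2^{-\kappa w}$). Then,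 against every output-adaptive adversary that keeps this promise, and for every $k$: \begin{itemize} \item every call halts with probability $1$, and the state of Algorithm A can be read off the contents of the machine by a function depending only on the program, $n$ and $w$ such that the joint law of this state and of the transcript after $k$ requests is that of Algorithm A; \item the number of distinct memory cells accessed up to then is always at most $Cn$; \item $\mathrm{init}$ takes expected time at most $Cn$; \item from every machine state that occurs with positive probability, $\mathrm{set}$ takes expected time at most $C$; \item $\mathrm{sample}$ takes expected amortized time $O(1+|T|)$: the expected total time of the calls of $\mathrm{sample}$ among the first $k$ requests is at most $C\cdot\mathbb E\big[\sum(1+|T|)\big]$, the sum being over these calls and $T$ the returned set. Moreover, from every machine state that occurs with positive probability, a single call takes expected time at most $C(1+|T|)$ if $\tau<n$ before the call, and at most $C(1+|T|+n)$ if $\tau=n$, where $T=T_\tau$ is the set to be returned. \end{itemize} -/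

import Mathlib

open scoped ENNReal unitInterval

noncomputable section

namespace SetSampler

/-! ## Data structures, output-adaptive adversaries, and their interaction -/

/-- A request to a dynamic set sampler over the ground set `Fin n`. -/
inductive Op (n : ℕ) where
  | set (i : Fin n) (α : I)
  | sample

/-- What an output-adaptive adversary sees of an operation: the request, and the returned set. -/
inductive Event (n : ℕ) where
  | set (i : Fin n) (α : I)
  | sample (T : Finset (Fin n))

/-- A (randomized) output-adaptive adversary picks the next request from the requests and outputs
so far (most recent first); it does not see the internal state of the data structure. -/
abbrev Adversary (n : ℕ) := List (Event n) → PMF (Op n)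

/-- A randomized data structure with state space `S` that supports the operations of a
dynamic set sampler; `start` is the law of the state after `init`. -/
structure Sampler (n : ℕ) (S : Type) where
  start : PMF S
  set : Fin n → I → S → PMF S
  sample : S → PMF (Finset (Fin n) × S)

/-- The joint law of the internal state and the transcript (most recent event first) after `init`
and the first `k` requests of the adversary. -/
def Sampler.play {n : ℕ} {S : Type} (D : Sampler n S) (adv : Adversary n) :
    ℕ → PMF (S × List (Event n))
  | 0 => D.start.map fun s => (s, [])
  | k + 1 => (D.play adv k).bind fun x => (adv x.2).bind fun
      | Op.set i α => (D.set i α x.1).map fun s => (s, Event.set i α :: x.2)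
      | Op.sample => (D.sample x.1).map fun y => (y.2, Event.sample y.1 :: x.2)

/-- `∑ (1 + |T|)` over all calls of `sample` in a transcript. -/
def sampleWork {n : ℕ} : List (Event n) → ℕ
  | [] => 0
  | Event.set _ _ :: h => sampleWork h
  | Event.sample T :: h => (1 + T.card) + sampleWork h

/-! ## The ideal set sampler -/

/-- The probability of `T` when every `i` is included independently with probability `p i`. -/
def indepMass {n : ℕ} (p : Fin n → I) (T : Finset (Fin n)) : ℝ≥0∞ :=
  (∏ i ∈ T, ENNReal.ofReal (p i)) * ∏ i ∈ Finset.univ \ T, ENNReal.ofReal (1 - p i)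

theorem ofReal_add_ofReal_compl (α : I) :
    ENNReal.ofReal (α : ℝ) + ENNReal.ofReal (1 - (α : ℝ)) = 1 := by
  rw [← ENNReal.ofReal_add α.2.1 (by linarith [α.2.2])]
  simp

theorem sum_indepMass {n : ℕ} (p : Fin n → I) : ∑ T, indepMass p T = 1 := by
  have h := Finset.prod_add (fun i => ENNReal.ofReal (p i : ℝ))
    (fun i => ENNReal.ofReal (1 - (p i : ℝ))) (Finset.univ : Finset (Fin n))
  rw [Finset.powerset_univ] at h
  unfold indepMass
  rw [← h]
  exact Finset.prod_eq_one fun i _ => ofReal_add_ofReal_compl (p i)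

/-- The law of a random subset that contains every `i` independently with probability `p i`. -/
def indepLaw {n : ℕ} (p : Fin n → I) : PMF (Finset (Fin n)) :=
  PMF.ofFintype (indepMass p) (sum_indepMass p)

/-- The specification of a dynamic set sampler: the state is the current vector `p`, and every call
of `sample` returns a fresh set that contains each `i` independently with probability `p i`. -/
def ideal (n : ℕ) (p₀ : Fin n → I) : Sampler n (Fin n → I) where
  start := PMF.pure p₀
  set i α p := PMF.pure (Function.update p i α)
  sample p := (indepLaw p).map fun T => (T, p)

/-! ## The algorithm -/

/-- A coin that shows `true` with probability `α`. -/
def coin (α : I) : PMF Bool :=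
  PMF.ofFintype (fun b => if b then ENNReal.ofReal α else ENNReal.ofReal (1 - α)) (by
    simpa using ofReal_add_ofReal_compl α)

/-- The global variables of the algorithm: the vector `p`, the current relative time `now`, the
sets `slot j` for the times `j = 1, …, n`, and the next sample time `next i` of each element,
with `next i = n + 1` if `i` is not scheduled before the next rebuild. -/
structure State (n : ℕ) where
  p : Fin n → I
  now : ℕ
  slot : ℕ → Finset (Fin n)
  next : Fin n → ℕ

variable {n : ℕ}

/-- Schedule element `i` at time `j`. -/
def State.insert (s : State n) (i : Fin n) (j : ℕ) : State n :=
  { s with slot := Function.update s.slot j (Insert.insert i (s.slot j))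
           next := Function.update s.next i j }

/-- Remove element `i` from the set in which it is scheduled, if there is one. -/
def State.remove (s : State n) (i : Fin n) : State n :=
  if s.next i ≠ n + 1 then
    { s with slot := Function.update s.slot (s.next i) ((s.slot (s.next i)).erase i) }
  else s

/-- The for-loop of `set`: `m` iterations, with loop variable `j, j + 1, …, j + m - 1`. -/
def State.loop (i : Fin n) : ℕ → ℕ → State n → PMF (State n)
  | 0, _, s => PMF.pure { s with next := Function.update s.next i (n + 1) }
  | m + 1, j, s => (coin (s.p i)).bind fun b =>
      if b then PMF.pure (s.insert i j) else State.loop i m (j + 1) s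

/-- The operation `set(i, α)`. -/
def State.set (i : Fin n) (α : I) (s : State n) : PMF (State n) :=
  let s' := s.remove i
  State.loop i (n + 1 - s.now) s.now { s' with p := Function.update s'.p i α }

/-- Call `set(i, p i)` for all `i` in a list. -/
def State.setAll : List (Fin n) → State n → PMF (State n)
  | [], s => PMF.pure s
  | i :: l, s => (s.set i (s.p i)).bind (State.setAll l)

/-- The operation `init(n, p)`. -/
def State.init (p : Fin n → I) : PMF (State n) :=
  State.setAll (List.finRange n)
    { p := p, now := 1, slot := fun _ => ∅, next := fun _ => n + 1 }

/-- The operation `sample()`. -/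
def State.sample (s : State n) : PMF (Finset (Fin n) × State n) :=
  let T := s.slot s.now
  let s' : State n := { s with now := s.now + 1 }
  (if s'.now < n + 1 then State.setAll ((List.finRange n).filter (· ∈ T)) s'
    else State.setAll (List.finRange n) { s' with now := 1 }).map fun s'' => (T, s'')

/-- The algorithm as a randomized data structure. -/
def algorithm (n : ℕ) (p : Fin n → I) : Sampler n (State n) where
  start := State.init p
  set := State.set
  sample := State.sample

/-! ## The word RAM -/

/-- Operations on `w`-bit words. -/
inductive BinOp where
  | add | sub | mul | mulHi | div | mod | and | or | xor | shl | shr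

def BinOp.eval {w : ℕ} : BinOp → BitVec w → BitVec w → BitVec w
  | add, x, y => x + y
  | sub, x, y => x - y
  | mul, x, y => x * y
  | mulHi, x, y => BitVec.ofNat w (x.toNat * y.toNat / 2 ^ w)
  | div, x, y => x / y
  | mod, x, y => x % y
  | and, x, y => x &&& y
  | or, x, y => x ||| y
  | xor, x, y => x ^^^ y
  | shl, x, y => x <<< y.toNat
  | shr, x, y => x >>> y.toNat

/-- Tests on two registers. -/
inductive Test where
  | eq (r s : ℕ)
  | lt (r s : ℕ)

/-- Elementary instructions. Registers are named by natural numbers. The memory consists of arrays,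
also named by natural numbers (constants of the program); a cell of an array is addressed
by a word that is computed at run time. -/
inductive Instr where
  /-- `r ← c` -/
  | const (r c : ℕ)
  /-- `r ← s` -/
  | move (r s : ℕ)
  /-- `r ← s op t` -/
  | bin (op : BinOp) (r s t : ℕ)
  /-- `r ← a[s]` -/
  | load (r a s : ℕ)
  /-- `a[s] ← t` -/
  | store (a s t : ℕ)
  /-- `r ←` a uniformly random word -/
  | rand (r : ℕ)
  /-- append the word in `r` to the output -/
  | emit (r : ℕ)

/-- Programs. They are finite texts and do not depend on the word size. -/
inductive Code where
  | skip
  | instr (i : Instr)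
  | seq (a b : Code)
  | ite (c : Test) (a b : Code)
  | while (c : Test) (a : Code)

/-- Contents of the registers and of the memory of a machine with `w`-bit words. -/
structure Store (w : ℕ) where
  reg : ℕ → BitVec w
  mem : ℕ → BitVec w → BitVec w

variable {w : ℕ}

/-- Assignment to a register. -/
def Store.setReg (m : Store w) (r : ℕ) (x : BitVec w) : Store w :=
  { m with reg := Function.update m.reg r x }

/-- Assignment to a memory cell. -/
def Store.setMem (m : Store w) (a : ℕ) (x y : BitVec w) : Store w :=
  { m with mem := Function.update m.mem a (Function.update (m.mem a) x y) }

def Test.eval (m : Store w) : Test → Prop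
  | eq r s => m.reg r = m.reg s
  | lt r s => (m.reg r).toNat < (m.reg s).toNat

/-- A configuration: the code that remains to be executed, the store, and the output. The number of
steps made so far and the set of memory cells read or written so far are recorded only to measure
time and space; the program has no access to them. -/
structure Config (w : ℕ) where
  todo : List Code
  store : Store w
  out : List (BitVec w)
  time : ℕ
  touched : Finset (ℕ × BitVec w)

/-- The uniform law on `w`-bit words. -/
def uniformWord (w : ℕ) : PMF (BitVec w) :=
  (PMF.uniformOfFintype (Fin (2 ^ w))).map BitVec.ofFin

/-- The effect of an elementary instruction. -/
def Instr.exec (c : Config w) : Instr → PMF (Config w)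
  | const r k => PMF.pure { c with store := c.store.setReg r (BitVec.ofNat w k) }
  | move r s => PMF.pure { c with store := c.store.setReg r (c.store.reg s) }
  | bin op r s t =>
      PMF.pure { c with store := c.store.setReg r (op.eval (c.store.reg s) (c.store.reg t)) }
  | load r a s => PMF.pure
      { c with store := c.store.setReg r (c.store.mem a (c.store.reg s))
               touched := Insert.insert (a, c.store.reg s) c.touched }
  | store a s t => PMF.pure
      { c with store := c.store.setMem a (c.store.reg s) (c.store.reg t)
               touched := Insert.insert (a, c.store.reg s) c.touched }
  | rand r => (uniformWord w).map fun x => { c with store := c.store.setReg r x }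
  | emit r => PMF.pure { c with out := c.out ++ [c.store.reg r] }

open Classical in
/-- One step of the machine. Every step takes one unit of time; a configuration in which
nothing remains to be executed is halted and does not change. -/
def step (c : Config w) : PMF (Config w) :=
  match c.todo with
  | [] => PMF.pure c
  | Code.skip :: k => PMF.pure { c with todo := k, time := c.time + 1 }
  | Code.instr i :: k => i.exec { c with todo := k, time := c.time + 1 }
  | Code.seq a b :: k => PMF.pure { c with todo := a :: b :: k, time := c.time + 1 }
  | Code.ite t a b :: k => PMF.pure
      { c with todo := (if t.eval c.store then a else b) :: k, time := c.time + 1 }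
  | Code.while t a :: k => PMF.pure
      { c with todo := if t.eval c.store then a :: Code.while t a :: k else k
               time := c.time + 1 }

/-- The law of the configuration after `t` steps. -/
def steps (c₀ : Config w) : ℕ → PMF (Config w)
  | 0 => PMF.pure c₀
  | t + 1 => (steps c₀ t).bind step

open Classical in
/-- The probability to halt in the configuration `c`, when started with the clock at `0` in `c₀`.
As the clock stops when the machine halts, `c` can only be reached at time `c.time`. -/
def haltMass (c₀ c : Config w) : ℝ≥0∞ :=
  if c.todo = [] then steps c₀ c.time c else 0

theorem steps_mono (c₀ c : Config w) (hc : c.todo = []) {s t : ℕ} (h : s ≤ t) :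
    steps c₀ s c ≤ steps c₀ t c := by
  induction t, h using Nat.le_induction with
  | base => exact le_rfl
  | succ t _ ih =>
    refine ih.trans ?_
    have hstep : step c = PMF.pure c := by unfold step; rw [hc]
    change _ ≤ ((steps c₀ t).bind step) c
    rw [PMF.bind_apply]
    refine le_trans ?_ (ENNReal.le_tsum c)
    rw [hstep]
    simp

theorem tsum_haltMass_le (c₀ : Config w) : ∑' c, haltMass c₀ c ≤ 1 := by
  classical
  rw [ENNReal.tsum_eq_iSup_sum]
  refine iSup_le fun F => ?_
  calc ∑ c ∈ F, haltMass c₀ c ≤ ∑ c ∈ F, steps c₀ (F.sup Config.time) c := by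
        refine Finset.sum_le_sum fun c hc => ?_
        unfold haltMass
        split_ifs with h
        · exact steps_mono c₀ c h (Finset.le_sup hc)
        · exact zero_le
    _ ≤ ∑' c, steps c₀ (F.sup Config.time) c := ENNReal.sum_le_tsum F
    _ = 1 := PMF.tsum_coe _

/-- The law of the halting configuration of a run; `none` stands for a run that never halts. -/
def runLaw (c₀ : Config w) : PMF (Option (Config w)) :=
  ⟨fun o => o.elim (1 - ∑' c, haltMass c₀ c) (haltMass c₀), by
    have h : ∑' o : Option (Config w),
        o.elim (1 - ∑' c, haltMass c₀ c) (haltMass c₀) = 1 := by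
      classical
      rw [ENNReal.tsum_eq_add_tsum_ite none,
        ← (Option.some_injective (Config w)).tsum_eq (fun o ho => ?_)]
      · simpa using tsub_add_cancel_of_le (tsum_haltMass_le c₀)
      · cases o with
        | none => simp at ho
        | some c => exact ⟨c, rfl⟩
    have hs := (ENNReal.summable (f := fun o : Option (Config w) =>
      o.elim (1 - ∑' c, haltMass c₀ c) (haltMass c₀))).hasSum
    rwa [h] at hs⟩

theorem runLaw_some (c₀ c : Config w) : runLaw c₀ (some c) = haltMass c₀ c := rfl

/-- The expected running time (`⊤` if the run fails to halt with positive probability). -/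
def meanTime (μ : PMF (Option (Config w))) : ℝ≥0∞ :=
  ∑' o, μ o * o.elim ⊤ fun c => (c.time : ℝ≥0∞)

/-! ## Set samplers on the word RAM -/

/-- A program for each of the three operations. -/
structure Program where
  init : Code
  set : Code
  sample : Code

/-- The start of a call: the arguments are put into the registers `0, 1, …`; the other registers
and the memory are as the previous call left them. -/
def callConfig (P : Code) (args : List (BitVec w)) (m : Store w)
    (touched : Finset (ℕ × BitVec w)) : Config w where
  todo := [P]
  store := { m with reg := fun r => (args[r]?).getD (m.reg r) }
  out := []
  time := 0
  touched := touched

/-- The `j`-th digit of `α` in base `2 ^ w`; `j = 0` is the integer part. -/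
def digit (w : ℕ) (α : I) (j : ℕ) : BitVec w :=
  BitVec.ofNat w ⌊(α : ℝ) * 2 ^ (w * j)⌋₊

/-- `α` is a fixed-point number with (at most) `κ` fractional words. -/
def HasPrecision (κ w : ℕ) (α : I) : Prop :=
  ∃ a : ℕ, (α : ℝ) * 2 ^ (w * κ) = a

/-- The words that represent a fixed-point probability. -/
def digits (κ w : ℕ) (α : I) : List (BitVec w) :=
  (List.range (κ + 1)).map (digit w α)

/-- The input vector `p` is stored in the arrays `0, …, κ`, one for each digit; nothing is assumed
about the other cells and the registers. -/
def HoldsInput (κ : ℕ) (p : Fin n → I) (m : Store w) : Prop :=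
  ∀ j ≤ κ, ∀ i : Fin n, m.mem j (BitVec.ofNat w i) = digit w (p i) j

/-- The state of the machine between two calls. The set of cells touched since the start of `init`
and the total number of steps spent in `sample` are recorded only to measure space and time. -/
structure Session (w : ℕ) where
  store : Store w
  touched : Finset (ℕ × BitVec w)
  sampleTime : ℕ

def initLaw (P : Program) (n : ℕ) (m : Store w) : PMF (Option (Config w)) :=
  runLaw (callConfig P.init [BitVec.ofNat w n] m ∅)

def setLaw (P : Program) (κ : ℕ) (i : Fin n) (α : I) (s : Session w) :
    PMF (Option (Config w)) :=
  runLaw (callConfig P.set (BitVec.ofNat w i :: digits κ w α) s.store s.touched)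

def sampleLaw (P : Program) (s : Session w) : PMF (Option (Config w)) :=
  runLaw (callConfig P.sample [] s.store s.touched)

open Classical in
/-- The subset of `Fin n` listed by an output; the elements have to be listed without repetition. -/
def readSet (n : ℕ) (out : List (BitVec w)) : Option (Finset (Fin n)) :=
  if out.Nodup ∧ ∀ x ∈ out, x.toNat < n then
    some (Finset.univ.filter fun i : Fin n => BitVec.ofNat w i ∈ out)
  else none

/-- The data structure that the program implements when it is started on the store `m`. The
state `none` means that a call did not halt or that its output was not a set. -/
def ram (P : Program) (κ n : ℕ) (m : Store w) : Sampler n (Option (Session w)) where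
  start := (initLaw P n m).map fun o => o.map fun c => ⟨c.store, c.touched, 0⟩
  set i α
    | none => PMF.pure none
    | some s => (setLaw P κ i α s).map fun o =>
        o.map fun c => ⟨c.store, c.touched, s.sampleTime⟩
  sample
    | none => PMF.pure (∅, none)
    | some s => (sampleLaw P s).map fun
      | none => (∅, none)
      | some c => match readSet n c.out with
        | none => (∅, none)
        | some T => (T, some ⟨c.store, c.touched, s.sampleTime + c.time⟩)

/-- The expected total time of the calls of `sample`, for a joint law of state and transcript. -/
def meanSampleTime (μ : PMF (Option (Session w) × List (Event n))) : ℝ≥0∞ :=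
  ∑' x, μ x * x.1.elim ⊤ fun s => (s.sampleTime : ℝ≥0∞)

/-- The expectation of `∑ (1 + |T|)` over the calls of `sample`. -/
def meanSampleWork {S : Type} (μ : PMF (S × List (Event n))) : ℝ≥0∞ :=
  ∑' x, μ x * (sampleWork x.2 : ℝ≥0∞)

end SetSampler

end

open scoped ENNReal unitInterval

noncomputable section

namespace SetSampler

variable {n : ℕ}

/-! ## Product laws -/

-- Correctness is the principle of deferred decisions. Up to the encoding `mkState`, a state
-- consists of `p`, the number `c` of samples since the last rebuild and a vector `τ` of next sample
-- times. The invariant `play_algorithm` says that, given the transcript, the `τ i` are independent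
-- with law `nextLaw n c (p i)`, the truncated waiting time for a success of a `p i`-coin, just as
-- if they were drawn now. A request is a random function of the transcript alone, so it tells
-- nothing about `τ`. A call of `set` redraws one coordinate. For `sample`, geometric laws are
-- memoryless: the event `τ i = c` is a `p i`-coin, and under either outcome the coordinate ends up
-- with the fresh law for the next time, because due elements are redrawn and the others are
-- conditioned on being later. Hence the returned set has the ideal law and is independent of the
-- new times (`fresh_refresh`).
--
-- For the implementation, the main task is to draw exactly from `nextLaw` in constant expected
-- time, without running through the trials one by one. The trials are grouped into blocks of length
-- `b`, roughly `1 / α`. One random word is divided by `d + 1`, where `d` is the first fractional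
-- digit of `α`: the quotient proposes a position, and the remainder, compared with the digits of
-- `α`, decides on rejection. Every position below `b` is proposed with probability exactly `α`
-- (`drawLaw_apply`). A proposal `v` has to survive with probability `(1 - α) ^ v`, because `α * (1
-- - α) ^ v` is the geometric mass (`gap_eq_proposal`). Such a coin comes from the method of von
-- Neumann and Forsythe: go on proposing while the positions decrease, and use the parity of the
-- length (`coin_failProb`). The expected length is `(1 + α) ^ v`, bounded because `b * α ≤ 1`. A
-- whole block fails with probability at most `4 / 5`, unless a single block covers all trials, so
-- boundedly many blocks are expected (`runs_search`).
--
-- The slots are doubly linked lists (`Linked`), so moving an element takes constant time. A call of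
-- `sample` pops one list; only the call that rebuilds touches all `n` elements, and it is paid by a
-- potential proportional to the clock (`answer_ram`).
--
-- Law and expected time of a program are proved together in the judgement `Runs`, which couples the
-- final machine state with a random variable of prescribed law and composes sequentially
-- (`Runs.append_mean`). The induction `play_ram` carries law, reachable states and potential
-- through the interaction with the adversary.

theorem bind_congr_of_support {A B : Type*} (μ : PMF A) (f : A → PMF B) (g : A → PMF B)
    (h : ∀ x ∈ μ.support, f x = g x) : μ.bind f = μ.bind g := by
  ext y
  rw [PMF.bind_apply, PMF.bind_apply]
  refine tsum_congr fun x => ?_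
  by_cases hx : μ x = 0
  · simp [hx]
  · rw [h x ((PMF.mem_support_iff _ _).2 hx)]

/-- Distributivity by splitting off one coordinate; in `ℝ≥0∞` no summability is needed. The
normalization of product laws and `piLaw_bind` rest on it. -/
theorem tsum_prod_eq_prod_tsum {β : Type*} : ∀ (n : ℕ) (F : Fin n → β → ℝ≥0∞),
    ∑' g : Fin n → β, ∏ i, F i (g i) = ∏ i, ∑' x, F i x
  | 0, F => by simp
  | n + 1, F => by
    rw [← (Fin.consEquiv fun _ => β).tsum_eq, ENNReal.tsum_prod', Fin.prod_univ_succ,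
      ← tsum_prod_eq_prod_tsum n, ← ENNReal.tsum_mul_right]
    refine tsum_congr fun x => ?_
    rw [← ENNReal.tsum_mul_left]
    refine tsum_congr fun g => ?_
    rw [Fin.prod_univ_succ]
    simp [Fin.consEquiv]

/-- The joint law of independent random variables. -/
def piLaw {β : Type*} (μ : Fin n → PMF β) : PMF (Fin n → β) :=
  ⟨fun g => ∏ i, μ i (g i), by
    have h : ∑' g : Fin n → β, ∏ i, μ i (g i) = 1 := by
      rw [tsum_prod_eq_prod_tsum]; simp
    have hs := (ENNReal.summable (f := fun g : Fin n → β => ∏ i, μ i (g i))).hasSum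
    rwa [h] at hs⟩

theorem piLaw_apply {β : Type*} (μ : Fin n → PMF β) (g : Fin n → β) :
    piLaw μ g = ∏ i, μ i (g i) := rfl

/-- Independent coordinates stay independent when each passes through a kernel of its own. Redrawing
some of the sample times is of this form. -/
theorem piLaw_bind {β γ : Type*} (μ : Fin n → PMF β) (κ : Fin n → β → PMF γ) :
    (piLaw μ).bind (fun g => piLaw fun i => κ i (g i)) = piLaw fun i => (μ i).bind (κ i) := by
  ext h
  simp only [PMF.bind_apply, piLaw_apply, ← Finset.prod_mul_distrib]
  exact tsum_prod_eq_prod_tsum n fun i x => μ i x * κ i x (h i)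

theorem piLaw_pure {β : Type*} (g : Fin n → β) : piLaw (fun i => PMF.pure (g i)) = PMF.pure g := by
  classical
  ext h
  rw [piLaw_apply]
  simp only [PMF.pure_apply]
  rw [Finset.prod_ite_zero]
  simp [funext_iff]

theorem piLaw_map {β γ : Type*} (μ : Fin n → PMF β) (f : Fin n → β → γ) :
    (piLaw μ).map (fun g i => f i (g i)) = piLaw fun i => (μ i).map (f i) := by
  have := piLaw_bind μ fun i x => PMF.pure (f i x)
  simp only [piLaw_pure] at this
  exact this

theorem piLaw_update {β : Type*} (g : Fin n → β) (i : Fin n) (ν : PMF β) :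
    piLaw (Function.update (fun j => PMF.pure (g j)) i ν) = ν.map (Function.update g i) := by
  classical
  ext h
  rw [piLaw_apply, PMF.map_apply, ← Finset.mul_prod_erase _ _ (Finset.mem_univ i)]
  rw [tsum_eq_single (h i)]
  · rw [Function.update_self]
    have h1 : ∏ j ∈ Finset.univ.erase i,
        Function.update (fun j => PMF.pure (g j)) i ν j (h j) =
        ∏ j ∈ Finset.univ.erase i, if h j = g j then 1 else 0 := by
      refine Finset.prod_congr rfl fun j hj => ?_
      rw [Function.update_of_ne (Finset.ne_of_mem_erase hj), PMF.pure_apply]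
    rw [h1, Finset.prod_ite_zero]
    by_cases hh : h = Function.update g i (h i)
    · rw [if_pos hh, if_pos]
      · simp
      · intro j hj
        rw [hh, Function.update_of_ne (Finset.ne_of_mem_erase hj)]
    · rw [if_neg hh, if_neg, mul_zero]
      intro hc
      apply hh
      ext j
      by_cases hj : j = i
      · subst hj; simp
      · rw [Function.update_of_ne hj]; exact hc j (by simp [hj])
  · intro x hx
    rw [if_neg]
    intro hh
    apply hx
    rw [hh]; simp

/-- Resample the coordinates in `S` and keep the others. -/
def resample {β : Type*} (ν : Fin n → PMF β) (S : Finset (Fin n)) (g : Fin n → β) :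
    PMF (Fin n → β) :=
  piLaw fun i => if i ∈ S then ν i else PMF.pure (g i)

theorem resample_empty {β : Type*} (ν : Fin n → PMF β) (g : Fin n → β) :
    resample ν ∅ g = PMF.pure g := by
  simp [resample, piLaw_pure]

theorem resample_univ {β : Type*} (ν : Fin n → PMF β) (g : Fin n → β) :
    resample ν Finset.univ g = piLaw ν := by
  simp [resample]

/-- Redrawing coordinates one after the other or all at once gives the same law. This turns the
loops of the algorithm and of the machine into a single product law, whatever the order of the
elements. -/
theorem resample_insert {β : Type*} (ν : Fin n → PMF β) {S : Finset (Fin n)} {i : Fin n}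
    (hi : i ∉ S) (g : Fin n → β) :
    resample ν (insert i S) g =
      (ν i).bind fun x => resample ν S (Function.update g i x) := by
  classical
  have h := piLaw_bind (Function.update (fun j => PMF.pure (g j)) i (ν i))
    (fun j x => if j ∈ S then ν j else PMF.pure x)
  rw [piLaw_update, PMF.bind_map] at h
  change _ = (ν i).bind ((fun g' => piLaw fun j => if j ∈ S then ν j else PMF.pure (g' j)) ∘
    Function.update g i)
  rw [h, resample]
  congr 1
  funext j
  by_cases hj : j = i
  · subst hj
    rw [Function.update_self, if_pos (Finset.mem_insert_self _ _)]
    simp [hi]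
  · rw [Function.update_of_ne hj]
    simp [hj]

/-! ## The waiting time for the first success -/

/-- The law of the number of failures before the first success in `m` trials; it is `m` if there
is no success. -/
def gap (α : I) : ℕ → PMF ℕ
  | 0 => PMF.pure 0
  | m + 1 => (coin α).bind fun b => if b then PMF.pure 0 else (gap α m).map (1 + ·)

theorem gap_le (α : I) : ∀ (m : ℕ), ∀ g ∈ (gap α m).support, g ≤ m
  | 0, g, hg => by simp [gap] at hg; omega
  | m + 1, g, hg => by
    rw [gap, PMF.mem_support_bind_iff] at hg
    obtain ⟨b, _, hb⟩ := hg
    cases b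
    · simp only [Bool.false_eq_true, if_false, PMF.mem_support_map_iff] at hb
      obtain ⟨x, hx, rfl⟩ := hb
      have := gap_le α m x hx
      omega
    · simp at hb; omega

/-- The state of the algorithm that is determined by the vector `p`, the number `c` of samples
since the last rebuild, and the sample times `τ i + 1`. -/
def mkState (p : Fin n → I) (c : ℕ) (τ : Fin n → ℕ) : State n where
  p := p
  now := c + 1
  slot j := Finset.univ.filter fun i => τ i + 1 = j ∧ τ i ≠ n
  next i := τ i + 1

/-- The coins of the loop matter only through the number of failures before the first success. The
hypothesis on `j + m` says that the last trial is the one for time `n`. -/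
theorem loop_eq (i : Fin n) : ∀ (m j : ℕ) (s : State n), j + m = n + 1 →
    State.loop i m j s = (gap (s.p i) m).map fun g =>
      if g < m then s.insert i (j + g)
      else { s with next := Function.update s.next i (n + 1) }
  | 0, j, s, _ => by simp [State.loop, gap, PMF.pure_map]
  | m + 1, j, s, h => by
    rw [State.loop, gap, PMF.map_bind]
    congr 1
    funext b
    cases b
    · simp only [Bool.false_eq_true, if_false]
      rw [loop_eq i m (j + 1) s (by omega), PMF.map_comp]
      congr 1
      funext g
      simp [Nat.add_assoc, Nat.add_comm 1 g]
    · simp [PMF.pure_map]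

/-- The law of the next sample time of an element (minus one), at relative time `c + 1`. -/
def nextLaw (n c : ℕ) (α : I) : PMF ℕ := (gap α (n - c)).map (c + ·)

/-- States of the form `mkState` are closed under `set`, so slots and times need not be tracked
separately. The value `n` of `τ i` encodes an element that is not scheduled and belongs to no slot;
this is why the old value (anything to remove?) and the new one (anything to insert?) are split into
cases. -/
theorem set_mkState (i : Fin n) (α : I) (p : Fin n → I) {c : ℕ} (hc : c ≤ n) (τ : Fin n → ℕ) :
    State.set i α (mkState p c τ) = (nextLaw n c α).map fun x =>
      mkState (Function.update p i α) c (Function.update τ i x) := by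
  classical
  unfold State.set
  rw [loop_eq]
  swap
  · by_cases h : (mkState p c τ).next i ≠ n + 1 <;> simp [mkState] <;> omega
  have hp : ∀ s : State n, ({ s with p := Function.update s.p i α } : State n).p i = α := by
    intro s; simp
  rw [hp, nextLaw, PMF.map_comp]
  have hm : n + 1 - (mkState p c τ).now = n - c := by simp [mkState]
  rw [hm]
  unfold PMF.map
  ext s
  rw [PMF.bind_apply, PMF.bind_apply]
  refine tsum_congr fun g => ?_
  by_cases hg : gap α (n - c) g = 0
  · simp [hg]
  have hgm := gap_le α (n - c) g ((PMF.mem_support_iff _ _).2 hg)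
  congr 2
  simp only [Function.comp_apply]
  congr 1
  by_cases hi : τ i = n
  · split_ifs with hlt
    · simp only [State.insert, State.remove, mkState, hi, ne_eq, not_true_eq_false, if_false]
      congr 1
      · funext j
        by_cases hj : j = c + 1 + g
        · subst hj
          rw [Function.update_self]
          ext k
          by_cases hk : k = i
          · subst hk; simp; omega
          · simp [hk]
        · rw [Function.update_of_ne hj]
          ext k
          by_cases hk : k = i
          · subst hk; simp [hi]; omega
          · simp [hk]
      · funext k
        by_cases hk : k = i
        · subst hk; simp; omega
        · simp [hk]
    · simp only [State.remove, mkState, hi, ne_eq, not_true_eq_false, if_false]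
      have : c + g = n := by omega
      congr 1
      · funext j
        ext k
        by_cases hk : k = i
        · subst hk; simp [hi, this]
        · simp [hk]
      · funext k
        by_cases hk : k = i
        · subst hk; simp; omega
        · simp [hk]
  · split_ifs with hlt
    · simp only [State.insert, State.remove, mkState, ne_eq, Nat.add_right_cancel_iff, hi,
        not_false_eq_true, if_true]
      congr 1
      · funext j
        ext k
        by_cases hk : k = i
        · subst hk
          by_cases hj : j = c + 1 + g
          · subst hj; simp; omega
          · by_cases hj' : j = τ k + 1
            · subst hj'
              rw [Function.update_of_ne hj, Function.update_self]
              simp; omega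
            · rw [Function.update_of_ne hj, Function.update_of_ne hj']
              simp; omega
        · by_cases hj : j = c + 1 + g
          · subst hj
            rw [Function.update_self]
            by_cases hj' : c + 1 + g = τ i + 1
            · rw [hj']; simp [hk]
            · rw [Function.update_of_ne hj']; simp [hk]
          · rw [Function.update_of_ne hj]
            by_cases hj' : j = τ i + 1
            · subst hj'; simp [hk]
            · rw [Function.update_of_ne hj']; simp [hk]
      · funext k
        by_cases hk : k = i
        · subst hk; simp; omega
        · simp [hk]
    · simp only [State.remove, mkState, ne_eq, Nat.add_right_cancel_iff, hi,
        not_false_eq_true, if_true]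
      have : c + g = n := by omega
      congr 1
      · funext j
        ext k
        by_cases hk : k = i
        · subst hk
          by_cases hj' : j = τ k + 1
          · subst hj'
            simp [this]
          · rw [Function.update_of_ne hj']
            simp [this]; omega
        · by_cases hj' : j = τ i + 1
          · subst hj'; simp [hk]
          · rw [Function.update_of_ne hj']; simp [hk]
      · funext k
        by_cases hk : k = i
        · subst hk; simp; omega
        · simp [hk]

theorem setAll_mkState (p : Fin n → I) {c : ℕ} (hc : c ≤ n) :
    ∀ (l : List (Fin n)), l.Nodup → ∀ τ : Fin n → ℕ,
      State.setAll l (mkState p c τ) =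
        (resample (fun i => nextLaw n c (p i)) l.toFinset τ).map (mkState p c)
  | [], _, τ => by simp [State.setAll, resample_empty, PMF.pure_map]
  | i :: l, hl, τ => by
    have hi : i ∉ l.toFinset := by simpa using (List.nodup_cons.1 hl).1
    rw [State.setAll, set_mkState _ _ _ hc, List.toFinset_cons, resample_insert _ hi,
      PMF.bind_map, PMF.map_bind]
    congr 1
    funext x
    simp only [Function.comp_apply]
    have : Function.update p i ((mkState p c τ).p i) = p := by simp [mkState]
    rw [this, setAll_mkState p hc l (List.nodup_cons.1 hl).2]

theorem init_eq (p : Fin n → I) :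
    State.init p = (piLaw fun i => nextLaw n 0 (p i)).map (mkState p 0) := by
  have : ({ p := p, now := 1, slot := fun _ => ∅, next := fun _ => n + 1 } : State n) =
      mkState p 0 fun _ => n := by
    simp [mkState]
  rw [State.init, this, setAll_mkState p (Nat.zero_le n) _ (List.nodup_finRange n)]
  rw [List.toFinset_finRange, resample_univ]

/-- The elements that are scheduled for the next call of `sample`. -/
def due (c : ℕ) (τ : Fin n → ℕ) : Finset (Fin n) := Finset.univ.filter fun i => τ i = c

theorem slot_mkState (p : Fin n → I) {c : ℕ} (hc : c < n) (τ : Fin n → ℕ) :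
    (mkState p c τ).slot (mkState p c τ).now = due c τ := by
  ext i
  simp [mkState, due]
  omega

/-- The law of the sample times after a call of `sample`. -/
def refresh (p : Fin n → I) (c : ℕ) (τ : Fin n → ℕ) : PMF (Fin n → ℕ) :=
  if c + 1 < n then resample (fun i => nextLaw n (c + 1) (p i)) (due c τ) τ
  else piLaw fun i => nextLaw n 0 (p i)

/-- Advancing or resetting the clock leaves slots and times alone, so the state before the redraws
is again of the form `mkState`. -/
theorem sample_mkState (p : Fin n → I) {c : ℕ} (hc : c < n) (τ : Fin n → ℕ) :
    State.sample (mkState p c τ) =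
      (refresh p c τ).map fun τ' => (due c τ, mkState p ((c + 1) % n) τ') := by
  unfold State.sample
  simp only [slot_mkState p hc]
  by_cases h : c + 1 < n
  · have h1 : ({ mkState p c τ with now := (mkState p c τ).now + 1 } : State n) =
        mkState p (c + 1) τ := rfl
    have h2 : (mkState p c τ).now + 1 < n + 1 := by simp only [mkState]; omega
    rw [h1, if_pos h2, setAll_mkState p h.le _ ((List.nodup_finRange n).filter _), PMF.map_comp]
    rw [refresh, if_pos h, Nat.mod_eq_of_lt h]
    congr 2
    ext i; simp
  · have h1 : ({ mkState p c τ with now := 1 } : State n) = mkState p 0 τ := rfl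
    have h2 : ¬ (mkState p c τ).now + 1 < n + 1 := by simp only [mkState]; omega
    have h3 : c + 1 = n := by omega
    rw [h1, if_neg h2, setAll_mkState p (Nat.zero_le n) _ (List.nodup_finRange n), PMF.map_comp]
    rw [refresh, if_neg h, h3, Nat.mod_self, List.toFinset_finRange, resample_univ]
    rfl

/-! ## The algorithm is a dynamic set sampler -/

theorem coin_true (α : I) : coin α true = ENNReal.ofReal α := rfl

theorem coin_false (α : I) : coin α false = ENNReal.ofReal (1 - α) := rfl

theorem indepLaw_eq (p : Fin n → I) :
    indepLaw p = (piLaw fun i => coin (p i)).map fun b => Finset.univ.filter fun i => b i := by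
  classical
  ext T
  rw [PMF.map_apply, tsum_eq_single fun i => decide (i ∈ T)]
  · rw [if_pos (by ext; simp), piLaw_apply]
    change indepMass p T = _
    rw [indepMass, ← Finset.prod_mul_prod_compl T, Finset.compl_eq_univ_sdiff]
    congr 1
    · refine Finset.prod_congr rfl fun i hi => ?_
      simp [hi, coin_true]
    · refine Finset.prod_congr rfl fun i hi => ?_
      have : i ∉ T := by simpa using hi
      simp [this, coin_false]
  · intro b hb
    rw [if_neg]
    rintro rfl
    apply hb
    funext i
    simp

/-- Both sides are images under `F` of a vector of independent pairs (is the element returned, its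
new time). It is therefore enough to compare the pairs coordinate by coordinate. -/
theorem coupled_resample (p : Fin n → I) (μ ν : Fin n → PMF ℕ) (c : ℕ)
    (κ : Fin n → ℕ → PMF ℕ)
    (h : ∀ i, (μ i).bind (fun x => (κ i x).map fun y => (decide (x = c), y)) =
      (coin (p i)).bind fun b => (ν i).map fun y => (b, y)) :
    (piLaw μ).bind (fun τ => (piLaw fun i => κ i (τ i)).map fun τ' => (due c τ, τ')) =
      (indepLaw p).bind fun T => (piLaw ν).map fun τ' => (T, τ') := by
  let F : (Fin n → Bool × ℕ) → Finset (Fin n) × (Fin n → ℕ) :=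
    fun g => (Finset.univ.filter fun i => (g i).1, fun i => (g i).2)
  have h1 : ∀ (b : Fin n → Bool) (ρ : Fin n → PMF ℕ),
      (piLaw ρ).map (fun τ' => (Finset.univ.filter fun i => b i, τ')) =
      (piLaw fun i => (ρ i).map fun y => (b i, y)).map F := by
    intro b ρ
    rw [← piLaw_map, PMF.map_comp]
    rfl
  have h2 : (fun τ : Fin n → ℕ => (piLaw fun i => κ i (τ i)).map fun τ' => (due c τ, τ')) =
      fun τ => (piLaw fun i => (κ i (τ i)).map fun y => (decide (τ i = c), y)).map F := by
    funext τ
    rw [← h1 (fun i => decide (τ i = c))]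
    simp [due]
  rw [h2, ← PMF.map_bind, piLaw_bind μ fun i x => (κ i x).map fun y => (decide (x = c), y),
    indepLaw_eq, PMF.bind_map]
  have h3 : ((fun T => (piLaw ν).map fun τ' => (T, τ')) ∘
      fun b : Fin n → Bool => Finset.univ.filter fun i => b i) =
      fun b => (piLaw fun i => (ν i).map fun y => (b i, y)).map F := by
    funext b
    exact h1 b ν
  rw [h3, ← PMF.map_bind, piLaw_bind (fun i => coin (p i)) fun i b => (ν i).map fun y => (b, y)]
  simp only [h]

/-- Memorylessness: the returned set and the new times are jointly distributed as an ideal sample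
and independent fresh times. This is the heart of the first claim. -/
theorem fresh_refresh (p : Fin n → I) {c : ℕ} (hc : c < n) :
    (piLaw fun i => nextLaw n c (p i)).bind
        (fun τ => (refresh p c τ).map fun τ' => (due c τ, τ')) =
      (indepLaw p).bind fun T =>
        (piLaw fun i => nextLaw n ((c + 1) % n) (p i)).map fun τ' => (T, τ') := by
  -- The outcome of the first trial is separated from the others.
  have hgap : ∀ i, nextLaw n c (p i) = (coin (p i)).bind fun b =>
      if b then PMF.pure c else nextLaw n (c + 1) (p i) := by
    intro i
    obtain ⟨m, hm⟩ : ∃ m, n - c = m + 1 := ⟨n - c - 1, by omega⟩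
    have hm' : n - (c + 1) = m := by omega
    rw [nextLaw, nextLaw, hm, hm', gap, PMF.map_bind]
    congr 1
    funext b
    cases b
    · simp only [Bool.false_eq_true, if_false]
      rw [PMF.map_comp]
      congr 1
      funext g
      simp only [Function.comp_apply]
      omega
    · simp [PMF.pure_map]
  -- After a failure the time is later than `c`, so the event "due now" recovers the first coin.
  have hne : ∀ i, ∀ x ∈ (nextLaw n (c + 1) (p i)).support, x ≠ c := by
    intro i x hx
    rw [nextLaw, PMF.mem_support_map_iff] at hx
    obtain ⟨y, _, rfl⟩ := hx
    omega
  by_cases h : c + 1 < n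
  · have h2 := coupled_resample p (fun i => nextLaw n c (p i))
      (fun i => nextLaw n (c + 1) (p i)) c
      (fun i x => if x = c then nextLaw n (c + 1) (p i) else PMF.pure x) ?_
    · rw [Nat.mod_eq_of_lt h, ← h2]
      congr 1
      funext τ
      rw [refresh, if_pos h, resample]
      simp [due]
    · intro i
      rw [hgap, PMF.bind_bind]
      congr 1
      funext b
      cases b
      · simp only [Bool.false_eq_true, if_false]
        rw [PMF.map]
        refine bind_congr_of_support _ _ _ fun x hx => ?_
        simp [hne i x hx, PMF.pure_map]
      · simp
  -- At a rebuild all old times are discarded, so independence of the returned set is immediate.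
  · have h3 : c + 1 = n := by omega
    have h2 := coupled_resample p (fun i => nextLaw n c (p i))
      (fun i => nextLaw n 0 (p i)) c (fun i x => nextLaw n 0 (p i)) ?_
    · rw [h3, Nat.mod_self, ← h2]
      congr 1
      funext τ
      rw [refresh, if_neg h]
    · intro i
      rw [hgap, PMF.bind_bind]
      congr 1
      funext b
      cases b
      · simp only [Bool.false_eq_true, if_false]
        rw [bind_congr_of_support _ _ (fun _ => (nextLaw n 0 (p i)).map fun y => (false, y))
          fun x hx => ?_]
        · rw [PMF.bind_const]
        · simp [hne i x hx]
      · simp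

/-- The relative time (minus one), computed from a transcript. -/
def ticks : List (Event n) → ℕ
  | [] => 0
  | Event.set _ _ :: h => ticks h
  | Event.sample _ :: h => (ticks h + 1) % n

theorem ticks_lt (hn : 1 ≤ n) : ∀ h : List (Event n), ticks h < n
  | [] => hn
  | Event.set _ _ :: h => ticks_lt hn h
  | Event.sample _ :: _ => Nat.mod_lt _ hn

/-- The old value of the coordinate is forgotten, so the product form persists with one factor
exchanged. -/
theorem fresh_set (p : Fin n → I) (c : ℕ) (i : Fin n) (α : I) :
    (piLaw fun j => nextLaw n c (p j)).bind
        (fun τ => (nextLaw n c α).map fun x => Function.update τ i x) =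
      piLaw fun j => nextLaw n c (Function.update p i α j) := by
  have h1 : (fun τ : Fin n → ℕ => (nextLaw n c α).map fun x => Function.update τ i x) =
      fun τ => piLaw fun j => if j = i then nextLaw n c α else PMF.pure (τ j) := by
    funext τ
    rw [← piLaw_update]
    congr 1
    funext j
    simp [Function.update_apply]
  rw [h1, piLaw_bind _ fun j x => if j = i then nextLaw n c α else PMF.pure x]
  congr 1
  funext j
  by_cases hj : j = i <;> simp [hj]

/-- Given the transcript, the sample times are independent and distributed as if they had just
been drawn. -/
theorem play_algorithm (hn : 1 ≤ n) (p : Fin n → I) (adv : Adversary n) : ∀ k : ℕ,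
    (algorithm n p).play adv k = ((ideal n p).play adv k).bind fun x =>
      (piLaw fun i => nextLaw n (ticks x.2) (x.1 i)).map fun τ =>
        (mkState x.1 (ticks x.2) τ, x.2)
  | 0 => by
    simp [Sampler.play, algorithm, ideal, init_eq, PMF.pure_map, PMF.map_comp, ticks]
    rfl
  | k + 1 => by
    rw [Sampler.play, play_algorithm hn p adv k, Sampler.play, PMF.bind_bind, PMF.bind_bind]
    congr 1
    funext ⟨q, h⟩
    have hc := ticks_lt hn h
    simp only [PMF.bind_map, PMF.bind_bind]
    change (piLaw fun i => nextLaw n (ticks h) (q i)).bind (fun τ => (adv h).bind _) = _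
    -- The request depends on the transcript only, so it may be drawn before the hidden sample
    -- times. This is where the adversary's ignorance of the internal state enters.
    rw [PMF.bind_comm]
    congr 1
    funext o
    cases o with
    | set i α =>
      simp only [algorithm, ideal, PMF.pure_map, PMF.pure_bind, ticks]
      rw [← fresh_set q (ticks h) i α, PMF.map_bind]
      congr 1
      funext τ
      rw [set_mkState _ _ _ hc.le, PMF.map_comp, PMF.map_comp]
      rfl
    | sample =>
      simp only [algorithm, ideal, PMF.map_comp, PMF.bind_map]
      have h1 := congrArg (PMF.map fun y : Finset (Fin n) × (Fin n → ℕ) =>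
        (mkState q ((ticks h + 1) % n) y.2, Event.sample y.1 :: h)) (fresh_refresh q hc)
      rw [PMF.map_bind, PMF.map_bind] at h1
      simp only [PMF.map_comp] at h1
      refine Eq.trans ?_ (h1.trans ?_)
      · congr 1
        funext τ
        rw [sample_mkState q hc, PMF.map_comp]
        rfl
      · rfl

theorem transcript_law (hn : 1 ≤ n) (p : Fin n → I) (adv : Adversary n) (k : ℕ) :
    ((algorithm n p).play adv k).map Prod.snd = ((ideal n p).play adv k).map Prod.snd := by
  rw [play_algorithm hn, PMF.map_bind]
  unfold PMF.map
  congr 1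
  funext x
  rw [PMF.bind_bind]
  simp

/-! ## Expectations -/

/-- The expectation of `f` under `μ`. -/
def mean {A : Type*} (μ : PMF A) (f : A → ℝ≥0∞) : ℝ≥0∞ := ∑' x, μ x * f x

section Mean
variable {A B : Type*}

theorem mean_pure (a : A) (f : A → ℝ≥0∞) : mean (PMF.pure a) f = f a := by
  classical
  rw [mean, tsum_eq_single a]
  · simp
  · intro b hb; simp [PMF.pure_apply, hb]

theorem mean_bind (μ : PMF A) (ν : A → PMF B) (f : B → ℝ≥0∞) :
    mean (μ.bind ν) f = mean μ fun x => mean (ν x) f := by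
  simp only [mean, PMF.bind_apply, ← ENNReal.tsum_mul_right, ← ENNReal.tsum_mul_left]
  rw [ENNReal.tsum_comm]
  simp only [mul_assoc]

theorem mean_map (μ : PMF A) (g : A → B) (f : B → ℝ≥0∞) :
    mean (μ.map g) f = mean μ fun x => f (g x) := by
  rw [PMF.map, mean_bind]
  simp only [Function.comp_apply, mean_pure]

theorem mean_mono (μ : PMF A) {f g : A → ℝ≥0∞} (h : ∀ x ∈ μ.support, f x ≤ g x) :
    mean μ f ≤ mean μ g := by
  refine ENNReal.tsum_le_tsum fun x => ?_
  by_cases hx : μ x = 0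
  · simp [hx]
  · gcongr
    exact h x ((PMF.mem_support_iff _ _).2 hx)

theorem mean_add (μ : PMF A) (f g : A → ℝ≥0∞) :
    mean μ (fun x => f x + g x) = mean μ f + mean μ g := by
  simp only [mean, mul_add, ENNReal.tsum_add]

theorem mean_const (μ : PMF A) (c : ℝ≥0∞) : mean μ (fun _ => c) = c := by
  rw [mean, ENNReal.tsum_mul_right, μ.tsum_coe, one_mul]

theorem mean_const_mul (μ : PMF A) (c : ℝ≥0∞) (f : A → ℝ≥0∞) :
    mean μ (fun x => c * f x) = c * mean μ f := by
  rw [mean, mean, ← ENNReal.tsum_mul_left]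
  exact tsum_congr fun x => by ring

theorem mean_le_of_forall (μ : PMF A) {f : A → ℝ≥0∞} {c : ℝ≥0∞} (h : ∀ x ∈ μ.support, f x ≤ c) :
    mean μ f ≤ c :=
  (mean_mono μ h).trans_eq (mean_const μ c)

/-- Two laws that agree at all points but one are equal. -/
theorem law_ext_of_ne {p q : PMF A} (a : A) (h : ∀ x, x ≠ a → p x = q x) : p = q := by
  classical
  have hp := p.tsum_coe
  have hq := q.tsum_coe
  rw [ENNReal.tsum_eq_add_tsum_ite a] at hp hq
  have hs : ∑' x, (if x = a then 0 else p x) = ∑' x, if x = a then 0 else q x :=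
    tsum_congr fun x => by
      by_cases hx : x = a
      · simp [hx]
      · simp [hx, h x hx]
  rw [hs] at hp
  have hne : ∑' x, (if x = a then 0 else q x) ≠ ⊤ :=
    ne_top_of_le_ne_top ENNReal.one_ne_top (hq ▸ le_add_self)
  ext x
  by_cases hx : x = a
  · subst hx
    exact (ENNReal.add_left_inj hne).1 (hp.trans hq.symm)
  · exact h x hx

/-- The mass of `none` is whatever remains, so laws of runs need to be compared at halting
configurations only. -/
theorem option_law_ext {p q : PMF (Option A)} (h : ∀ a, p (some a) = q (some a)) : p = q := by
  refine law_ext_of_ne none fun x hx => ?_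
  cases x with
  | none => exact absurd rfl hx
  | some a => exact h a

end Mean

/-! ## Runs of the machine -/

section Machine
variable {w : ℕ}

theorem step_halted {c : Config w} (h : c.todo = []) : step c = PMF.pure c := by
  unfold step; rw [h]

theorem step_time {c c' : Config w} (h : c.todo ≠ []) (hc : c' ∈ (step c).support) :
    c'.time = c.time + 1 := by
  unfold step at hc
  split at hc
  · exact absurd ‹_› h
  · simp at hc; rw [hc]
  · rename_i i k _
    cases i
    case rand r =>
      simp only [Instr.exec, PMF.mem_support_map_iff] at hc
      obtain ⟨x, _, rfl⟩ := hc
      rfl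
    all_goals simp [Instr.exec] at hc; rw [hc]
  all_goals simp at hc; rw [hc]

/-- The clock of a running configuration has counted all steps, whereas that of a halted one may
have stopped earlier. -/
theorem steps_time {c₀ c : Config w} : ∀ {t : ℕ}, c ∈ (steps c₀ t).support →
    c.time ≤ c₀.time + t ∧ (c.todo ≠ [] → c.time = c₀.time + t)
  | 0, h => by
    simp [steps] at h; simp [h]
  | t + 1, h => by
    rw [steps, PMF.mem_support_bind_iff] at h
    obtain ⟨c', h1, h2⟩ := h
    have ih := steps_time h1
    by_cases hc' : c'.todo = []
    · rw [step_halted hc'] at h2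
      simp at h2
      subst h2
      exact ⟨by omega, fun hn => absurd hc' hn⟩
    · have := step_time hc' h2
      have := ih.2 hc'
      exact ⟨by omega, fun _ => by omega⟩

/-- New mass at step `t + 1` can only come from a running configuration, and then its clock shows
more than `t`. So nothing arrives at `c` any more. -/
theorem steps_succ_eq {c₀ c : Config w} (h : c.todo = []) {t : ℕ} (ht : c.time ≤ t) :
    steps c₀ (t + 1) c = steps c₀ t c := by
  rw [steps, PMF.bind_apply, tsum_eq_single c]
  · rw [step_halted h]; simp
  · intro c' hne
    by_cases h1 : steps c₀ t c' = 0
    · simp [h1]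
    have h2 := steps_time ((PMF.mem_support_iff _ _).2 h1)
    rw [mul_eq_zero]
    right
    by_contra h3
    by_cases h4 : c'.todo = []
    · rw [step_halted h4, PMF.pure_apply] at h3
      simp at h3
      exact hne h3.symm
    · have h5 := step_time h4 ((PMF.mem_support_iff _ _).2 h3)
      have := h2.2 h4
      omega

theorem steps_succ_front (c₀ : Config w) : ∀ t : ℕ,
    steps c₀ (t + 1) = (step c₀).bind fun c => steps c t
  | 0 => by simp [steps]
  | t + 1 => by
    rw [steps, steps_succ_front c₀ t, PMF.bind_bind]
    rfl

/-- The Markov property at the first step. The definition of `haltMass` looks at step number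
`c.time`; by `steps_succ_eq` looking one step later changes nothing, and this makes room for the
first step. On this identity the program logic is built. -/
theorem runLaw_step (c₀ : Config w) : runLaw c₀ = (step c₀).bind runLaw := by
  refine option_law_ext fun c => ?_
  rw [PMF.bind_apply]
  simp only [runLaw_some, haltMass]
  split_ifs with h
  · rw [← steps_succ_eq h le_rfl, steps_succ_front, PMF.bind_apply]
  · simp

theorem runLaw_halted {c : Config w} (h : c.todo = []) : runLaw c = PMF.pure (some c) := by
  classical
  have h1 : ∀ t, steps c t = PMF.pure c := by
    intro t
    induction t with
    | zero => rfl
    | succ t ih => rw [steps, ih, PMF.pure_bind, step_halted h]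
  refine option_law_ext fun d => ?_
  simp only [runLaw_some, haltMass, h1, PMF.pure_apply]
  by_cases hd : d = c
  · subst hd; simp [h]
  · simp [hd]

/-! ## A program logic for laws and expected running times -/

/-- What a program acts on: a configuration without control and clock. -/
structure Core (w : ℕ) where
  store : Store w
  out : List (BitVec w)
  touched : Finset (ℕ × BitVec w)

/-- The content of a register. -/
abbrev Core.reg (s : Core w) (r : ℕ) : BitVec w := s.store.reg r

def Core.config (s : Core w) (k : List Code) (T : ℕ) : Config w :=
  ⟨k, s.store, s.out, T, s.touched⟩

/-- Started in `s`, the codes in the list `l` terminate almost surely. The outcome can be described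
by a random variable with law `μ` so that `Q` holds between its value and the final state,
and the expected running time is at most `t`. -/
def Runs {A : Type} (l : List Code) (s : Core w) (μ : PMF A) (Q : A → Core w → Prop)
    (t : ℝ≥0∞) : Prop :=
  ∃ ρ : PMF (A × Core w × ℕ), ρ.map Prod.fst = μ ∧ (∀ x ∈ ρ.support, Q x.1 x.2.1) ∧
    mean ρ (fun x => (x.2.2 : ℝ≥0∞)) ≤ t ∧
    ∀ (k : List Code) (T : ℕ), runLaw (s.config (l ++ k) T) =
      ρ.bind fun x => runLaw (x.2.1.config k (T + x.2.2))

variable {A B : Type} {s : Core w} {μ : PMF A} {Q : A → Core w → Prop} {t t₁ t₂ : ℝ≥0∞}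
  {l l₁ l₂ : List Code}

theorem Runs.nil {a : A} (h : Q a s) : Runs [] s (PMF.pure a) Q 0 := by
  refine ⟨PMF.pure (a, s, 0), by rw [PMF.pure_map], ?_, ?_, ?_⟩
  · intro x hx
    simp at hx; subst hx; exact h
  · rw [mean_pure]; simp
  · intro k T
    simp

/-- For every outcome of the first part a coupling for the second part is chosen, and the two are
glued. The cost of the second part may depend on the outcome `a`, and only its mean enters; this is
what makes expected times of loops accessible by recursion. -/
theorem Runs.append_mean {ν : A → PMF B} {R : B → Core w → Prop} {t₂ : A → ℝ≥0∞}
    (h₁ : Runs l₁ s μ Q t₁)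
    (h₂ : ∀ a ∈ μ.support, ∀ s', Q a s' → Runs l₂ s' (ν a) R (t₂ a)) :
    Runs (l₁ ++ l₂) s (μ.bind ν) R (t₁ + mean μ t₂) := by
  obtain ⟨ρ, hρ, hQ, ht, hrun⟩ := h₁
  have hex : ∀ x : A × Core w × ℕ, ∃ ρ' : PMF (B × Core w × ℕ), x ∈ ρ.support →
      ρ'.map Prod.fst = ν x.1 ∧ (∀ y ∈ ρ'.support, R y.1 y.2.1) ∧
      mean ρ' (fun y => (y.2.2 : ℝ≥0∞)) ≤ t₂ x.1 ∧
      ∀ (k : List Code) (T : ℕ), runLaw (x.2.1.config (l₂ ++ k) T) =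
        ρ'.bind fun y => runLaw (y.2.1.config k (T + y.2.2)) := by
    intro x
    by_cases hx : x ∈ ρ.support
    · have hx1 : x.1 ∈ μ.support := by
        rw [← hρ, PMF.mem_support_map_iff]; exact ⟨x, hx, rfl⟩
      obtain ⟨ρ', h⟩ := h₂ x.1 hx1 x.2.1 (hQ x hx)
      exact ⟨ρ', fun _ => h⟩
    -- Outside the support any law will do, but the choice below needs one.
    · exact ⟨(ν x.1).map fun y => (y, x.2.1, 0), fun h => absurd h hx⟩
  choose ρ' hρ' using hex
  refine ⟨ρ.bind fun x => (ρ' x).map fun y => (y.1, y.2.1, x.2.2 + y.2.2), ?_, ?_, ?_, ?_⟩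
  · rw [PMF.map_bind, ← hρ, PMF.bind_map]
    refine bind_congr_of_support _ _ _ fun x hx => ?_
    rw [PMF.map_comp]
    exact (hρ' x hx).1
  · intro y hy
    rw [PMF.mem_support_bind_iff] at hy
    obtain ⟨x, hx, hy⟩ := hy
    rw [PMF.mem_support_map_iff] at hy
    obtain ⟨z, hz, rfl⟩ := hy
    exact (hρ' x hx).2.1 z hz
  · rw [mean_bind]
    have : ∀ x ∈ ρ.support, mean ((ρ' x).map fun y => (y.1, y.2.1, x.2.2 + y.2.2))
        (fun y => (y.2.2 : ℝ≥0∞)) ≤ (x.2.2 : ℝ≥0∞) + t₂ x.1 := by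
      intro x hx
      rw [mean_map]
      simp only [Nat.cast_add]
      rw [mean_add, mean_const]
      gcongr
      exact (hρ' x hx).2.2.1
    refine (mean_mono ρ this).trans ?_
    rw [mean_add, ← hρ, mean_map]
    gcongr
  · intro k T
    rw [List.append_assoc, hrun, PMF.bind_bind]
    refine bind_congr_of_support _ _ _ fun x hx => ?_
    rw [(hρ' x hx).2.2.2, PMF.bind_map]
    simp only [Function.comp_def, Nat.add_assoc]

theorem Runs.map {R : B → Core w → Prop} (h : Runs l s μ Q t₁) (f : A → B)
    (hQ : ∀ a ∈ μ.support, ∀ s', Q a s' → R (f a) s') (ht : t₁ ≤ t) :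
    Runs l s (μ.map f) R t := by
  have := h.append_mean (l₂ := []) (ν := fun a => PMF.pure (f a)) (t₂ := fun _ => 0)
    (fun a ha s' hs => Runs.nil (hQ a ha s' hs))
  rw [List.append_nil, mean_const, add_zero] at this
  obtain ⟨ρ, h1, h2, h3, h4⟩ := this
  exact ⟨ρ, h1, h2, h3.trans ht, h4⟩

theorem Runs.conseq {R : A → Core w → Prop} (h : Runs l s μ Q t₁)
    (hQ : ∀ a ∈ μ.support, ∀ s', Q a s' → R a s') (ht : t₁ ≤ t) : Runs l s μ R t := by
  have := h.map id hQ ht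
  rwa [PMF.map_id] at this

theorem Runs.mono (h : Runs l s μ Q t₁) (ht : t₁ ≤ t) : Runs l s μ Q t :=
  h.conseq (fun _ _ _ hq => hq) ht

theorem Runs.append {ν : A → PMF B} {R : B → Core w → Prop}
    (h₁ : Runs l₁ s μ Q t₁)
    (h₂ : ∀ a ∈ μ.support, ∀ s', Q a s' → Runs l₂ s' (ν a) R t₂) :
    Runs (l₁ ++ l₂) s (μ.bind ν) R (t₁ + t₂) := by
  have := h₁.append_mean (t₂ := fun _ => t₂) h₂
  rwa [mean_const] at this

/-- The first part is deterministic. -/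
theorem Runs.append_pure {a : A} {ν : PMF B} {R : B → Core w → Prop}
    (h₁ : Runs l₁ s (PMF.pure a) Q t₁) (h₂ : ∀ s', Q a s' → Runs l₂ s' ν R t₂) :
    Runs (l₁ ++ l₂) s ν R (t₁ + t₂) := by
  have := h₁.append (ν := fun _ => ν) (R := R) (t₂ := t₂) (l₂ := l₂) fun b hb s' hs => by
    simp at hb; subst hb; exact h₂ s' hs
  rwa [PMF.bind_const] at this

/-- A step that only affects the control. -/
theorem Runs.tick {l' : List Code} (h : Runs l' s μ Q t)
    (hstep : ∀ k T, step (s.config (l ++ k) T) = PMF.pure (s.config (l' ++ k) (T + 1))) :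
    Runs l s μ Q (1 + t) := by
  obtain ⟨ρ, h1, h2, h3, h4⟩ := h
  refine ⟨ρ.map fun x => (x.1, x.2.1, 1 + x.2.2), ?_, ?_, ?_, ?_⟩
  · rw [PMF.map_comp]; exact h1
  · intro x hx
    rw [PMF.mem_support_map_iff] at hx
    obtain ⟨y, hy, rfl⟩ := hx
    exact h2 y hy
  · rw [mean_map]
    simp only [Nat.cast_add, Nat.cast_one]
    rw [mean_add, mean_const]
    gcongr
  · intro k T
    rw [runLaw_step, hstep, PMF.pure_bind, h4, PMF.bind_map]
    simp only [Function.comp_def, Nat.add_assoc]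

theorem Runs.skip (h : Runs l s μ Q t) : Runs (Code.skip :: l) s μ Q (1 + t) :=
  h.tick fun _ _ => rfl

theorem Runs.seq {a b : Code} (h : Runs (a :: b :: l) s μ Q t) :
    Runs (Code.seq a b :: l) s μ Q (1 + t) :=
  h.tick fun _ _ => rfl

theorem Runs.ite_pos {c : Test} {a b : Code} (hc : c.eval s.store) (h : Runs (a :: l) s μ Q t) :
    Runs (Code.ite c a b :: l) s μ Q (1 + t) :=
  h.tick fun _ _ => by simp [step, Core.config, hc]

theorem Runs.ite_neg {c : Test} {a b : Code} (hc : ¬ c.eval s.store) (h : Runs (b :: l) s μ Q t) :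
    Runs (Code.ite c a b :: l) s μ Q (1 + t) :=
  h.tick fun _ _ => by simp [step, Core.config, hc]

theorem Runs.ite {c : Test} {a b : Code} (ha : c.eval s.store → Runs (a :: l) s μ Q t)
    (hb : ¬ c.eval s.store → Runs (b :: l) s μ Q t) :
    Runs (Code.ite c a b :: l) s μ Q (1 + t) := by
  by_cases hc : c.eval s.store
  · exact (ha hc).ite_pos hc
  · exact (hb hc).ite_neg hc

theorem Runs.while_pos {c : Test} {a : Code} (hc : c.eval s.store)
    (h : Runs (a :: Code.while c a :: l) s μ Q t) :
    Runs (Code.while c a :: l) s μ Q (1 + t) :=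
  h.tick fun _ _ => by simp [step, Core.config, hc]

theorem Runs.while_neg {c : Test} {a : Code} (hc : ¬ c.eval s.store) (h : Runs l s μ Q t) :
    Runs (Code.while c a :: l) s μ Q (1 + t) :=
  h.tick fun _ _ => by simp [step, Core.config, hc]

/-- The effect of an instruction that draws no random word. -/
def Instr.apply (s : Core w) : Instr → Core w
  | const r k => { s with store := s.store.setReg r (BitVec.ofNat w k) }
  | move r r' => { s with store := s.store.setReg r (s.store.reg r') }
  | bin op r r' t => { s with store := s.store.setReg r (op.eval (s.store.reg r') (s.store.reg t)) }
  | load r a r' =>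
      { s with store := s.store.setReg r (s.store.mem a (s.store.reg r'))
               touched := Insert.insert (a, s.store.reg r') s.touched }
  | store a r' t =>
      { s with store := s.store.setMem a (s.store.reg r') (s.store.reg t)
               touched := Insert.insert (a, s.store.reg r') s.touched }
  | rand _ => s
  | emit r => { s with out := s.out ++ [s.store.reg r] }

def Instr.deterministic : Instr → Bool
  | rand _ => false
  | _ => true

theorem Runs.instr {i : Instr} (hi : i.deterministic) (h : Runs l (i.apply s) μ Q t) :
    Runs (Code.instr i :: l) s μ Q (1 + t) := by
  obtain ⟨ρ, h1, h2, h3, h4⟩ := h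
  refine ⟨ρ.map fun x => (x.1, x.2.1, 1 + x.2.2), ?_, ?_, ?_, ?_⟩
  · rw [PMF.map_comp]; exact h1
  · intro x hx
    rw [PMF.mem_support_map_iff] at hx
    obtain ⟨y, hy, rfl⟩ := hx
    exact h2 y hy
  · rw [mean_map]
    simp only [Nat.cast_add, Nat.cast_one]
    rw [mean_add, mean_const]
    gcongr
  · intro k T
    have : step (s.config (Code.instr i :: l ++ k) T) =
        PMF.pure ((i.apply s).config (l ++ k) (T + 1)) := by
      cases i
      case rand => simp [Instr.deterministic] at hi
      all_goals rfl
    rw [runLaw_step, this, PMF.pure_bind, h4, PMF.bind_map]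
    simp only [Function.comp_def, Nat.add_assoc]

theorem Runs.rand (r : ℕ) (Q : BitVec w → Core w → Prop)
    (hQ : ∀ x, Q x { s with store := s.store.setReg r x }) :
    Runs [Code.instr (Instr.rand r)] s (uniformWord w) Q 1 := by
  refine ⟨(uniformWord w).map fun x => (x, { s with store := s.store.setReg r x }, 1),
    ?_, ?_, ?_, ?_⟩
  · rw [PMF.map_comp]; exact PMF.map_id _
  · intro x hx
    rw [PMF.mem_support_map_iff] at hx
    obtain ⟨y, hy, rfl⟩ := hx
    exact hQ y
  · rw [mean_map]
    simp only [Nat.cast_one]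
    rw [mean_const]
  · intro k T
    rw [runLaw_step, PMF.bind_map]
    change ((uniformWord w).map _).bind _ = _
    rw [PMF.bind_map]
    rfl

/-- A list of instructions as a program. -/
def block : List Instr → Code
  | [] => Code.skip
  | i :: l => Code.seq (Code.instr i) (block l)

theorem Runs.block : ∀ {L : List Instr} {s : Core w}, L.all Instr.deterministic →
    Runs l (L.foldl Instr.apply s) μ Q t →
    Runs (SetSampler.block L :: l) s μ Q ((2 * L.length + 1 : ℕ) + t)
  | [], s, _, h => by
    refine h.skip.mono (le_of_eq ?_)
    simp
  | i :: L, s, hL, h => by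
    simp only [List.all_cons, Bool.and_eq_true] at hL
    refine ((Runs.block hL.2 h).instr hL.1).seq.mono (le_of_eq ?_)
    simp only [List.length_cons]
    push_cast
    ring

/-- The law of the run of a call. -/
theorem Runs.runLaw_eq {c : Code} (h : Runs [c] s μ Q t) :
    ∃ ρ : PMF (A × Core w × ℕ), ρ.map Prod.fst = μ ∧ (∀ x ∈ ρ.support, Q x.1 x.2.1) ∧
      mean ρ (fun x => (x.2.2 : ℝ≥0∞)) ≤ t ∧
      runLaw (s.config [c] 0) = ρ.map fun x => some (x.2.1.config [] x.2.2) := by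
  obtain ⟨ρ, h1, h2, h3, h4⟩ := h
  refine ⟨ρ, h1, h2, h3, ?_⟩
  have := h4 [] 0
  rw [List.append_nil] at this
  rw [this, PMF.map]
  congr 1
  funext x
  rw [runLaw_halted rfl]
  simp

theorem Runs.meanTime_le {c : Code} (h : Runs [c] s μ Q t) :
    meanTime (runLaw (s.config [c] 0)) ≤ t := by
  obtain ⟨ρ, _, _, h3, h4⟩ := h.runLaw_eq
  rw [h4]
  change mean _ _ ≤ _
  rw [mean_map]
  exact h3

end Machine

/-! ## Laws that the program simulates -/

section Laws

theorem uniformWord_bind_apply {w : ℕ} {B : Type*} (f : BitVec w → PMF B) (b : B) :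
    (uniformWord w).bind f b = (2 ^ w : ℝ≥0∞)⁻¹ *
      ∑ r ∈ Finset.range (2 ^ w), f (BitVec.ofNat w r) b := by
  rw [uniformWord, PMF.bind_map, PMF.bind_apply, tsum_fintype, Finset.mul_sum,
    ← Fin.sum_univ_eq_sum_range fun r => (2 ^ w : ℝ≥0∞)⁻¹ * f (BitVec.ofNat w r) b]
  refine Finset.sum_congr rfl fun r _ => ?_
  rw [PMF.uniformOfFintype_apply]
  simp only [Fintype.card_fin, Function.comp_apply, Nat.cast_pow, Nat.cast_ofNat]
  congr 3
  apply BitVec.eq_of_toNat_eq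
  simp

/-- The digits of `α` are the base `2 ^ w` digits of the integer `a`, because `α = a / 2 ^ (w * κ)`.
-/
theorem digit_toNat {κ w : ℕ} {α : I} {a j : ℕ} (ha : (α : ℝ) * 2 ^ (w * κ) = a) (hj : j ≤ κ) :
    (digit w α j).toNat = a / 2 ^ (w * (κ - j)) % 2 ^ w := by
  rw [digit, BitVec.toNat_ofNat]
  congr 1
  have h : (α : ℝ) * 2 ^ (w * j) = (a : ℝ) / ((2 ^ (w * (κ - j)) : ℕ) : ℝ) := by
    rw [← ha, eq_div_iff (by positivity)]
    push_cast
    rw [mul_assoc, ← pow_add, ← mul_add, Nat.add_sub_cancel' hj]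
  rw [h, Nat.floor_div_natCast, Nat.floor_natCast]

mutual
/-- The law of the comparison of a uniformly random fixed-point number with the last `m` digits
of `α`. -/
def acceptLaw (κ w : ℕ) (α : I) : ℕ → PMF Bool
  | 0 => PMF.pure false
  | m + 1 => (uniformWord w).bind (acceptAt κ w α m)

/-- The same, after the first digit has been drawn. -/
def acceptAt (κ w : ℕ) (α : I) (m : ℕ) (x : BitVec w) : PMF Bool :=
  if x.toNat < (digit w α (κ - m)).toNat then PMF.pure true
  else if (digit w α (κ - m)).toNat < x.toNat then PMF.pure false
  else acceptLaw κ w α m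
end

theorem acceptAt_true {κ w : ℕ} {α : I} (m : ℕ) (x : BitVec w) :
    acceptAt κ w α m x true =
      (if x.toNat < (digit w α (κ - m)).toNat then 1 else 0) +
        if x.toNat = (digit w α (κ - m)).toNat then acceptLaw κ w α m true else 0 := by
  rw [acceptAt]
  rcases lt_trichotomy x.toNat (digit w α (κ - m)).toNat with h | h | h
  · simp [h, h.ne]
  · simp [h]
  · simp [h, h.ne', h.not_gt]

theorem sum_range_lt_or_eq (c : ℝ≥0∞) {d N : ℕ} (h : d < N) :
    ∑ r ∈ Finset.range N, ((if r < d then 1 else 0) + if r = d then c else 0) = d + c := by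
  rw [Finset.sum_add_distrib, Finset.sum_boole, Finset.sum_ite_eq', if_pos (Finset.mem_range.2 h)]
  congr 2
  have : (Finset.range N).filter (· < d) = Finset.range d := by
    ext x; simp; omega
  rw [this, Finset.card_range]

/-- Comparison is lexicographic: a leading digit `d` contributes `d / 2 ^ w`, and a tie, of
probability `1 / 2 ^ w`, contributes the fraction formed by the remaining digits. In total this is
the value of the last `m` digits, read as a fraction. -/
theorem acceptLaw_true {κ w : ℕ} {α : I} {a : ℕ} (ha : (α : ℝ) * 2 ^ (w * κ) = a) :
    ∀ m : ℕ, m ≤ κ → acceptLaw κ w α m true = (a % 2 ^ (w * m) : ℕ) / (2 : ℝ≥0∞) ^ (w * m)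
  | 0, _ => by simp [acceptLaw, Nat.mod_one]
  | m + 1, hm => by
    rw [acceptLaw, uniformWord_bind_apply]
    have h1 : ∀ r ∈ Finset.range (2 ^ w), acceptAt κ w α m (BitVec.ofNat w r) true =
        (if r < (digit w α (κ - m)).toNat then 1 else 0) +
          if r = (digit w α (κ - m)).toNat then acceptLaw κ w α m true else 0 := by
      intro r hr
      rw [acceptAt_true, BitVec.toNat_ofNat, Nat.mod_eq_of_lt (Finset.mem_range.1 hr)]
    rw [Finset.sum_congr rfl h1, sum_range_lt_or_eq _ (BitVec.isLt _),
      acceptLaw_true ha m (by omega), digit_toNat ha (Nat.sub_le _ _),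
      Nat.sub_sub_self (by omega : m ≤ κ)]
    have h2 : a % 2 ^ (w * (m + 1)) =
        2 ^ (w * m) * (a / 2 ^ (w * m) % 2 ^ w) + a % 2 ^ (w * m) := by
      rw [mul_add, mul_one, pow_add, Nat.mod_mul]; ring
    rw [h2]
    push_cast
    have h3 : (2 : ℝ≥0∞) ^ (w * m) ≠ 0 := by positivity
    have h4 : (2 : ℝ≥0∞) ^ (w * m) ≠ ⊤ := by finiteness
    rw [mul_add w m 1, mul_one, pow_add, div_eq_mul_inv, div_eq_mul_inv,
      ENNReal.mul_inv (Or.inl h3) (Or.inl h4)]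
    generalize ((a / 2 ^ (w * m) % 2 ^ w : ℕ) : ℝ≥0∞) = d
    generalize ((a % 2 ^ (w * m) : ℕ) : ℝ≥0∞) = r
    calc (2 ^ w)⁻¹ * (d + r * (2 ^ (w * m))⁻¹)
        = (2 ^ w)⁻¹ * d * 1 + (2 ^ w)⁻¹ * r * (2 ^ (w * m))⁻¹ := by ring
      _ = (2 ^ w)⁻¹ * d * (2 ^ (w * m) * (2 ^ (w * m))⁻¹) +
          (2 ^ w)⁻¹ * r * (2 ^ (w * m))⁻¹ := by rw [ENNReal.mul_inv_cancel h3 h4]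
      _ = _ := by ring

/-- The law of the proposed position: it is `x` with probability `α`, for all small `x`. -/
def drawLaw (κ w : ℕ) (α : I) : PMF ℕ :=
  (uniformWord w).bind fun x =>
    (acceptAt κ w α (κ - 1) (x % (digit w α 1 + 1#w))).map fun b =>
      if b then (x / (digit w α 1 + 1#w)).toNat else 2 ^ w - 1

theorem toNat_add_one {w : ℕ} (d : BitVec w) :
    (d + 1#w).toNat = if d.toNat + 1 = 2 ^ w then 0 else d.toNat + 1 := by
  have hd := d.isLt
  rw [BitVec.toNat_add, BitVec.toNat_ofNat, Nat.add_mod_mod]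
  split_ifs with h
  · rw [h, Nat.mod_self]
  · rw [Nat.mod_eq_of_lt (by omega)]

/-- If `d` is the largest word, then `d + 1` overflows to zero. Dividing by the zero word gives
quotient zero and remainder `x`, which agrees with division by `2 ^ w`, so the program needs no
special case. -/
theorem toNat_div_succ {w : ℕ} (x d : BitVec w) :
    (x / (d + 1#w)).toNat = x.toNat / (d.toNat + 1) := by
  rw [BitVec.toNat_udiv, toNat_add_one]
  split_ifs with h
  · rw [h, Nat.div_eq_of_lt x.isLt, Nat.div_zero]
  · rfl

theorem toNat_mod_succ {w : ℕ} (x d : BitVec w) :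
    (x % (d + 1#w)).toNat = x.toNat % (d.toNat + 1) := by
  rw [BitVec.toNat_umod, toNat_add_one]
  split_ifs with h
  · rw [h, Nat.mod_eq_of_lt x.isLt, Nat.mod_zero]
  · rfl

/-- The numbers with quotient `x` form a complete group, in which each remainder occurs exactly
once. -/
theorem sum_range_div_eq (f : ℕ → ℝ≥0∞) {e x N : ℕ} (he : 0 < e) (h : (x + 1) * e ≤ N) :
    ∑ r ∈ Finset.range N, (if r / e = x then f (r % e) else 0) = ∑ r ∈ Finset.range e, f r := by
  rw [← Finset.sum_filter]
  refine Finset.sum_nbij' (fun r => r % e) (fun r => x * e + r) ?_ ?_ ?_ ?_ ?_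
  · intro r _
    exact Finset.mem_range.2 (Nat.mod_lt _ he)
  · intro r hr
    have hr := Finset.mem_range.1 hr
    simp only [Finset.mem_filter, Finset.mem_range]
    refine ⟨by nlinarith, ?_⟩
    rw [mul_comm, Nat.mul_add_div he, Nat.div_eq_of_lt hr, add_zero]
  · intro r hr
    have := (Finset.mem_filter.1 hr).2
    rw [← this, mul_comm]
    exact Nat.div_add_mod r e
  · intro r hr
    have hr := Finset.mem_range.1 hr
    simp [Nat.add_mod, Nat.mod_eq_of_lt hr]
  · intro r _
    rfl

/-- Write `d` for the first fractional digit. Exactly `d + 1` words propose `x`, one for each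
remainder: those with remainder below `d` are accepted, and remainder `d` is a tie to be settled by
the further digits. Hence the mass is `(d + r) / 2 ^ w` with `r` the fraction after the first digit,
and this is `α`. The bound `x < 2 ^ w - 1` separates `x` from the word that signals rejection. -/
theorem drawLaw_apply {κ w : ℕ} {α : I} (hκ : HasPrecision κ w α) (h1 : (α : ℝ) < 1) (h0 : 1 ≤ κ)
    {x : ℕ} (hx : x < 2 ^ w - 1) (hx' : (x + 1) * ((digit w α 1).toNat + 1) ≤ 2 ^ w) :
    drawLaw κ w α x = ENNReal.ofReal α := by
  obtain ⟨a, ha⟩ := hκ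
  obtain ⟨m, rfl⟩ : ∃ m, κ = m + 1 := ⟨κ - 1, by omega⟩
  have h2 : drawLaw (m + 1) w α x = (2 ^ w : ℝ≥0∞)⁻¹ * ∑ r ∈ Finset.range (2 ^ w),
      if r / ((digit w α 1).toNat + 1) = x then
        (if r % ((digit w α 1).toNat + 1) < (digit w α 1).toNat then 1 else 0) +
        (if r % ((digit w α 1).toNat + 1) = (digit w α 1).toNat then
          acceptLaw (m + 1) w α m true else 0) else 0 := by
    rw [drawLaw, uniformWord_bind_apply]
    congr 1
    refine Finset.sum_congr rfl fun r hr => ?_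
    have hr := Finset.mem_range.1 hr
    rw [PMF.map_apply, tsum_bool, toNat_div_succ, BitVec.toNat_ofNat, Nat.mod_eq_of_lt hr,
      Nat.add_sub_cancel, acceptAt_true, toNat_mod_succ, BitVec.toNat_ofNat, Nat.mod_eq_of_lt hr,
      Nat.add_sub_cancel_left]
    simp [hx.ne, eq_comm]
  rw [h2, sum_range_div_eq (fun r => (if r < (digit w α 1).toNat then 1 else 0) +
    (if r = (digit w α 1).toNat then acceptLaw (m + 1) w α m true else 0)) (Nat.succ_pos _) hx',
    sum_range_lt_or_eq _ (Nat.lt_succ_self _)]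
  -- A comparison that starts with a full random digit leads to the same count, so the mass can be
  -- read off `acceptLaw_true`.
  have h3 : acceptLaw (m + 1) w α (m + 1) true = (2 ^ w : ℝ≥0∞)⁻¹ *
      ((digit w α 1).toNat + acceptLaw (m + 1) w α m true) := by
    rw [acceptLaw, uniformWord_bind_apply]
    congr 1
    rw [← sum_range_lt_or_eq (acceptLaw (m + 1) w α m true) (digit w α 1).isLt]
    refine Finset.sum_congr rfl fun r hr => ?_
    have hr := Finset.mem_range.1 hr
    rw [acceptAt_true, BitVec.toNat_ofNat, Nat.mod_eq_of_lt hr, Nat.add_sub_cancel_left]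
  rw [← h3, acceptLaw_true ha _ le_rfl]
  have hlt : a < 2 ^ (w * (m + 1)) := by
    have : (a : ℝ) < 2 ^ (w * (m + 1)) := by
      rw [← ha]
      exact mul_lt_of_lt_one_left (by positivity) h1
    exact_mod_cast this
  rw [Nat.mod_eq_of_lt hlt]
  have : (α : ℝ) = a / 2 ^ (w * (m + 1)) := by
    rw [← ha]; field_simp
  rw [this, ENNReal.ofReal_div_of_pos (by positivity), ENNReal.ofReal_natCast,
    ENNReal.ofReal_pow (by norm_num)]
  simp

/-- The probability of `x` failures in a row. -/
def failProb (α : I) (x : ℕ) : I := unitInterval.symm α ^ x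

theorem coe_failProb (α : I) (x : ℕ) : (failProb α x : ℝ) = (1 - (α : ℝ)) ^ x := by
  simp [failProb]

theorem bool_law_ext {p q : PMF Bool} (h : p false = q false) : p = q :=
  law_ext_of_ne true fun x hx => by
    cases x
    · exact h
    · exact absurd rfl hx

theorem sum_geometric (α : ℝ) (L : ℕ) :
    ∑ x ∈ Finset.range L, α * (1 - α) ^ x = 1 - (1 - α) ^ L := by
  induction L with
  | zero => simp
  | succ L ih => rw [Finset.sum_range_succ, ih]; ring

/-- The parity of the length of a maximal decreasing sequence of proposals. The law is that of the
event that the first element is at least `L`, or the sequence that starts with the second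
one has odd length. -/
theorem coin_failProb {α : I} {μ : PMF ℕ} {L : ℕ} (h : ∀ x < L, μ x = ENNReal.ofReal α) :
    (μ.bind fun v => if v < L then (coin (failProb α v)).map not else PMF.pure true) =
      coin (failProb α L) := by
  -- The outcome `false` needs a proposal `x < L` and then the outcome `true` of the coin for `x`.
  -- Its probability is the sum of `α * (1 - α) ^ x` over `x < L`, which is `1 - (1 - α) ^ L`.
  refine bool_law_ext ?_
  rw [PMF.bind_apply, tsum_eq_sum (s := Finset.range L)]
  · have : ∀ x ∈ Finset.range L,
        μ x * (if x < L then (coin (failProb α x)).map not else PMF.pure true) false =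
        ENNReal.ofReal (α * (1 - α) ^ x) := by
      intro x hx
      have hx := Finset.mem_range.1 hx
      rw [h x hx, if_pos hx, ENNReal.ofReal_mul α.2.1]
      congr 1
      rw [PMF.map_apply, tsum_bool]
      simp [coin_true, coe_failProb]
    rw [Finset.sum_congr rfl this, ← ENNReal.ofReal_sum_of_nonneg, sum_geometric, coin_false,
      coe_failProb]
    intro x _
    have := α.2.1
    have : 0 ≤ 1 - (α : ℝ) := by linarith [α.2.2]
    positivity
  · intro x hx
    rw [if_neg (by simpa using hx)]
    simp

theorem gap_apply_of_lt (α : I) : ∀ {m x : ℕ}, x < m →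
    gap α m x = ENNReal.ofReal (α * (1 - α) ^ x)
  | m + 1, 0, _ => by
    rw [gap, PMF.bind_apply, tsum_bool]
    have : ∀ i, 0 ≠ 1 + i := by omega
    simp [coin_true, PMF.map_apply, this]
  | m + 1, x + 1, h => by
    rw [gap, PMF.bind_apply, tsum_bool]
    simp only [Bool.false_eq_true, if_false, if_true, PMF.map_apply]
    rw [tsum_eq_single x]
    · rw [if_pos (by omega), gap_apply_of_lt α (by omega : x < m), coin_false,
        ← ENNReal.ofReal_mul (by linarith [α.2.2])]
      simp
      congr 1; ring
    · intro y hy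
      rw [if_neg (by omega)]

theorem gap_self (α : I) : ∀ m : ℕ, gap α m m = ENNReal.ofReal ((1 - α) ^ m)
  | 0 => by simp [gap]
  | m + 1 => by
    rw [gap, PMF.bind_apply, tsum_bool]
    simp only [Bool.false_eq_true, if_false, if_true, PMF.map_apply]
    rw [tsum_eq_single m]
    · rw [if_pos (by omega), gap_self α m, coin_false, ← ENNReal.ofReal_mul (by linarith [α.2.2])]
      simp
      congr 1; ring
    · intro y hy
      rw [if_neg (by omega)]

/-- The outcome of a block of `b` trials, from a proposal and the parity of a decreasing
sequence. -/
theorem gap_eq_proposal {α : I} {μ : PMF ℕ} {b : ℕ} (h : ∀ x < b, μ x = ENNReal.ofReal α) :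
    (μ.bind fun v => (if v < b then (coin (failProb α v)).map not else PMF.pure true).map
      fun e => if e then b else v) = gap α b := by
  -- Below `b`, a proposal has mass `α` and survives with probability `(1 - α) ^ x`. The mass of
  -- `b`, a block without success, is then forced.
  refine law_ext_of_ne b fun x hx => ?_
  rw [PMF.bind_apply]
  by_cases hxb : x < b
  · rw [gap_apply_of_lt α hxb, tsum_eq_single x, h x hxb, if_pos hxb, ENNReal.ofReal_mul α.2.1]
    · congr 1
      rw [PMF.map_comp, PMF.map_apply, tsum_bool]
      simp [hx, coin_true, coe_failProb]
    · intro y hy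
      rw [mul_eq_zero]
      right
      rw [PMF.map_apply, tsum_bool]
      simp [hx, hy.symm]
  · rw [(PMF.apply_eq_zero_iff _ _).2 fun hs => hxb (lt_of_le_of_ne (gap_le α b x hs) hx)]
    rw [ENNReal.tsum_eq_zero]
    intro y
    rw [mul_eq_zero]
    right
    rw [PMF.map_apply, tsum_bool]
    by_cases hy : y < b
    · have : x ≠ y := by omega
      simp [hx, this]
    · simp [hy, hx]

/-- Run a block of `b` trials and, if all fail, the remaining `m - b`. The block may be longer than
`m`; a success beyond the last trial then counts as none, hence the minimum. -/
theorem gap_split (α : I) : ∀ b m : ℕ, gap α m = (gap α b).bind fun g =>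
    if g < b then PMF.pure (min g m) else
      if b < m then (gap α (m - b)).map (b + ·) else PMF.pure m
  | 0, m => by
    simp only [gap, PMF.pure_bind, lt_irrefl, if_false, Nat.sub_zero, zero_add]
    split_ifs with h
    · exact (PMF.map_id _).symm
    · obtain rfl : m = 0 := by omega
      rfl
  | b + 1, 0 => by
    have : ∀ g, (if g < b + 1 then PMF.pure (min g 0) else
      if b + 1 < 0 then (gap α (0 - (b + 1))).map (b + 1 + ·) else PMF.pure 0) =
        PMF.pure 0 := by
      intro g; simp
    simp only [this, PMF.bind_const]
    rfl
  | b + 1, m + 1 => by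
    rw [gap, gap, PMF.bind_bind]
    congr 1
    funext c
    cases c
    · simp only [Bool.false_eq_true, if_false]
      rw [gap_split α b m, PMF.bind_map, PMF.map_bind]
      congr 1
      funext g
      simp only [Function.comp_apply]
      by_cases hg : g < b
      · rw [if_pos hg, if_pos (by omega), PMF.pure_map]
        congr 1
        omega
      · rw [if_neg hg, if_neg (by omega : ¬ 1 + g < b + 1)]
        by_cases hb : b < m
        · rw [if_pos hb, if_pos (by omega), PMF.map_comp, Nat.add_sub_add_right]
          congr 1
          funext x
          simp only [Function.comp_apply]
          omega
        · rw [if_neg hb, if_neg (by omega), PMF.pure_map, add_comm]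
    · simp

theorem gap_one {m : ℕ} (hm : 0 < m) {α : I} (hα : (α : ℝ) = 1) : gap α m = PMF.pure 0 := by
  obtain ⟨m, rfl⟩ : ∃ k, m = k + 1 := ⟨m - 1, by omega⟩
  refine law_ext_of_ne 0 fun x hx => ?_
  rw [PMF.pure_apply, if_neg hx, gap, PMF.bind_apply, tsum_bool]
  simp [coin_false, hα, hx]

/-! ## Numerical estimates -/

/-- The right-hand side solves the recursion for the expected length of a decreasing sequence below
`L`: one draw, and from each `x < L`, hit with probability `a`, the expected length below `x`. -/
theorem one_add_sum_geometric (a : ℝ≥0∞) (L : ℕ) :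
    1 + ∑ x ∈ Finset.range L, a * (1 + a) ^ x = (1 + a) ^ L := by
  induction L with
  | zero => simp
  | succ L ih => rw [Finset.sum_range_succ, ← add_assoc, ih]; ring

theorem one_add_pow_le {α : I} {L : ℕ} (h : (L : ℝ) * α ≤ 1) :
    (1 + ENNReal.ofReal α) ^ L ≤ 3 := by
  have h0 := α.2.1
  have h1 : (1 + (α : ℝ)) ^ L ≤ 3 := by
    calc (1 + (α : ℝ)) ^ L ≤ (Real.exp α) ^ L := by
          gcongr
          rw [add_comm]; exact Real.add_one_le_exp _
      _ = Real.exp (L * α) := by rw [← Real.exp_nat_mul]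
      _ ≤ Real.exp 1 := Real.exp_le_exp.2 h
      _ ≤ 3 := by linarith [Real.exp_one_lt_d9]
  rw [← ENNReal.ofReal_one, ← ENNReal.ofReal_add zero_le_one h0,
    ← ENNReal.ofReal_pow (by positivity)]
  exact (ENNReal.ofReal_le_ofReal h1).trans (by simp)

/-- The product of `(1 - α) ^ b` and `(1 + α) ^ b` is at most `1`, and by Bernoulli's inequality the
second factor is at least `1 + b * α ≥ 5 / 4`. This bounds the probability that a whole block fails.
-/
theorem one_sub_pow_le {α : I} {b : ℕ} (h : 1 ≤ 4 * ((b : ℝ) * α)) :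
    5 * ((1 - (α : ℝ)) ^ b) ≤ 4 := by
  have h0 := α.2.1
  have h1 := α.2.2
  have h2 : 1 + (b : ℝ) * α ≤ (1 + (α : ℝ)) ^ b :=
    one_add_mul_le_pow (by linarith) b
  have h3 : (1 - (α : ℝ)) ^ b * (1 + (α : ℝ)) ^ b ≤ 1 := by
    rw [← mul_pow]
    exact pow_le_one₀ (mul_nonneg (by linarith) (by linarith)) (by nlinarith)
  have h4 : 0 ≤ (1 - (α : ℝ)) ^ b := pow_nonneg (by linarith) _
  nlinarith

end Laws

/-! ## The program: scheduling an element -/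

/-- Registers beyond those for the arguments of a call. The first three are not used as
temporary registers. -/
inductive Var where
  | size | clock | old
  | zero | one | ones | width | blk | time | bound | first | room | last | par | drawn | raw
  | slot | prev | succ

def Var.index : Var → ℕ
  | size => 0 | clock => 1 | old => 2
  | zero => 3 | one => 4 | ones => 5 | width => 6 | blk => 7 | time => 8 | bound => 9 | first => 10
  | room => 11 | last => 12 | par => 13 | drawn => 14 | raw => 15
  | slot => 16 | prev => 17 | succ => 18

theorem Var.index_inj {u v : Var} : u.index = v.index ↔ u = v := by
  constructor
  · cases u <;> cases v <;> simp [Var.index]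
  · rintro rfl; rfl

/-- The name of the register that holds a variable. -/
def var (κ : ℕ) (v : Var) : ℕ := κ + 2 + v.index

@[simp] theorem var_inj {κ : ℕ} {u v : Var} : var κ u = var κ v ↔ u = v := by
  rw [var, var, Nat.add_left_cancel_iff, Var.index_inj]

theorem le_var (κ : ℕ) (v : Var) : κ + 2 ≤ var κ v := Nat.le_add_right _ _

/-- The registers of the given variables. -/
def vars (κ : ℕ) (L : List Var) : Set ℕ := {r | ∃ v ∈ L, r = var κ v}

@[simp] theorem var_mem_vars {κ : ℕ} {v : Var} {L : List Var} : var κ v ∈ vars κ L ↔ v ∈ L := by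
  simp [vars]

theorem notMem_vars {κ r : ℕ} (h : r < κ + 2) (L : List Var) : r ∉ vars κ L := by
  rintro ⟨v, _, rfl⟩
  exact absurd (le_var κ v) (by omega)

section Registers
variable {w : ℕ}

@[simp] theorem Store.setReg_reg (m : Store w) (r : ℕ) (x : BitVec w) (r' : ℕ) :
    (m.setReg r x).reg r' = if r' = r then x else m.reg r' := by
  simp [Store.setReg, Function.update_apply]

@[simp] theorem Core.reg_mk (m : Store w) (o : List (BitVec w)) (T : Finset (ℕ × BitVec w))
    (r : ℕ) : (Core.mk m o T).reg r = m.reg r := rfl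

@[simp] theorem Store.setReg_mem (m : Store w) (r : ℕ) (x : BitVec w) :
    (m.setReg r x).mem = m.mem := rfl

@[simp] theorem Store.setMem_reg (m : Store w) (a : ℕ) (x y : BitVec w) :
    (m.setMem a x y).reg = m.reg := rfl

/-- Only the registers in `W` have changed. -/
structure Frame (W : Set ℕ) (s s' : Core w) : Prop where
  reg : ∀ r, r ∉ W → s'.reg r = s.reg r
  mem : s'.store.mem = s.store.mem
  out : s'.out = s.out
  touched : s'.touched = s.touched

theorem Frame.refl (W : Set ℕ) (s : Core w) : Frame W s s := ⟨fun _ _ => rfl, rfl, rfl, rfl⟩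

theorem Frame.trans {W : Set ℕ} {s s' s'' : Core w} (h : Frame W s s') (h' : Frame W s' s'') :
    Frame W s s'' :=
  ⟨fun r hr => (h'.reg r hr).trans (h.reg r hr), h'.mem.trans h.mem, h'.out.trans h.out,
    h'.touched.trans h.touched⟩

theorem Frame.mono {W W' : Set ℕ} (hW : W ⊆ W') {s s' : Core w} (h : Frame W s s') :
    Frame W' s s' :=
  ⟨fun r hr => h.reg r fun hr' => hr (hW hr'), h.mem, h.out, h.touched⟩

theorem vars_mono {κ : ℕ} {L L' : List Var} (h : L ⊆ L') : vars κ L ⊆ vars κ L' := by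
  rintro r ⟨v, hv, rfl⟩
  exact ⟨v, h hv, rfl⟩

end Registers

open Instr Var

/-- Compare the random digit in `raw` and further random digits with the last `m` digits; set
`drawn` to the largest word if the random number is not smaller. -/
def compare (κ : ℕ) : ℕ → Code
  | 0 => block [move (var κ drawn) (var κ ones)]
  | m + 1 => Code.ite (Test.lt (var κ raw) (κ - m + 1)) Code.skip <|
      Code.ite (Test.lt (κ - m + 1) (var κ raw)) (block [move (var κ drawn) (var κ ones)]) <|
        Code.seq (Code.instr (rand (var κ raw))) (compare κ m)

/-- Propose a position. -/
def draw (κ : ℕ) : Code :=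
  Code.seq (Code.instr (rand (var κ raw))) <|
  Code.seq (block [bin BinOp.div (var κ drawn) (var κ raw) (var κ width),
    bin BinOp.mod (var κ raw) (var κ raw) (var κ width)]) <|
  compare κ κ

/-- Propose positions as long as they decrease, and keep track of the parity of their number. -/
def descend (κ : ℕ) : Code :=
  Code.while (Test.lt (var κ drawn) (var κ last)) <|
    Code.seq (block [move (var κ last) (var κ drawn),
      bin BinOp.xor (var κ par) (var κ par) (var κ one)]) <|
    draw κ

/-- Find the first success in a block of trials. -/
def trial (κ : ℕ) : Code :=
  Code.seq (block [move (var κ last) (var κ blk), move (var κ par) (var κ zero)]) <|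
  Code.seq (draw κ) <|
  Code.seq (block [move (var κ first) (var κ drawn)]) <|
  Code.seq (descend κ) <|
  Code.seq (Code.ite (Test.eq (var κ par) (var κ zero))
    (block [move (var κ first) (var κ blk)]) (block [move (var κ bound) (var κ zero)])) <|
  Code.seq (block [bin BinOp.sub (var κ room) (var κ size) (var κ time)]) <|
  Code.ite (Test.lt (var κ first) (var κ room))
    (block [bin BinOp.add (var κ time) (var κ time) (var κ first)])
    (block [move (var κ time) (var κ size)])

/-- Draw the next sample time of an element whose probability is in the registers `1, …, κ + 1`. -/
def schedule (κ : ℕ) : Code :=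
  Code.seq (block [const (var κ zero) 0, const (var κ one) 1,
    bin BinOp.sub (var κ ones) (var κ zero) (var κ one), move (var κ time) (var κ clock)]) <|
  Code.ite (Test.eq 1 (var κ zero))
    (Code.seq (block [bin BinOp.add (var κ width) 2 (var κ one),
        bin BinOp.div (var κ blk) (var κ ones) (var κ width), move (var κ bound) (var κ size)]) <|
      Code.seq (Code.ite (Test.eq (var κ blk) (var κ zero))
        (block [move (var κ blk) (var κ one)]) Code.skip) <|
      Code.while (Test.lt (var κ time) (var κ bound)) (trial κ))
    Code.skip

section Schedule
variable {κ w : ℕ} {α : I}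

/-- The law of the comparison, given the content of `raw`. -/
def acceptFrom (κ w : ℕ) (α : I) : ℕ → BitVec w → PMF Bool
  | 0, _ => PMF.pure false
  | m + 1, x => acceptAt κ w α m x

theorem uniformWord_bind_acceptFrom (m : ℕ) :
    (uniformWord w).bind (acceptFrom κ w α m) = acceptLaw κ w α m := by
  cases m with
  | zero =>
    have : acceptFrom κ w α 0 = fun _ => PMF.pure false := rfl
    rw [this, PMF.bind_const, acceptLaw]
  | succ m => rw [acceptLaw]; rfl

theorem runs_move_drawn (s : Core w) :
    Runs [block [move (var κ drawn) (var κ ones)]] s (PMF.pure false)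
      (fun b s' => Frame (vars κ [drawn, raw]) s s' ∧
        s'.reg (var κ drawn) = if b then s.reg (var κ drawn) else s.reg (var κ ones)) 3 := by
  refine (Runs.block rfl (Runs.nil ⟨⟨?_, rfl, rfl, rfl⟩, ?_⟩)).mono ?_
  · norm_num
  · intro r hr
    simp [vars] at hr
    simp [Instr.apply, hr]
  · simp [Instr.apply]

/-- The digit to be compared first is already in `raw`, so only ties consume new randomness. This
allows the remainder of a division to serve as the first digit. -/
theorem runs_compare : ∀ (m : ℕ) (s : Core w), m ≤ κ →
    (∀ j ≤ κ, s.reg (j + 1) = digit w α j) →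
    Runs [compare κ m] s (acceptFrom κ w α m (s.reg (var κ raw)))
      (fun b s' => Frame (vars κ [drawn, raw]) s s' ∧
        s'.reg (var κ drawn) = if b then s.reg (var κ drawn) else s.reg (var κ ones))
      (4 * m + 3)
  | 0, s, _, _ => by
    simpa [compare, acceptFrom] using runs_move_drawn s
  | m + 1, s, hm, hd => by
    have hreg : s.reg (κ - m + 1) = digit w α (κ - m) := hd _ (Nat.sub_le _ _)
    rw [compare, acceptFrom, acceptAt, ← hreg]
    have ht : (1 : ℝ≥0∞) + (1 + (1 + (1 + (4 * m + 3)))) ≤ 4 * (m + 1 : ℕ) + 3 := by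
      push_cast
      apply le_of_eq; ring
    refine (Runs.ite (t := 1 + (1 + (1 + (4 * m + 3)))) (fun h => ?_) fun h => ?_).mono ht
    · have h : _ < _ := h
      rw [if_pos h]
      refine (Runs.nil ⟨Frame.refl _ s, by simp⟩).skip.mono ?_
      exact add_le_add le_rfl zero_le
    · have h : ¬ _ < _ := h
      rw [if_neg h]
      refine Runs.ite (fun h' => ?_) fun h' => ?_
      · have h' : _ < _ := h'
        rw [if_pos h']
        refine (runs_move_drawn s).mono ?_
        rw [← add_assoc, ← add_assoc]
        exact le_add_self
      · have h' : ¬ _ < _ := h'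
        rw [if_neg h', ← uniformWord_bind_acceptFrom m]
        refine Runs.seq ?_
        refine Runs.append (l₁ := [_]) (l₂ := [_]) (Runs.rand (var κ raw)
          (fun x s' => s' = { s with store := s.store.setReg (var κ raw) x }) fun x => rfl) ?_
        rintro x _ _ rfl
        have ih := runs_compare m
          { s with store := s.store.setReg (var κ raw) x } (by omega) (fun j hj => ?_)
        · have e : (({ s with store := s.store.setReg (var κ raw) x } : Core w).reg (var κ raw)) =
            x := by simp
          rw [e] at ih
          refine ih.conseq (fun b _ s' ⟨hf, hb⟩ => ⟨?_, ?_⟩) le_rfl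
          · refine Frame.trans (s' := { s with store := s.store.setReg (var κ raw) x })
              ⟨fun r hr => ?_, rfl, rfl, rfl⟩ hf
            simp [vars] at hr
            simp [hr]
          · rw [hb]; simp
        · have := le_var κ raw
          rw [Core.reg_mk, Store.setReg_reg, if_neg (by omega)]
          exact hd j hj

/-- What the program for proposals needs to know. -/
structure DrawReady (κ : ℕ) (α : I) (s : Core w) : Prop where
  digits : ∀ j ≤ κ, s.reg (j + 1) = digit w α j
  ones : (s.reg (var κ ones)).toNat = 2 ^ w - 1
  width : s.reg (var κ width) = digit w α 1 + 1#w

theorem DrawReady.frame {s s' : Core w} (h : DrawReady κ α s) {L : List Var}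
    (hf : Frame (vars κ L) s s') (h1 : Var.ones ∉ L) (h2 : Var.width ∉ L) : DrawReady κ α s' :=
  ⟨fun j hj => (hf.reg _ (notMem_vars (by omega) L)).trans (h.digits j hj),
    by rw [hf.reg _ (by simpa using h1)]; exact h.ones,
    by rw [hf.reg _ (by simpa using h2)]; exact h.width⟩

/-- A bound for the time of a proposal. -/
def drawTime (κ : ℕ) : ℕ := 4 * κ + 11

theorem runs_draw {s : Core w} (hκ : 1 ≤ κ) (h : DrawReady κ α s) :
    Runs [draw κ] s (drawLaw κ w α) (fun v s' => Frame (vars κ [drawn, raw]) s s' ∧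
      (s'.reg (var κ drawn)).toNat = v) (drawTime κ) := by
  refine (Runs.seq (Runs.append (l₁ := [_]) (l₂ := [_]) (Runs.rand (var κ raw)
    (fun x s' => s' = { s with store := s.store.setReg (var κ raw) x }) fun x => rfl)
    (t₂ := 1 + ((5 : ℕ) + (4 * κ + 3))) ?_)).mono ?_
  · rintro x _ _ rfl
    refine Runs.seq (Runs.block rfl ?_)
    simp only [List.foldl, Instr.apply]
    generalize hs' : (Core.mk _ s.out s.touched : Core w) = s'
    have hf : Frame (vars κ [drawn, raw]) s s' := by
      subst hs'
      refine ⟨fun r hr => ?_, rfl, rfl, rfl⟩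
      simp [vars] at hr
      simp [hr]
    have h' := h.frame hf (by simp) (by simp)
    have hraw : s'.reg (var κ raw) = x % (digit w α 1 + 1#w) := by
      subst hs'; simp [BinOp.eval, h.width]
    have hdrawn : s'.reg (var κ drawn) = x / (digit w α 1 + 1#w) := by
      subst hs'; simp [BinOp.eval, h.width]
    have hc := runs_compare (α := α) κ s' le_rfl h'.digits
    obtain ⟨m, rfl⟩ : ∃ m, κ = m + 1 := ⟨κ - 1, by omega⟩
    rw [hraw] at hc
    refine Runs.map hc _ (fun b _ s'' ⟨hf', hb⟩ => ⟨hf.trans hf', ?_⟩) le_rfl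
    rw [hb]
    cases b
    · simpa using h'.ones
    · simp [hdrawn]
  · rw [drawTime]
    push_cast
    apply le_of_eq; ring

theorem mean_lt_add {μ : PMF ℕ} {L : ℕ} (h : ∀ x < L, μ x = ENNReal.ofReal α)
    (c : ℝ≥0∞) (f : ℕ → ℝ≥0∞) :
    mean μ (fun v => c + if v < L then f v else 0) =
      c + ∑ x ∈ Finset.range L, ENNReal.ofReal α * f x := by
  rw [mean_add, mean_const]
  congr 1
  rw [mean, tsum_eq_sum (s := Finset.range L)]
  · refine Finset.sum_congr rfl fun x hx => ?_
    have hx := Finset.mem_range.1 hx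
    rw [if_pos hx, h x hx]
  · intro x hx
    rw [if_neg (by simpa using hx), mul_zero]

/-- A bound for the time of an iteration of `descend`. -/
def descendTime (κ : ℕ) : ℕ := drawTime κ + 8

/-- Induction on the last element `L` of the sequence. The value `e` tells whether the parity ends
up unchanged. Each further element flips it, which is the negation in `coin_failProb`, and the cost
follows the recursion of `one_add_sum_geometric`. -/
theorem runs_descend {b : ℕ} (hκ : 1 ≤ κ) (hD : ∀ x < b, drawLaw κ w α x = ENNReal.ofReal α) :
    ∀ (L : ℕ), L ≤ b → ∀ (v : ℕ) (s : Core w), DrawReady κ α s →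
      (s.reg (var κ last)).toNat = L → (s.reg (var κ drawn)).toNat = v →
      s.reg (var κ one) = 1#w →
      Runs [descend κ] s
        (if v < L then (coin (failProb α v)).map not else PMF.pure true)
        (fun e s' => Frame (vars κ [last, par, drawn, raw]) s s' ∧
          s'.reg (var κ par) = if e then s.reg (var κ par) else s.reg (var κ par) ^^^ 1#w)
        (1 + if v < L then descendTime κ * (1 + ENNReal.ofReal α) ^ v else 0) := by
  intro L
  induction L using Nat.strong_induction_on with
  | _ L ih =>
  intro hL v s hs hlast hdrawn hone
  by_cases hv : v < L
  · rw [if_pos hv, if_pos hv]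
    refine Runs.while_pos (by simpa [Test.eval, hlast, hdrawn] using hv) ?_
    have hcost : (1 : ℝ≥0∞) + ((5 : ℕ) + (drawTime κ + mean (drawLaw κ w α)
        fun v' => 1 + if v' < v then descendTime κ * (1 + ENNReal.ofReal α) ^ v' else 0)) ≤
        descendTime κ * (1 + ENNReal.ofReal α) ^ v := by
      rw [mean_lt_add (L := v) fun x hx => hD x (by omega)]
      have : ∀ x, ENNReal.ofReal α * ((descendTime κ : ℝ≥0∞) * (1 + ENNReal.ofReal α) ^ x) =
          descendTime κ * (ENNReal.ofReal α * (1 + ENNReal.ofReal α) ^ x) := by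
        intro x; ring
      simp only [this]
      rw [← Finset.mul_sum, ← one_add_sum_geometric, mul_add]
      have h7 : (descendTime κ : ℝ≥0∞) = drawTime κ + 8 := by simp [descendTime]
      have h8 : (1 : ℝ≥0∞) + (5 + (drawTime κ + (1 + descendTime κ *
          ∑ x ∈ Finset.range v, ENNReal.ofReal α * (1 + ENNReal.ofReal α) ^ x))) =
          drawTime κ + 7 + descendTime κ *
          ∑ x ∈ Finset.range v, ENNReal.ofReal α * (1 + ENNReal.ofReal α) ^ x := by ring
      push_cast
      rw [h8]
      gcongr
      rw [h7, mul_one]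
      gcongr
      norm_num
    refine Runs.mono ?_ hcost
    refine Runs.seq (Runs.block rfl ?_)
    simp only [List.foldl, Instr.apply]
    generalize hs' : (Core.mk _ s.out s.touched : Core w) = s'
    have hf : Frame (vars κ [last, par, drawn, raw]) s s' := by
      subst hs'
      refine ⟨fun r hr => ?_, rfl, rfl, rfl⟩
      simp [vars] at hr
      simp [hr]
    have h' := hs.frame hf (by simp) (by simp)
    have hlast' : (s'.reg (var κ last)).toNat = v := by subst hs'; simpa using hdrawn
    have hpar' : s'.reg (var κ par) = s.reg (var κ par) ^^^ 1#w := by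
      subst hs'; simp [BinOp.eval, hone]
    -- The law is unfolded just as the program proceeds: a new proposal is drawn and compared with
    -- `v`, now the last element.
    rw [← coin_failProb (L := v) fun x hx => hD x (by omega), PMF.map_bind]
    refine Runs.append_mean (l₁ := [_]) (l₂ := [_]) (runs_draw hκ h') ?_
    intro v' _ s'' ⟨hf', hdrawn'⟩
    have hf'' : Frame (vars κ [last, par, drawn, raw]) s' s'' :=
      hf'.mono (vars_mono (by simp))
    refine Runs.map (ih v hv (by omega) v' s'' (h'.frame hf' (by simp) (by simp))
      (by rw [hf'.reg _ (by simp)]; exact hlast') hdrawn'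
      (by rw [hf'.reg _ (by simp), hf.reg _ (by simp)]; exact hone)) not ?_ le_rfl
    intro e _ s''' ⟨hf3, he⟩
    refine ⟨(hf.trans hf'').trans hf3, ?_⟩
    rw [he, hf'.reg _ (by simp), hpar']
    cases e
    · simp
    · simp
  · rw [if_neg hv, if_neg hv]
    refine Runs.while_neg (by simpa [Test.eval, hlast, hdrawn] using hv) ?_
    exact Runs.nil ⟨Frame.refl _ s, by simp⟩

end Schedule


-- The choice of the block length

section BlockSize
variable {κ w : ℕ} {α : I}

/-- The number of trials that are simulated at once. -/
def blockSize (w : ℕ) (α : I) : ℕ := max 1 ((2 ^ w - 1) / ((digit w α 1).toNat + 1))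

theorem blockSize_pos : 0 < blockSize w α := lt_of_lt_of_le one_pos (le_max_left _ _)

theorem blockSize_le (hw : 1 ≤ w) : blockSize w α ≤ 2 ^ w - 1 := by
  have : 2 ≤ 2 ^ w := by
    calc 2 = 2 ^ 1 := rfl
      _ ≤ 2 ^ w := Nat.pow_le_pow_right (by norm_num) hw
  exact max_le (by omega) (Nat.div_le_self _ _)

/-- Each position below the block length owns a complete group of `d + 1` words, where `d` is the
first fractional digit, so proposals are exact. The maximum with `1` does no harm, as `d + 1 ≤ 2 ^
w`. -/
theorem blockSize_mul_le : blockSize w α * ((digit w α 1).toNat + 1) ≤ 2 ^ w := by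
  rw [blockSize]
  have h1 := Nat.div_mul_le_self (2 ^ w - 1) ((digit w α 1).toNat + 1)
  rcases max_choice 1 ((2 ^ w - 1) / ((digit w α 1).toNat + 1)) with h | h <;> rw [h]
  · have := (digit w α 1).isLt
    omega
  · have := Nat.one_le_two_pow (n := w)
    omega

theorem le_two_mul_blockSize : 2 ^ w ≤ 2 * (blockSize w α * ((digit w α 1).toNat + 1)) := by
  have h1 : 1 ≤ blockSize w α := le_max_left _ _
  have h2 : (2 ^ w - 1) / ((digit w α 1).toNat + 1) ≤ blockSize w α := le_max_right _ _
  have h4 := Nat.div_add_mod (2 ^ w - 1) ((digit w α 1).toNat + 1)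
  have h5 : (2 ^ w - 1) % ((digit w α 1).toNat + 1) < (digit w α 1).toNat + 1 :=
    Nat.mod_lt _ (Nat.succ_pos _)
  have h6 : ((digit w α 1).toNat + 1) * ((2 ^ w - 1) / ((digit w α 1).toNat + 1)) ≤
      blockSize w α * ((digit w α 1).toNat + 1) := by
    rw [mul_comm]
    gcongr
  have h7 : (digit w α 1).toNat + 1 ≤ blockSize w α * ((digit w α 1).toNat + 1) :=
    Nat.le_mul_of_pos_left _ h1
  omega

theorem digit_one_toNat (h1 : (α : ℝ) < 1) : (digit w α 1).toNat = ⌊(α : ℝ) * 2 ^ w⌋₊ := by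
  rw [digit, BitVec.toNat_ofNat, mul_one, Nat.mod_eq_of_lt]
  have h : (α : ℝ) * 2 ^ w < (2 ^ w : ℕ) := by
    push_cast
    exact mul_lt_of_lt_one_left (by positivity) h1
  exact (Nat.floor_lt (mul_nonneg α.2.1 (by positivity))).2 h

/-- Blocks are short enough for decreasing sequences to have bounded expected length. The reason is
`α * 2 ^ w ≤ d + 1`, with `d` the first fractional digit. -/
theorem blockSize_mul_prob_le (h1 : (α : ℝ) < 1) : (blockSize w α : ℝ) * α ≤ 1 := by
  have h2 : (α : ℝ) * 2 ^ w ≤ (digit w α 1).toNat + 1 := by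
    rw [digit_one_toNat h1]
    exact (Nat.lt_floor_add_one _).le
  have h3 : (blockSize w α : ℝ) * ((digit w α 1).toNat + 1) ≤ 2 ^ w := by
    exact_mod_cast blockSize_mul_le (w := w) (α := α)
  have h4 : (blockSize w α : ℝ) * (α * 2 ^ w) ≤ 2 ^ w :=
    (mul_le_mul_of_nonneg_left h2 (by positivity)).trans h3
  have h5 : (0 : ℝ) < 2 ^ w := by positivity
  rw [← mul_assoc] at h4
  exact le_of_mul_le_mul_right (by linarith) h5

/-- Blocks are long enough to contain a success with constant probability. If the first fractional
digit `d` is zero, the block length is at least `2 ^ w - 1`, which is excluded. Otherwise `d + 1 ≤ 2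
* d ≤ 2 * α * 2 ^ w`, and rounding in the division costs another factor of two. -/
theorem one_le_blockSize_mul_prob (h1 : (α : ℝ) < 1) (hb : blockSize w α < 2 ^ w - 1) :
    1 ≤ 4 * ((blockSize w α : ℝ) * α) := by
  have hd : 1 ≤ (digit w α 1).toNat := by
    by_contra h
    have h0 : (digit w α 1).toNat = 0 := by omega
    have := le_max_right 1 ((2 ^ w - 1) / ((digit w α 1).toNat + 1))
    rw [h0] at this
    rw [blockSize, h0] at hb
    simp at hb
  have h2 : ((digit w α 1).toNat : ℝ) ≤ α * 2 ^ w := by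
    rw [digit_one_toNat h1]
    exact Nat.floor_le (mul_nonneg α.2.1 (by positivity))
  have h3 : (2 : ℝ) ^ w ≤ 2 * (blockSize w α * ((digit w α 1).toNat + 1)) := by
    exact_mod_cast le_two_mul_blockSize (w := w) (α := α)
  have hd' : (1 : ℝ) ≤ (digit w α 1).toNat := by exact_mod_cast hd
  have h4 : (2 : ℝ) ^ w ≤ 4 * (blockSize w α * α) * 2 ^ w := by
    have h6 : (0 : ℝ) ≤ blockSize w α := by positivity
    nlinarith
  have h5 : (0 : ℝ) < 2 ^ w := by positivity
  exact le_of_mul_le_mul_right (by linarith) h5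

theorem drawLaw_of_lt_blockSize (hw : 1 ≤ w) (hα : HasPrecision κ w α) (h1 : (α : ℝ) < 1)
    (hκ : 1 ≤ κ) : ∀ x < blockSize w α, drawLaw κ w α x = ENNReal.ofReal α := by
  intro x hx
  refine drawLaw_apply hα h1 hκ (lt_of_lt_of_le hx (blockSize_le hw)) ?_
  exact (Nat.mul_le_mul_right _ hx).trans blockSize_mul_le

end BlockSize

-- The search for the next sample time

section Schedule
variable {κ w n : ℕ} {α : I}

theorem toNat_ofNat_of_lt {x : ℕ} (h : x < 2 ^ w) : (BitVec.ofNat w x).toNat = x := by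
  rw [BitVec.toNat_ofNat, Nat.mod_eq_of_lt h]

theorem toNat_sub_of_le {x y : BitVec w} (h : y.toNat ≤ x.toNat) :
    (x - y).toNat = x.toNat - y.toNat := by
  exact BitVec.toNat_sub_of_le h

theorem Test.eval_lt (s : Core w) (r r' : ℕ) :
    (Test.lt r r').eval s.store ↔ (s.reg r).toNat < (s.reg r').toNat := Iff.rfl

theorem Test.eval_eq (s : Core w) (r r' : ℕ) :
    (Test.eq r r').eval s.store ↔ s.reg r = s.reg r' := Iff.rfl

/-- Comparing `g` with the remaining room, rather than `T + g` with `n`, avoids an overflow. -/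
theorem runs_advance {s : Core w} {g T : ℕ} (hn : n < 2 ^ w)
    (hsize : (s.reg (var κ size)).toNat = n) (hT : (s.reg (var κ time)).toNat = T) (hTn : T ≤ n)
    (hg : (s.reg (var κ first)).toNat = g) :
    Runs [Code.seq (block [bin BinOp.sub (var κ room) (var κ size) (var κ time)]) <|
      Code.ite (Test.lt (var κ first) (var κ room))
        (block [bin BinOp.add (var κ time) (var κ time) (var κ first)])
        (block [move (var κ time) (var κ size)])] s (PMF.pure ())
      (fun _ s' => Frame (vars κ [time, room]) s s' ∧
        (s'.reg (var κ time)).toNat = T + min g (n - T)) 8 := by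
  have ht : (1 : ℝ≥0∞) + ((3 : ℕ) + (1 + ((3 : ℕ) + 0))) ≤ 8 := by norm_num
  change (s.store.reg (var κ size)).toNat = n at hsize
  change (s.store.reg (var κ time)).toNat = T at hT
  change (s.store.reg (var κ first)).toNat = g at hg
  refine Runs.mono ?_ ht
  refine Runs.seq (Runs.block rfl (Runs.ite (fun h => Runs.block rfl (Runs.nil ⟨?_, ?_⟩))
    (fun h => Runs.block rfl (Runs.nil ⟨?_, ?_⟩))))
  · refine ⟨fun r hr => ?_, rfl, rfl, rfl⟩
    simp [vars] at hr
    simp [Instr.apply, hr]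
  · simp only [Test.eval, List.foldl, Instr.apply, Store.setReg_reg, var_inj, reduceCtorEq,
      if_false, if_true, BinOp.eval] at h
    simp only [List.foldl, Instr.apply, Store.setReg_reg, var_inj, Core.reg_mk, reduceCtorEq,
      if_false, if_true, BinOp.eval]
    rw [toNat_sub_of_le (by rw [hT, hsize]; exact hTn), hT, hsize, hg] at h
    rw [BitVec.toNat_add, hT, hg, Nat.mod_eq_of_lt (by omega)]
    omega
  · refine ⟨fun r hr => ?_, rfl, rfl, rfl⟩
    simp [vars] at hr
    simp [Instr.apply, hr]
  · simp only [Test.eval, List.foldl, Instr.apply, Store.setReg_reg, var_inj, reduceCtorEq,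
      if_false, if_true, BinOp.eval] at h
    simp only [List.foldl, Instr.apply, Store.setReg_reg, var_inj, Core.reg_mk, reduceCtorEq,
      if_false, if_true]
    rw [toNat_sub_of_le (by rw [hT, hsize]; exact hTn), hT, hsize, hg] at h
    rw [hsize]
    omega

/-- What the search for the next sample time needs to know. -/
structure TrialReady (κ n : ℕ) (α : I) (s : Core w) : Prop where
  draw : DrawReady κ α s
  size : (s.reg (var κ size)).toNat = n
  zero : s.reg (var κ zero) = 0#w
  one : s.reg (var κ one) = 1#w
  blk : (s.reg (var κ blk)).toNat = blockSize w α

theorem TrialReady.frame {s s' : Core w} (h : TrialReady κ n α s) {L : List Var}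
    (hf : Frame (vars κ L) s s') (hL : ∀ v ∈ [Var.ones, Var.width, Var.size, Var.zero, Var.one,
      Var.blk], v ∉ L) : TrialReady κ n α s' := by
  simp only [List.mem_cons, List.not_mem_nil, or_false, forall_eq_or_imp, forall_eq] at hL
  obtain ⟨h1, h2, h3, h4, h5, h6⟩ := hL
  refine ⟨h.draw.frame hf h1 h2, ?_, ?_, ?_, ?_⟩
  · rw [hf.reg _ (by simpa using h3)]; exact h.size
  · rw [hf.reg _ (by simpa using h4)]; exact h.zero
  · rw [hf.reg _ (by simpa using h5)]; exact h.one
  · rw [hf.reg _ (by simpa using h6)]; exact h.blk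

/-- A bound for the time of a block of trials. -/
def trialTime (κ : ℕ) : ℕ := drawTime κ + 3 * descendTime κ + 26

/-- The registers that change during the search. -/
def searchVars : List Var := [time, bound, first, room, last, par, drawn, raw]

/-- Even parity means that the proposal is rejected, and the block length takes its place. After a
success `bound` is set to zero, which ends the surrounding loop regardless of the time found. -/
theorem runs_trial {s : Core w} {T : ℕ} (hκ : 1 ≤ κ) (hw : 1 ≤ w) (hn : n < 2 ^ w)
    (hα : HasPrecision κ w α) (h1 : (α : ℝ) < 1) (hs : TrialReady κ n α s)
    (hT : (s.reg (var κ time)).toNat = T) (hTn : T ≤ n) :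
    Runs [trial κ] s (gap α (blockSize w α)) (fun g s' => Frame (vars κ searchVars) s s' ∧
      (s'.reg (var κ time)).toNat = T + min g (n - T) ∧
      s'.reg (var κ bound) = if g < blockSize w α then 0#w else s.reg (var κ bound))
      (trialTime κ) := by
  set b := blockSize w α with hb
  have hD := drawLaw_of_lt_blockSize hw hα h1 hκ
  rw [← hb] at hD
  have hone : (1#w).toNat = 1 := by
    rw [toNat_ofNat_of_lt]
    exact Nat.one_lt_two_pow (by omega)
  have hcost : (1 : ℝ≥0∞) + ((5 : ℕ) + (1 + (drawTime κ + (1 + ((3 : ℕ) + (1 +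
      ((1 + descendTime κ * 3) + (1 + ((1 + (3 : ℕ)) + 8))))))))) ≤ trialTime κ := by
    rw [trialTime]
    push_cast
    apply le_of_eq; ring
  refine Runs.mono ?_ hcost
  refine Runs.seq (Runs.block rfl ?_)
  simp only [List.foldl, Instr.apply]
  generalize hs₁ : (Core.mk _ s.out s.touched : Core w) = s₁
  have hf₁ : Frame (vars κ [last, par]) s s₁ := by
    subst hs₁
    refine ⟨fun r hr => ?_, rfl, rfl, rfl⟩
    simp [vars] at hr
    simp [hr]
  have h₁ := hs.frame hf₁ (by simp)
  have hlast₁ : (s₁.reg (var κ last)).toNat = b := by subst hs₁; simpa using hs.blk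
  have hpar₁ : s₁.reg (var κ par) = 0#w := by subst hs₁; simpa using hs.zero
  rw [← gap_eq_proposal hD]
  refine Runs.seq (Runs.append (l₁ := [_]) (l₂ := [_]) (runs_draw hκ h₁.draw) ?_)
  intro v _ s₂ ⟨hf₂, hv₂⟩
  have h₂ := h₁.frame hf₂ (by simp)
  refine Runs.seq (Runs.block rfl ?_)
  simp only [List.foldl, Instr.apply]
  generalize hs₃ : (Core.mk _ s₂.out s₂.touched : Core w) = s₃
  have hf₃ : Frame (vars κ [first]) s₂ s₃ := by
    subst hs₃
    refine ⟨fun r hr => ?_, rfl, rfl, rfl⟩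
    simp [vars] at hr
    simp [hr]
  have h₃ := h₂.frame hf₃ (by simp)
  have hfirst₃ : (s₃.reg (var κ first)).toNat = v := by subst hs₃; simpa using hv₂
  have hlast₃ : (s₃.reg (var κ last)).toNat = b := by
    rw [hf₃.reg _ (by simp), hf₂.reg _ (by simp), hlast₁]
  have hpar₃ : s₃.reg (var κ par) = 0#w := by
    rw [hf₃.reg _ (by simp), hf₂.reg _ (by simp), hpar₁]
  have hdrawn₃ : (s₃.reg (var κ drawn)).toNat = v := by
    rw [hf₃.reg _ (by simp), hv₂]
  have hdesc := runs_descend hκ hD b le_rfl v s₃ h₃.draw hlast₃ hdrawn₃ h₃.one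
  -- A proposal below `b` satisfies `v * α ≤ 1`, so `(1 + α) ^ v` is at most `3`.
  have hdesc' := hdesc.mono (t := 1 + descendTime κ * 3) (by
    gcongr
    split_ifs with hvb
    · gcongr
      refine one_add_pow_le (le_trans ?_ (blockSize_mul_prob_le (w := w) h1))
      have h0 := α.2.1
      gcongr
    · exact zero_le)
  refine Runs.seq (Runs.append (l₁ := [_]) (l₂ := [_]) hdesc' ?_)
  intro e he s₄ ⟨hf₄, hpar₄⟩
  have h₄ := h₃.frame hf₄ (by simp)
  have hev : e = false → v < b := by
    rintro rfl
    by_contra hvb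
    rw [if_neg hvb] at he
    simp at he
  rw [hpar₃] at hpar₄
  have hmid : Runs [Code.ite (Test.eq (var κ par) (var κ zero))
      (block [move (var κ first) (var κ blk)]) (block [move (var κ bound) (var κ zero)])] s₄
      (PMF.pure ()) (fun _ s₅ => Frame (vars κ [first, bound]) s₄ s₅ ∧
        (s₅.reg (var κ first)).toNat = (if e then b else v) ∧
        s₅.reg (var κ bound) = if e then s₄.reg (var κ bound) else 0#w) (1 + (3 : ℕ)) := by
    have hstep : ∀ i : Instr, ((2 * [i].length + 1 : ℕ) : ℝ≥0∞) + 0 ≤ (3 : ℕ) := by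
      intro i; simp
    refine Runs.ite (fun h => (Runs.block rfl (Runs.nil ?_)).mono (hstep _))
      (fun h => (Runs.block rfl (Runs.nil ?_)).mono (hstep _))
    · have hh : s₄.reg (var κ par) = s₄.reg (var κ zero) := h
      have : e = true := by
        cases e
        · rw [hpar₄, h₄.zero] at hh
          have := congrArg BitVec.toNat hh
          simp at this
          omega
        · rfl
      subst this
      refine ⟨⟨fun r hr => ?_, rfl, rfl, rfl⟩, ?_, ?_⟩
      · simp [vars] at hr
        simp [Instr.apply, hr]
      · simpa [Instr.apply] using h₄.blk
      · simp [Instr.apply]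
    · have hh : ¬ s₄.reg (var κ par) = s₄.reg (var κ zero) := h
      have : e = false := by
        cases e
        · rfl
        · rw [hpar₄, h₄.zero] at hh
          simp at hh
      subst this
      refine ⟨⟨fun r hr => ?_, rfl, rfl, rfl⟩, ?_, ?_⟩
      · simp [vars] at hr
        simp [Instr.apply, hr]
      · simp [Instr.apply]
        rw [← hfirst₃]
        exact congrArg _ (hf₄.reg _ (by simp))
      · simpa [Instr.apply] using h₄.zero
  have hmono : ∀ {L : List Var}, L ⊆ searchVars → vars κ L ⊆ vars κ searchVars := vars_mono
  refine Runs.seq (Runs.append_pure (l₁ := [_]) (l₂ := [_]) hmid ?_)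
  intro s₅ ⟨hf₅, hfirst₅, hbound₅⟩
  have h₅ := h₄.frame hf₅ (by simp)
  have hT₅ : (s₅.reg (var κ time)).toNat = T := by
    rw [hf₅.reg _ (by simp), hf₄.reg _ (by simp), hf₃.reg _ (by simp), hf₂.reg _ (by simp),
      hf₁.reg _ (by simp), hT]
  have hadv := runs_advance (κ := κ) hn h₅.size hT₅ hTn hfirst₅
  have hres := hadv.map (fun _ => if e then b else v)
    (R := fun g s' => Frame (vars κ searchVars) s s' ∧
      (s'.reg (var κ time)).toNat = T + min g (n - T) ∧
      s'.reg (var κ bound) = if g < b then 0#w else s.reg (var κ bound)) ?_ le_rfl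
  · rwa [PMF.pure_map] at hres
  intro _ _ s₆ ⟨hf₆, hT₆⟩
  refine ⟨(((((hf₁.mono (hmono (by simp [searchVars]))).trans
    (hf₂.mono (hmono (by simp [searchVars])))).trans (hf₃.mono (hmono (by simp [searchVars])))).trans
    (hf₄.mono (hmono (by simp [searchVars])))).trans (hf₅.mono (hmono (by simp [searchVars])))).trans
    (hf₆.mono (hmono (by simp [searchVars]))), hT₆, ?_⟩
  rw [hf₆.reg _ (by simp), hbound₅]
  cases e
  · simp [hev rfl]
  · simp only [if_true, lt_irrefl, if_false]
    rw [hf₄.reg _ (by simp), hf₃.reg _ (by simp), hf₂.reg _ (by simp), hf₁.reg _ (by simp)]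

/-- A bound for the expected time of the search for the next sample time. -/
def searchTime (κ : ℕ) : ℕ := 5 * (trialTime κ + 2)

/-- A round costs one block and a loop test, a final test ends the search, and the search goes on
with probability at most `4 / 5`. The constant `K = 5 * (trialTime κ + 2)` solves `K = trialTime κ +
2 + 4 / 5 * K`. -/
theorem runs_search (hκ : 1 ≤ κ) (hw : 1 ≤ w) (hn : n < 2 ^ w)
    (hα : HasPrecision κ w α) (h1 : (α : ℝ) < 1) :
    ∀ (m T : ℕ) (s : Core w), n = T + m → 0 < m → TrialReady κ n α s →
      (s.reg (var κ time)).toNat = T → (s.reg (var κ bound)).toNat = n →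
      Runs [Code.while (Test.lt (var κ time) (var κ bound)) (trial κ)] s
        ((gap α m).map (T + ·)) (fun x s' => Frame (vars κ searchVars) s s' ∧
          (s'.reg (var κ time)).toNat = x) (searchTime κ) := by
  intro m
  induction m using Nat.strong_induction_on with
  | _ m ih =>
  intro T s hm h0 hs hT hbound
  set b := blockSize w α with hb
  have hbpos : 0 < b := blockSize_pos
  have hcost : (1 : ℝ≥0∞) + (trialTime κ + mean (gap α b) fun g =>
      if g < b then 1 else if b < m then searchTime κ else 1) ≤ searchTime κ := by
    have hle : mean (gap α b) (fun g => if g < b then 1 else if b < m then (searchTime κ : ℝ≥0∞)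
        else 1) ≤ 1 + (gap α b b * if b < m then (searchTime κ : ℝ≥0∞) else 0) := by
      refine (mean_mono (g := fun g => 1 + if g = b then (if b < m then (searchTime κ : ℝ≥0∞)
        else 0) else 0) _ fun g hg => ?_).trans_eq ?_
      · have := gap_le α b g hg
        by_cases hgb : g < b
        · simp [hgb]
        · have : g = b := by omega
          subst this
          rw [if_neg hgb, if_pos rfl]
          split_ifs
          · exact le_add_self
          · simp
      · rw [mean_add, mean_const]
        congr 1
        rw [mean, tsum_eq_single b]
        · simp
        · intro x hx; simp [hx]
    have hK : (searchTime κ : ℝ≥0∞) = 5 * (trialTime κ + 2) := by simp [searchTime]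
    have h4 : (gap α b b * if b < m then (searchTime κ : ℝ≥0∞) else 0) ≤
        4 * (trialTime κ + 2) := by
      split_ifs with hbm
      -- A second block is needed only if `b < m ≤ n < 2 ^ w`; thus `b < 2 ^ w - 1`, and the
      -- exceptional block length does not occur.
      · have h5 := one_sub_pow_le (one_le_blockSize_mul_prob (w := w) h1 (by omega))
        have h6 : gap α b b * 5 ≤ 4 := by
          rw [gap_self, ← ENNReal.ofReal_ofNat 5, ← ENNReal.ofReal_mul
            (pow_nonneg (by linarith) _), mul_comm]
          exact (ENNReal.ofReal_le_ofReal h5).trans (by simp)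
        rw [hK, ← mul_assoc]
        gcongr
      · simp
    calc (1 : ℝ≥0∞) + (trialTime κ + mean (gap α b) fun g =>
          if g < b then 1 else if b < m then (searchTime κ : ℝ≥0∞) else 1)
        ≤ 1 + (trialTime κ + (1 + 4 * (trialTime κ + 2))) := by
          gcongr
          exact hle.trans (by gcongr)
      _ = searchTime κ := by rw [hK]; ring
  refine Runs.mono ?_ hcost
  refine Runs.while_pos (by rw [Test.eval_lt]; omega) ?_
  rw [gap_split α b m, PMF.map_bind]
  refine Runs.append_mean (l₁ := [_]) (l₂ := [_])
    (runs_trial hκ hw hn hα h1 hs hT (by omega)) ?_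
  intro g hg s' ⟨hf, hT', hbound'⟩
  have hs' := hs.frame hf (by simp [searchVars])
  have hgle := gap_le α b g hg
  by_cases hgb : g < b
  · rw [if_pos hgb, if_pos hgb, PMF.pure_map]
    rw [if_pos hgb] at hbound'
    have := Runs.while_neg (l := []) (a := trial κ)
      (c := Test.lt (var κ time) (var κ bound)) (s := s')
      (by simp [Test.eval, hbound']) (Runs.nil (a := T + min g m)
        (Q := fun x s' => Frame (vars κ searchVars) s s' ∧ (s'.reg (var κ time)).toNat = x)
        ⟨hf, by rw [hT']; congr 2; omega⟩)
    simpa using this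
  · have hgb' : g = b := by omega
    subst hgb'
    rw [if_neg hgb, if_neg hgb]
    rw [if_neg hgb] at hbound'
    by_cases hbm : b < m
    · rw [if_pos hbm, if_pos hbm, PMF.map_comp]
      have := ih (m - b) (by omega) (T + b) s' (by omega) (by omega) hs' (by rw [hT']; omega)
        (by rw [hbound']; exact hbound)
      have hfun : ((T + ·) ∘ (b + ·) : ℕ → ℕ) = (T + b + ·) := by
        funext x; simp [add_assoc]
      rw [hfun]
      exact this.conseq (fun x _ s'' ⟨hf', hx⟩ => ⟨hf.trans hf', hx⟩) le_rfl
    · rw [if_neg hbm, if_neg hbm, PMF.pure_map]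
      have hTn : (s'.reg (var κ time)).toNat = n := by rw [hT']; omega
      have := Runs.while_neg (l := []) (a := trial κ)
        (c := Test.lt (var κ time) (var κ bound)) (s := s')
        (by
          rw [Test.eval_lt, hTn, hbound', hbound]
          exact lt_irrefl n)
        (Runs.nil (a := T + m)
          (Q := fun x s' => Frame (vars κ searchVars) s s' ∧ (s'.reg (var κ time)).toNat = x)
          ⟨hf, by rw [hTn, hm]⟩)
      simpa using this

/-- A bound for the expected time of `schedule`. -/
def scheduleTime (κ : ℕ) : ℕ := searchTime κ + 26

/-- The registers that change in `schedule`. -/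
def scheduleVars : List Var :=
  [zero, one, ones, width, blk, time, bound, first, room, last, par, drawn, raw]

/-- A positive fixed-point number. -/
def Valid (κ w : ℕ) (α : I) : Prop := 0 < (α : ℝ) ∧ HasPrecision κ w α

/-- Probability one is the only case with a nonzero integer digit; its fractional digits would
mislead the search, and the next time is simply the clock. -/
theorem runs_schedule {s : Core w} {c : ℕ} (hn : n < 2 ^ w) (hc : c < n) (hα : Valid κ w α)
    (hd : ∀ j ≤ κ, s.reg (j + 1) = digit w α j) (hsize : s.reg (var κ size) = BitVec.ofNat w n)
    (hclock : s.reg (var κ Var.clock) = BitVec.ofNat w c) :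
    Runs [schedule κ] s (nextLaw n c α) (fun x s' => Frame (vars κ scheduleVars) s s' ∧
      s'.reg (var κ time) = BitVec.ofNat w x) (scheduleTime κ) := by
  have hw : 1 ≤ w := by
    by_contra h
    obtain rfl : w = 0 := by omega
    simp at hn; omega
  have hcost : (1 : ℝ≥0∞) + ((9 : ℕ) + (1 + (1 + ((7 : ℕ) + (1 + ((1 + ((3 : ℕ) + 0)) +
      searchTime κ)))))) ≤ scheduleTime κ := by
    rw [scheduleTime]
    push_cast
    rw [show (1 : ℝ≥0∞) + (9 + (1 + (1 + (7 + (1 + (1 + (3 + 0) + searchTime κ)))))) =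
      searchTime κ + 24 by ring]
    gcongr
    norm_num
  refine Runs.mono ?_ hcost
  refine Runs.seq (Runs.block rfl ?_)
  simp only [List.foldl, Instr.apply]
  generalize hs₁ : (Core.mk _ s.out s.touched : Core w) = s₁
  have hf₁ : Frame (vars κ [zero, one, ones, time]) s s₁ := by
    subst hs₁
    refine ⟨fun r hr => ?_, rfl, rfl, rfl⟩
    simp [vars] at hr
    simp [hr]
  have hzero₁ : s₁.reg (var κ zero) = 0#w := by subst hs₁; simp
  have hone₁ : s₁.reg (var κ one) = 1#w := by subst hs₁; simp
  have hones₁ : (s₁.reg (var κ ones)).toNat = 2 ^ w - 1 := by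
    subst hs₁
    simp [BinOp.eval, BitVec.toNat_neg]
    rw [Nat.mod_eq_of_lt (a := 1) (Nat.one_lt_two_pow (by omega)), Nat.mod_eq_of_lt]
    have := Nat.one_lt_two_pow (n := w) (by omega)
    omega
  have htime₁ : s₁.reg (var κ time) = BitVec.ofNat w c := by subst hs₁; simpa using hclock
  have hsize₁ : s₁.reg (var κ size) = BitVec.ofNat w n := by
    rw [hf₁.reg _ (by simp), hsize]
  have hd₁ : ∀ j ≤ κ, s₁.reg (j + 1) = digit w α j := fun j hj =>
    (hf₁.reg _ (notMem_vars (by omega) _)).trans (hd j hj)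
  have hfloor : digit w α 0 = BitVec.ofNat w ⌊(α : ℝ)⌋₊ := by simp [digit]
  have hmono : ∀ {L : List Var}, L ⊆ scheduleVars → vars κ L ⊆ vars κ scheduleVars := vars_mono
  have hreg1 : s₁.reg 1 = digit w α 0 := hd₁ 0 (Nat.zero_le _)
  rcases lt_or_eq_of_le α.2.2 with h1 | h1
  · have hdig : digit w α 0 = 0#w := by
      rw [hfloor, Nat.floor_eq_zero.2 h1]
    refine Runs.ite_pos (by rw [Test.eval_eq, hreg1, hdig, hzero₁]) ?_
    -- Without fractional words `α` would be an integer strictly between `0` and `1`.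
    have hκ : 1 ≤ κ := by
      by_contra h
      obtain rfl : κ = 0 := by omega
      obtain ⟨a, ha⟩ := hα.2
      simp at ha
      have h2 := hα.1
      rw [ha] at h1 h2
      have h3 : a < 1 := by exact_mod_cast h1
      have h4 : 0 < a := by exact_mod_cast h2
      omega
    refine Runs.seq (Runs.block rfl ?_)
    simp only [List.foldl, Instr.apply]
    generalize hs₂ : (Core.mk _ s₁.out s₁.touched : Core w) = s₂
    have hf₂ : Frame (vars κ [width, blk, bound]) s₁ s₂ := by
      subst hs₂
      refine ⟨fun r hr => ?_, rfl, rfl, rfl⟩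
      simp [vars] at hr
      simp [hr]
    have hwidth₂ : s₂.reg (var κ width) = digit w α 1 + 1#w := by
      have := hd₁ 1 hκ
      subst hs₂
      simp [BinOp.eval, hone₁, ← this]
    have hblk₂ : (s₂.reg (var κ blk)).toNat = (2 ^ w - 1) / ((digit w α 1).toNat + 1) := by
      have := hd₁ 1 hκ
      rw [← hones₁, ← toNat_div_succ, ← this, ← hone₁]
      subst hs₂
      simp [BinOp.eval]
    have hbound₂ : s₂.reg (var κ bound) = BitVec.ofNat w n := by
      subst hs₂; simpa using hsize₁
    have hmid : Runs [Code.ite (Test.eq (var κ blk) (var κ zero))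
        (block [move (var κ blk) (var κ one)]) Code.skip] s₂ (PMF.pure ()) (fun _ s₃ =>
          Frame (vars κ [blk]) s₂ s₃ ∧ (s₃.reg (var κ blk)).toNat = blockSize w α)
          (1 + ((3 : ℕ) + 0)) := by
      have hz : s₂.reg (var κ zero) = 0#w := by rw [hf₂.reg _ (by simp), hzero₁]
      refine Runs.ite (fun h => Runs.block rfl (Runs.nil ⟨?_, ?_⟩)) (fun h =>
        (Runs.skip (Runs.nil ⟨Frame.refl _ _, ?_⟩)).mono (by norm_num))
      · refine ⟨fun r hr => ?_, rfl, rfl, rfl⟩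
        simp [vars] at hr
        simp [Instr.apply, hr]
      · have hh : s₂.reg (var κ blk) = s₂.reg (var κ zero) := h
        rw [hh, hz] at hblk₂
        rw [blockSize, ← hblk₂]
        have h2 : s₂.reg (var κ one) = 1#w := by rw [hf₂.reg _ (by simp), hone₁]
        have h3 : (1#w).toNat = 1 := toNat_ofNat_of_lt (Nat.one_lt_two_pow (by omega))
        simp [Instr.apply]
        rw [← h3, ← h2]
      · have hh : ¬ s₂.reg (var κ blk) = s₂.reg (var κ zero) := h
        rw [hblk₂, blockSize, max_eq_right]
        rw [← hblk₂]
        by_contra h0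
        apply hh
        rw [hz]
        apply BitVec.eq_of_toNat_eq
        simp
        omega
    refine Runs.seq (Runs.append_pure (l₁ := [_]) (l₂ := [_]) hmid ?_)
    intro s₃ ⟨hf₃, hblk₃⟩
    have hf₁₃ : Frame (vars κ scheduleVars) s s₃ :=
      ((hf₁.mono (hmono (by simp [scheduleVars]))).trans
        (hf₂.mono (hmono (by simp [scheduleVars])))).trans
        (hf₃.mono (hmono (by simp [scheduleVars])))
    have h₃ : TrialReady κ n α s₃ := by
      refine ⟨⟨fun j hj => ?_, ?_, ?_⟩, ?_, ?_, ?_, hblk₃⟩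
      · rw [hf₁₃.reg _ (notMem_vars (by omega) _), hd j hj]
      · rw [hf₃.reg _ (by simp), hf₂.reg _ (by simp), hones₁]
      · rw [hf₃.reg _ (by simp), hwidth₂]
      · rw [hf₃.reg _ (by simp), hf₂.reg _ (by simp), hsize₁, toNat_ofNat_of_lt hn]
      · rw [hf₃.reg _ (by simp), hf₂.reg _ (by simp), hzero₁]
      · rw [hf₃.reg _ (by simp), hf₂.reg _ (by simp), hone₁]
    have htime₃ : (s₃.reg (var κ time)).toNat = c := by
      rw [hf₃.reg _ (by simp), hf₂.reg _ (by simp), htime₁, toNat_ofNat_of_lt (by omega)]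
    have hbound₃ : (s₃.reg (var κ bound)).toNat = n := by
      rw [hf₃.reg _ (by simp), hbound₂, toNat_ofNat_of_lt hn]
    refine (runs_search hκ hw hn hα.2 h1 (n - c) c s₃ (by omega) (by omega) h₃ htime₃
      hbound₃).conseq (fun x _ s' ⟨hf, hx⟩ => ⟨hf₁₃.trans (hf.mono (hmono ?_)), ?_⟩) le_rfl
    · simp [searchVars, scheduleVars]
    · rw [← hx]; simp
  · have hdig : digit w α 0 = 1#w := by
      rw [hfloor, h1, Nat.floor_one]
    refine Runs.ite_neg ?_ ?_
    · rw [Test.eval_eq, hreg1, hdig, hzero₁]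
      intro h
      have := congrArg BitVec.toNat h
      rw [toNat_ofNat_of_lt (Nat.one_lt_two_pow (by omega))] at this
      simp at this
    · rw [nextLaw, gap_one (by omega) h1, PMF.pure_map]
      refine (Runs.skip (Runs.nil ⟨hf₁.mono (hmono (by simp [scheduleVars])), ?_⟩)).mono ?_
      · exact add_le_add le_rfl zero_le
      · rw [htime₁, add_zero]
end Schedule

/-! ## Doubly linked lists -/

/-- The elements `i < n` with `τ i = t` form a doubly linked list, for every `t ≤ n`. The pointer
`n` marks both ends. -/
structure Linked (n : ℕ) (τ hd nx pv : ℕ → ℕ) : Prop where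
  back : ∀ i < n, τ i ≤ n →
    (pv i = n ∧ hd (τ i) = i) ∨ (pv i < n ∧ τ (pv i) = τ i ∧ nx (pv i) = i)
  next : ∀ i < n, τ i ≤ n → nx i = n ∨ (nx i < n ∧ τ (nx i) = τ i ∧ pv (nx i) = i)
  head : ∀ t ≤ n, hd t = n ∨ (hd t < n ∧ τ (hd t) = t ∧ pv (hd t) = n)
  rank : ∃ r : ℕ → ℕ, ∀ i < n, τ i ≤ n → pv i < n → r i < r (pv i)

section Linked
variable {n : ℕ} {τ hd nx pv : ℕ → ℕ}

theorem Linked.head_ne (h : Linked n τ hd nx pv) {i : ℕ} (hi : i < n) (hit : τ i ≤ n) :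
    hd (τ i) ≠ n := by
  obtain ⟨r, hr⟩ := h.rank
  obtain ⟨j, hj, hmax⟩ := Finset.exists_max_image ((Finset.range n).filter fun j => τ j = τ i) r
    ⟨i, by simp [hi]⟩
  simp only [Finset.mem_filter, Finset.mem_range] at hj hmax
  rcases h.back j hj.1 (hj.2 ▸ hit) with ⟨_, h2⟩ | ⟨h1, h2, _⟩
  · rw [hj.2] at h2
    omega
  · have h3 := hr j hj.1 (hj.2 ▸ hit) h1
    have h4 := hmax (pv j) ⟨h1, h2.trans hj.2⟩
    omega

/-- The value `n + 1` puts `i` outside all lists, and only the clauses at its neighbours need work.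
The old ranks still serve: the rank of `nx i` is below that of `i`, hence below that of `pv i`. -/
theorem Linked.remove (h : Linked n τ hd nx pv) {i : ℕ} (hi : i < n) (hit : τ i ≤ n) :
    Linked n (Function.update τ i (n + 1))
      (if pv i = n then Function.update hd (τ i) (nx i) else hd)
      (if pv i = n then nx else Function.update nx (pv i) (nx i))
      (if nx i = n then pv else Function.update pv (nx i) (pv i)) := by
  obtain ⟨hb, hn, hh, r, hr⟩ := h
  have hbi := hb i hi hit
  have hni := hn i hi hit
  have hri := hr i hi hit
  have hrn := hr (nx i)
  -- Pointwise forms of the new pointers reduce each clause to a finite case distinction.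
  have e1 : ∀ t, (if pv i = n then Function.update hd (τ i) (nx i) else hd) t =
      if pv i = n ∧ t = τ i then nx i else hd t := by
    intro t; split_ifs <;> simp_all
  have e2 : ∀ t, (if pv i = n then nx else Function.update nx (pv i) (nx i)) t =
      if pv i ≠ n ∧ t = pv i then nx i else nx t := by
    intro t; split_ifs <;> simp_all [Function.update_apply]
  have e3 : ∀ t, (if nx i = n then pv else Function.update pv (nx i) (pv i)) t =
      if nx i ≠ n ∧ t = nx i then pv i else pv t := by
    intro t; split_ifs <;> simp_all
  refine ⟨?_, ?_, ?_, r, ?_⟩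
  · intro j hj hjt
    simp only [e1, e2, e3, Function.update_apply] at hjt ⊢
    have hji : j ≠ i := by rintro rfl; simp at hjt
    rw [if_neg hji] at hjt
    have hbj := hb j hj hjt
    simp only [if_neg hji]
    clear hb hn hh hr e1 e2 e3
    grind
  · intro j hj hjt
    simp only [e2, e3, Function.update_apply] at hjt ⊢
    have hji : j ≠ i := by rintro rfl; simp at hjt
    rw [if_neg hji] at hjt
    have hnj := hn j hj hjt
    have hbj := hb j hj hjt
    simp only [if_neg hji]
    clear hb hn hh hr e1 e2 e3
    grind
  · intro t ht
    simp only [e1, e3, Function.update_apply]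
    have hht := hh t ht
    have hhi := hh (τ i) hit
    clear hb hn hh hr e1 e2 e3
    grind
  · intro j hj hjt
    simp only [e3, Function.update_apply] at hjt ⊢
    have hji : j ≠ i := by rintro rfl; simp at hjt
    rw [if_neg hji] at hjt
    have hrj := hr j hj hjt
    have hbj := hb j hj hjt
    clear hb hn hh hr e1 e2 e3
    grind

/-- The new element becomes the head, so a rank above that of the old head is enough. An element
outside all lists is the predecessor of no listed element, so changing its rank affects nothing
else. -/
theorem Linked.insert (h : Linked n τ hd nx pv) {i t : ℕ} (hi : i < n) (hit : n < τ i)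
    (ht : t ≤ n) :
    Linked n (Function.update τ i t) (Function.update hd t i) (Function.update nx i (hd t))
      (if hd t = n then Function.update pv i n
        else Function.update (Function.update pv i n) (hd t) i) := by
  obtain ⟨hb, hn, hh, r, hr⟩ := h
  have hht := hh t ht
  have e3 : ∀ j, (if hd t = n then Function.update pv i n
        else Function.update (Function.update pv i n) (hd t) i) j =
      if hd t ≠ n ∧ j = hd t then i else if j = i then n else pv j := by
    intro t; split_ifs <;> simp_all
  refine ⟨?_, ?_, ?_, Function.update r i (r (hd t) + 1), ?_⟩
  · intro j hj hjt
    simp only [e3, Function.update_apply] at hjt ⊢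
    have hbj := hb j hj
    clear hb hn hh hr e3
    grind
  · intro j hj hjt
    simp only [e3, Function.update_apply] at hjt ⊢
    have hbj := hb j hj
    have hnj := hn j hj
    clear hb hn hh hr e3
    grind
  · intro u hu
    simp only [e3, Function.update_apply]
    have hhu := hh u hu
    clear hb hn hh hr e3
    grind
  · intro j hj hjt
    simp only [e3, Function.update_apply] at hjt ⊢
    have hrj := hr j hj
    have hbj := hb j hj
    clear hb hn hh hr e3
    grind

end Linked

/-! ## The program: moving an element to its next slot -/

/-- Arrays beyond those for the digits of the probabilities. -/
inductive Arr where
  | head | next | back | slot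

def Arr.index : Arr → ℕ
  | head => 0 | next => 1 | back => 2 | slot => 3

theorem Arr.index_inj {a b : Arr} : a.index = b.index ↔ a = b := by
  constructor
  · cases a <;> cases b <;> simp [Arr.index]
  · rintro rfl; rfl

/-- The name of an array. -/
def arr (κ : ℕ) (a : Arr) : ℕ := κ + 1 + a.index

@[simp] theorem arr_inj {κ : ℕ} {a b : Arr} : arr κ a = arr κ b ↔ a = b := by
  rw [arr, arr, Nat.add_left_cancel_iff, Arr.index_inj]

/-- The memory cells that the program uses. -/
def cells (κ n w : ℕ) : Finset (ℕ × BitVec w) :=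
  Finset.range (κ + 5) ×ˢ (Finset.range (n + 1)).image (BitVec.ofNat w)

theorem card_cells_le (κ n w : ℕ) : (cells κ n w).card ≤ (κ + 5) * (n + 1) := by
  rw [cells, Finset.card_product, Finset.card_range]
  refine Nat.mul_le_mul_left _ (Finset.card_image_le.trans ?_)
  rw [Finset.card_range]

section Memory
variable {κ n w : ℕ}

theorem mem_cells {a : ℕ} {x : BitVec w} (ha : a < κ + 5) (hx : x.toNat ≤ n) :
    (a, x) ∈ cells κ n w := by
  simp only [cells, Finset.mem_product, Finset.mem_range, Finset.mem_image]
  exact ⟨ha, x.toNat, by omega, by simp⟩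

theorem arr_mem_cells (a : Arr) {x : BitVec w} (hx : x.toNat ≤ n) :
    (arr κ a, x) ∈ cells κ n w := by
  refine mem_cells ?_ hx
  cases a <;> simp [arr, Arr.index]

theorem insert_subset_cells {T : Finset (ℕ × BitVec w)} (hT : T ⊆ cells κ n w) (a : Arr)
    {x : BitVec w} (hx : x.toNat ≤ n) : insert (arr κ a, x) T ⊆ cells κ n w :=
  Finset.insert_subset (arr_mem_cells a hx) hT

/-- The content of the first `n + 1` cells of an array, as a function on the natural numbers. -/
def readArray (n : ℕ) (mem : ℕ → BitVec w → BitVec w) (a x : ℕ) : ℕ :=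
  if x ≤ n then (mem a (BitVec.ofNat w x)).toNat else 0

theorem readArray_toNat {mem : ℕ → BitVec w → BitVec w} {a : ℕ} {x : BitVec w}
    (hx : x.toNat ≤ n) : readArray n mem a x.toNat = (mem a x).toNat := by
  rw [readArray, if_pos hx]; simp

/-- For `n < 2 ^ w` the addresses up to `n` are distinct words, so a store changes a single value.
Larger indices might alias modulo `2 ^ w`, which is why `readArray` cuts them off. -/
theorem readArray_update (hn : n < 2 ^ w) {mem : ℕ → BitVec w → BitVec w} {a : ℕ}
    {x y : BitVec w} (hx : x.toNat ≤ n) (b : ℕ) :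
    readArray n (Function.update mem a (Function.update (mem a) x y)) b =
      if b = a then Function.update (readArray n mem a) x.toNat y.toNat
      else readArray n mem b := by
  split_ifs with hb
  · subst hb
    funext z
    by_cases hz : z ≤ n
    · rw [readArray, if_pos hz, Function.update_self, Function.update_apply, Function.update_apply]
      have : BitVec.ofNat w z = x ↔ z = x.toNat := by
        constructor
        · rintro rfl
          rw [toNat_ofNat_of_lt (by omega)]
        · rintro rfl
          simp
      simp only [this]
      split_ifs
      · rfl
      · rw [readArray, if_pos hz]
    · rw [readArray, if_neg hz, Function.update_apply, if_neg (by omega), readArray, if_neg hz]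
  · funext z
    rw [readArray, readArray, Function.update_of_ne hb]

@[simp] theorem Store.setMem_mem (m : Store w) (a : ℕ) (x y : BitVec w) :
    (m.setMem a x y).mem = Function.update m.mem a (Function.update (m.mem a) x y) := rfl

/-- Only the registers in `W` and the arrays of the lists have changed. -/
structure MemFrame (κ n : ℕ) (W : Set ℕ) (s s' : Core w) : Prop where
  reg : ∀ r, r ∉ W → s'.reg r = s.reg r
  mem : ∀ a ≤ κ, s'.store.mem a = s.store.mem a
  out : s'.out = s.out
  touched : s.touched ⊆ cells κ n w → s'.touched ⊆ cells κ n w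

theorem MemFrame.trans {W : Set ℕ} {s s' s'' : Core w} (h : MemFrame κ n W s s')
    (h' : MemFrame κ n W s' s'') : MemFrame κ n W s s'' :=
  ⟨fun r hr => (h'.reg r hr).trans (h.reg r hr), fun a ha => (h'.mem a ha).trans (h.mem a ha),
    h'.out.trans h.out, fun ht => h'.touched (h.touched ht)⟩

theorem MemFrame.mono {W W' : Set ℕ} (hW : W ⊆ W') {s s' : Core w} (h : MemFrame κ n W s s') :
    MemFrame κ n W' s s' :=
  ⟨fun r hr => h.reg r fun hr' => hr (hW hr'), h.mem, h.out, h.touched⟩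

theorem Frame.memFrame {W : Set ℕ} {s s' : Core w} (h : Frame W s s') : MemFrame κ n W s s' :=
  ⟨h.reg, fun a _ => by rw [h.mem], h.out, fun ht => by rw [h.touched]; exact ht⟩

theorem update_arr_of_le {mem : ℕ → BitVec w → BitVec w} {a : Arr} {f : BitVec w → BitVec w}
    {j : ℕ} (hj : j ≤ κ) : Function.update mem (arr κ a) f j = mem j := by
  rw [Function.update_of_ne]
  rw [arr]; omega

/-- The arrays hold the lists of the elements with equal `τ`. -/
structure Lists (κ n : ℕ) (τ : ℕ → ℕ) (mem : ℕ → BitVec w → BitVec w) : Prop where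
  linked : Linked n τ (readArray n mem (arr κ Arr.head)) (readArray n mem (arr κ Arr.next))
    (readArray n mem (arr κ Arr.back))
  slot : ∀ i < n, τ i ≤ n → readArray n mem (arr κ Arr.slot) i = τ i

end Memory

/-- Remove the element in register `0` from its list. -/
def unlink (κ : ℕ) : Code :=
  Code.seq (block [load (var κ slot) (arr κ Arr.slot) 0, load (var κ prev) (arr κ Arr.back) 0,
    load (var κ succ) (arr κ Arr.next) 0]) <|
  Code.seq (Code.ite (Test.eq (var κ prev) (var κ size))
    (block [store (arr κ Arr.head) (var κ slot) (var κ succ)])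
    (block [store (arr κ Arr.next) (var κ prev) (var κ succ)])) <|
  Code.ite (Test.eq (var κ succ) (var κ size)) Code.skip
    (block [store (arr κ Arr.back) (var κ succ) (var κ prev)])

/-- Insert the element in register `0` into the list for the slot `time`. -/
def link (κ : ℕ) : Code :=
  Code.seq (block [load (var κ succ) (arr κ Arr.head) (var κ time),
    store (arr κ Arr.next) 0 (var κ succ), store (arr κ Arr.back) 0 (var κ size),
    store (arr κ Arr.head) (var κ time) 0, store (arr κ Arr.slot) 0 (var κ time)]) <|
  Code.ite (Test.eq (var κ succ) (var κ size)) Code.skip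
    (block [store (arr κ Arr.back) (var κ succ) 0])

/-- Load the probability of the element in register `0`. -/
def loadDigits (κ : ℕ) : Code :=
  block ((List.range (κ + 1)).map fun j => load (j + 1) j 0)

/-- Draw a new sample time for the element in register `0`. -/
def reschedule (κ : ℕ) : Code :=
  Code.seq (loadDigits κ) <| Code.seq (schedule κ) <| Code.seq (unlink κ) (link κ)

section Reschedule
variable {κ n w : ℕ} {α : I} {τ : ℕ → ℕ}

/-- Elements without a sample time are kept in a list as well, that of slot `n`, so the program need
not ask whether there is anything to remove. -/
theorem runs_unlink {s : Core w} {i : ℕ} (hn : n < 2 ^ w) (hi : i < n) (hit : τ i ≤ n)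
    (h0 : s.reg 0 = BitVec.ofNat w i) (hsize : s.reg (var κ size) = BitVec.ofNat w n)
    (hL : Lists κ n τ s.store.mem) :
    Runs [unlink κ] s (PMF.pure ()) (fun _ s' => MemFrame κ n (vars κ [slot, prev, succ]) s s' ∧
      Lists κ n (Function.update τ i (n + 1)) s'.store.mem) 17 := by
  have hcost : (1 : ℝ≥0∞) + ((7 : ℕ) + (1 + ((1 + (3 : ℕ)) + (1 + (3 : ℕ))))) ≤ 17 := by
    norm_num
  refine Runs.mono ?_ hcost
  have hi0 : (s.reg 0).toNat = i := by rw [h0, toNat_ofNat_of_lt (by omega)]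
  have hin : (s.reg 0).toNat ≤ n := by omega
  have hne : ∀ v, (0 : ℕ) ≠ var κ v := fun v => by have := le_var κ v; omega
  refine Runs.seq (Runs.block rfl ?_)
  simp only [List.foldl, Instr.apply]
  generalize hs₁ : (Core.mk _ s.out _ : Core w) = s₁
  have hf₁ : MemFrame κ n (vars κ [slot, prev, succ]) s s₁ := by
    subst hs₁
    refine ⟨fun r hr => ?_, fun a _ => rfl, rfl, fun ht => ?_⟩
    · simp [vars] at hr
      simp [hr]
    · simp only [Store.setReg_reg, hne, if_false]
      exact insert_subset_cells (insert_subset_cells (insert_subset_cells ht _ hin) _ hin) _ hin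
  have hmem₁ : s₁.store.mem = s.store.mem := by subst hs₁; rfl
  have hslot : (s₁.reg (var κ slot)).toNat = τ i := by
    rw [← hL.slot i hi hit, ← hi0, readArray_toNat hin]
    subst hs₁; simp
  have hprev : (s₁.reg (var κ prev)).toNat = readArray n s.store.mem (arr κ Arr.back) i := by
    rw [← hi0, readArray_toNat hin]
    subst hs₁; simp [hne]
  have hsucc : (s₁.reg (var κ succ)).toNat = readArray n s.store.mem (arr κ Arr.next) i := by
    rw [← hi0, readArray_toNat hin]
    subst hs₁; simp [hne]
  have hsize₁ : (s₁.reg (var κ size)).toNat = n := by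
    rw [hf₁.reg _ (by simp), hsize, toNat_ofNat_of_lt hn]
  have hpn : (s₁.reg (var κ prev)).toNat ≤ n := by
    rw [hprev]
    rcases hL.linked.back i hi hit with h | h <;> omega
  have hsn : (s₁.reg (var κ succ)).toNat ≤ n := by
    rw [hsucc]
    rcases hL.linked.next i hi hit with h | h <;> omega
  have hslotn : (s₁.reg (var κ slot)).toNat ≤ n := by rw [hslot]; exact hit
  have heq : ∀ v, (Test.eq (var κ v) (var κ size)).eval s₁.store ↔
      (s₁.reg (var κ v)).toNat = n := by
    intro v
    rw [Test.eval_eq, ← hsize₁]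
    exact BitVec.toNat_inj.symm
  have h1 : Runs [Code.ite (Test.eq (var κ prev) (var κ size))
      (block [store (arr κ Arr.head) (var κ slot) (var κ succ)])
      (block [store (arr κ Arr.next) (var κ prev) (var κ succ)])] s₁ (PMF.pure ())
      (fun _ s₂ => MemFrame κ n (vars κ [slot, prev, succ]) s₁ s₂ ∧
        s₂.store.reg = s₁.store.reg ∧
        readArray n s₂.store.mem = fun a =>
          if (s₁.reg (var κ prev)).toNat = n then
            if a = arr κ Arr.head then Function.update (readArray n s₁.store.mem (arr κ Arr.head))
              (s₁.reg (var κ slot)).toNat (s₁.reg (var κ succ)).toNat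
            else readArray n s₁.store.mem a
          else
            if a = arr κ Arr.next then Function.update (readArray n s₁.store.mem (arr κ Arr.next))
              (s₁.reg (var κ prev)).toNat (s₁.reg (var κ succ)).toNat
            else readArray n s₁.store.mem a) (1 + (3 : ℕ)) := by
    refine Runs.ite (fun h => ?_) (fun h => ?_)
    · rw [heq] at h
      refine (Runs.block rfl (Runs.nil ⟨⟨fun r _ => rfl, fun a ha => ?_, rfl, fun ht => ?_⟩, rfl,
        ?_⟩)).mono (by simp)
      · simp [Instr.apply, update_arr_of_le ha]
      · exact insert_subset_cells ht _ (by omega)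
      · funext a
        simp only [List.foldl, Instr.apply, Store.setMem_mem]
        rw [readArray_update hn hslotn, if_pos h]
    · rw [heq] at h
      refine (Runs.block rfl (Runs.nil ⟨⟨fun r _ => rfl, fun a ha => ?_, rfl, fun ht => ?_⟩, rfl,
        ?_⟩)).mono (by simp)
      · simp [Instr.apply, update_arr_of_le ha]
      · exact insert_subset_cells ht _ (by omega)
      · funext a
        simp only [List.foldl, Instr.apply, Store.setMem_mem]
        rw [readArray_update hn hpn, if_neg h]
  refine Runs.seq (Runs.append_pure (l₁ := [_]) (l₂ := [_]) h1 ?_)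
  intro s₂ ⟨hf₂, hreg₂, hread₂⟩
  have hreg₂' : ∀ r, s₂.reg r = s₁.reg r := fun r => congrFun hreg₂ r
  have hlast : ∀ s₃ : Core w, MemFrame κ n (vars κ [slot, prev, succ]) s₂ s₃ →
      (readArray n s₃.store.mem = fun a =>
        if (s₁.reg (var κ succ)).toNat = n then readArray n s₂.store.mem a
        else if a = arr κ Arr.back then
          Function.update (readArray n s₂.store.mem (arr κ Arr.back))
            (s₁.reg (var κ succ)).toNat (s₁.reg (var κ prev)).toNat
        else readArray n s₂.store.mem a) →
      MemFrame κ n (vars κ [slot, prev, succ]) s s₃ ∧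
        Lists κ n (Function.update τ i (n + 1)) s₃.store.mem := by
    intro s₃ hf₃ hread₃
    refine ⟨(hf₁.trans hf₂).trans hf₃, ?_, ?_⟩
    · have := hL.linked.remove hi hit
      rw [hread₃, hread₂, hmem₁]
      simpa only [arr_inj, reduceCtorEq, if_false, if_true, ite_self, hprev, hsucc, hslot]
        using this
    · intro j hj hjt
      have hji : j ≠ i := by rintro rfl; simp at hjt
      rw [Function.update_of_ne hji] at hjt ⊢
      rw [← hL.slot j hj hjt, hread₃, hread₂, hmem₁]
      simp
  refine Runs.ite (fun h => ?_) (fun h => ?_)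
  · have h : (s₁.reg (var κ succ)).toNat = n := by
      rw [Test.eval_eq, hreg₂', hreg₂'] at h
      rw [h, hsize₁]
    refine (Runs.nil (hlast s₂ ⟨fun r _ => rfl, fun _ _ => rfl, rfl, id⟩ ?_)).skip.mono
      (by norm_num)
    funext a
    simp [h]
  · have h : ¬ (s₁.reg (var κ succ)).toNat = n := by
      intro hc
      apply h
      rw [Test.eval_eq, hreg₂', hreg₂']
      exact (heq succ).2 hc
    refine (Runs.block rfl (Runs.nil ?_)).mono (by simp)
    refine hlast _ ⟨fun r _ => rfl, fun a ha => ?_, rfl, fun ht => ?_⟩ ?_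
    · simp [Instr.apply, update_arr_of_le ha]
    · refine insert_subset_cells ht _ ?_
      change (s₂.reg _).toNat ≤ n
      rw [hreg₂']; exact hsn
    · funext a
      simp only [List.foldl, Instr.apply, Store.setMem_mem]
      rw [readArray_update hn (by change (s₂.reg _).toNat ≤ n; rw [hreg₂']; exact hsn), if_neg h,
        hreg₂]

theorem runs_link {s : Core w} {i t : ℕ} (hn : n < 2 ^ w) (hi : i < n) (hit : n < τ i)
    (ht : t ≤ n) (h0 : s.reg 0 = BitVec.ofNat w i)
    (hsize : s.reg (var κ size) = BitVec.ofNat w n) (htime : s.reg (var κ time) = BitVec.ofNat w t)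
    (hL : Lists κ n τ s.store.mem) :
    Runs [link κ] s (PMF.pure ()) (fun _ s' => MemFrame κ n (vars κ [succ]) s s' ∧
      Lists κ n (Function.update τ i t) s'.store.mem) 16 := by
  have hcost : (1 : ℝ≥0∞) + ((11 : ℕ) + (1 + (3 : ℕ))) ≤ 16 := by
    norm_num
  refine Runs.mono ?_ hcost
  have hi0 : (s.reg 0).toNat = i := by rw [h0, toNat_ofNat_of_lt (by omega)]
  have hin : (s.reg 0).toNat ≤ n := by omega
  have ht0 : (s.reg (var κ time)).toNat = t := by rw [htime, toNat_ofNat_of_lt (by omega)]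
  have htn : (s.reg (var κ time)).toNat ≤ n := by omega
  have hs0 : (s.reg (var κ size)).toNat = n := by rw [hsize, toNat_ofNat_of_lt hn]
  have hne : ∀ v, (0 : ℕ) ≠ var κ v := fun v => by have := le_var κ v; omega
  have hne' : ∀ v, var κ v ≠ 0 := fun v => (hne v).symm
  refine Runs.seq (Runs.block rfl ?_)
  simp only [List.foldl, Instr.apply]
  generalize hs₁ : (Core.mk _ s.out _ : Core w) = s₁
  have hf₁ : MemFrame κ n (vars κ [succ]) s s₁ := by
    subst hs₁
    refine ⟨fun r hr => ?_, fun a ha => ?_, rfl, fun hT => ?_⟩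
    · simp [vars] at hr
      simp [hr]
    · simp [update_arr_of_le ha]
    · simp only [Store.setReg_reg, Store.setMem_reg, hne, if_false, var_inj, reduceCtorEq]
      exact insert_subset_cells (insert_subset_cells (insert_subset_cells (insert_subset_cells
        (insert_subset_cells hT _ htn) _ hin) _ hin) _ htn) _ hin
  have hsucc : (s₁.reg (var κ succ)).toNat = readArray n s.store.mem (arr κ Arr.head) t := by
    rw [← ht0, readArray_toNat htn]
    subst hs₁; simp
  have hread₁ : readArray n s₁.store.mem = fun a =>
      if a = arr κ Arr.slot then Function.update (readArray n s.store.mem (arr κ Arr.slot)) i t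
      else if a = arr κ Arr.head then Function.update (readArray n s.store.mem (arr κ Arr.head)) t i
      else if a = arr κ Arr.back then Function.update (readArray n s.store.mem (arr κ Arr.back)) i n
      else if a = arr κ Arr.next then Function.update (readArray n s.store.mem (arr κ Arr.next)) i
        (readArray n s.store.mem (arr κ Arr.head) t)
      else readArray n s.store.mem a := by
    rw [← hsucc]
    change (s.store.reg 0).toNat ≤ n at hin
    change (s.store.reg (var κ time)).toNat ≤ n at htn
    change (s.store.reg 0).toNat = i at hi0
    change (s.store.reg (var κ time)).toNat = t at ht0
    change (s.store.reg (var κ size)).toNat = n at hs0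
    subst hs₁
    funext a
    simp only [Store.setReg_reg, Store.setMem_reg, hne, if_false, var_inj, reduceCtorEq,
      Store.setMem_mem, Store.setReg_mem, if_true, Core.reg_mk, readArray_update hn hin,
      readArray_update hn htn, hi0, ht0, hs0, arr_inj]
  have hsize₁ : (s₁.reg (var κ size)).toNat = n := by
    rw [hf₁.reg _ (by simp), hs0]
  have h0₁ : s₁.reg 0 = s.reg 0 := hf₁.reg _ (notMem_vars (by omega) _)
  have hsn : (s₁.reg (var κ succ)).toNat ≤ n := by
    rw [hsucc]
    rcases hL.linked.head t ht with h | h <;> omega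
  have hlast : ∀ s₃ : Core w, MemFrame κ n (vars κ [succ]) s₁ s₃ →
      (readArray n s₃.store.mem = fun a =>
        if (s₁.reg (var κ succ)).toNat = n then readArray n s₁.store.mem a
        else if a = arr κ Arr.back then
          Function.update (readArray n s₁.store.mem (arr κ Arr.back))
            (s₁.reg (var κ succ)).toNat i
        else readArray n s₁.store.mem a) →
      MemFrame κ n (vars κ [succ]) s s₃ ∧ Lists κ n (Function.update τ i t) s₃.store.mem := by
    intro s₃ hf₃ hread₃
    refine ⟨hf₁.trans hf₃, ?_, ?_⟩
    · have := hL.linked.insert hi hit ht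
      rw [hread₃, hread₁]
      simpa only [arr_inj, reduceCtorEq, if_false, if_true, ite_self, hsucc] using this
    · intro j hj hjt
      rw [hread₃, hread₁]
      by_cases hji : j = i
      · subst hji
        simp
      · rw [Function.update_of_ne hji] at hjt ⊢
        rw [← hL.slot j hj hjt]
        simp [hji]
  refine Runs.ite (fun h => ?_) (fun h => ?_)
  · have h : (s₁.reg (var κ succ)).toNat = n := by
      rw [Test.eval_eq] at h
      rw [h, hsize₁]
    refine (Runs.nil (hlast s₁ ⟨fun r _ => rfl, fun _ _ => rfl, rfl, id⟩ ?_)).skip.mono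
      (by norm_num)
    funext a
    simp [h]
  · have h : ¬ (s₁.reg (var κ succ)).toNat = n := by
      intro hc
      apply h
      rw [Test.eval_eq]
      apply BitVec.eq_of_toNat_eq
      rw [hc, hsize₁]
    refine (Runs.block rfl (Runs.nil ?_)).mono (by simp)
    refine hlast _ ⟨fun r _ => rfl, fun a ha => ?_, rfl, fun ht => ?_⟩ ?_
    · simp [Instr.apply, update_arr_of_le ha]
    · exact insert_subset_cells ht _ hsn
    · funext a
      simp only [List.foldl, Instr.apply, Store.setMem_mem]
      rw [readArray_update hn hsn, if_neg h]
      congr 2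
      rw [← hi0, ← h0₁]

/-- The registers that `reschedule` may change. -/
def scratch (κ : ℕ) : Set ℕ :=
  {r | r ≠ 0 ∧ r ≠ var κ size ∧ r ≠ var κ Var.clock ∧ r ≠ var κ old}

theorem vars_subset_scratch {L : List Var} (h1 : Var.size ∉ L) (h2 : Var.clock ∉ L)
    (h3 : Var.old ∉ L) : vars κ L ⊆ scratch κ := by
  rintro r ⟨v, hv, rfl⟩
  refine ⟨?_, ?_, ?_, ?_⟩
  · have := le_var κ v
    omega
  all_goals rw [ne_eq, var_inj]; rintro rfl; contradiction

theorem foldl_loadDigits (s : Core w) (h0 : (s.reg 0).toNat ≤ n) : ∀ m ≤ κ + 1,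
    let s' := ((List.range m).map fun j => load (j + 1) j 0).foldl Instr.apply s
    (∀ j < m, s'.reg (j + 1) = s.store.mem j (s.reg 0)) ∧
      (∀ r, r = 0 ∨ m < r → s'.reg r = s.reg r) ∧ s'.store.mem = s.store.mem ∧ s'.out = s.out ∧
      (s.touched ⊆ cells κ n w → s'.touched ⊆ cells κ n w) := by
  intro m
  induction m with
  | zero =>
    intro _
    simp
  | succ m ih =>
    intro hm
    obtain ⟨h1, h2, h3, h4, h5⟩ := ih (by omega)
    simp only [List.range_succ, List.map_append, List.map_cons, List.map_nil, List.foldl_append,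
      List.foldl_cons, List.foldl_nil]
    generalize ((List.range m).map fun j => load (j + 1) j 0).foldl Instr.apply s = s' at *
    have h20 : s'.store.reg 0 = s.reg 0 := h2 0 (Or.inl rfl)
    refine ⟨fun j hj => ?_, fun r hr => ?_, h3, h4, fun ht => ?_⟩
    · by_cases hjm : j = m
      · subst hjm
        simp [Instr.apply, h3, h20]
      · have := h1 j (by omega)
        simp only [Instr.apply, Core.reg_mk, Store.setReg_reg]
        rw [if_neg (by omega)]
        exact this
    · have := h2 r (by omega)
      simp only [Instr.apply, Core.reg_mk, Store.setReg_reg]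
      rw [if_neg (by omega)]
      exact this
    · simp only [Instr.apply]
      refine Finset.insert_subset (mem_cells (by omega) ?_) (h5 ht)
      rw [h20]; exact h0

/-- A bound for the expected time of `reschedule`. -/
def rescheduleTime (κ : ℕ) : ℕ := scheduleTime κ + 2 * κ + 39

theorem nextLaw_le {c : ℕ} (hc : c ≤ n) : ∀ x ∈ (nextLaw n c α).support, x ≤ n := by
  intro x hx
  rw [nextLaw, PMF.mem_support_map_iff] at hx
  obtain ⟨g, hg, rfl⟩ := hx
  have := gap_le α _ g hg
  omega

/-- Drawing the new time affects registers only, so the lists are still intact when the element is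
moved. Between the removal and the insertion its time is `n + 1`, that is, it is in no list. -/
theorem runs_reschedule {s : Core w} {i c : ℕ} (hn : n < 2 ^ w) (hi : i < n) (hc : c < n)
    (hα : Valid κ w α) (h0 : s.reg 0 = BitVec.ofNat w i)
    (hd : ∀ j ≤ κ, s.store.mem j (BitVec.ofNat w i) = digit w α j)
    (hsize : s.reg (var κ size) = BitVec.ofNat w n)
    (hclock : s.reg (var κ Var.clock) = BitVec.ofNat w c)
    (hL : Lists κ n τ s.store.mem) (hit : τ i ≤ n) :
    Runs [reschedule κ] s (nextLaw n c α) (fun x s' => MemFrame κ n (scratch κ) s s' ∧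
      Lists κ n (Function.update τ i x) s'.store.mem) (rescheduleTime κ) := by
  have hcost : (1 : ℝ≥0∞) + ((2 * ((List.range (κ + 1)).map fun j => load (j + 1) j 0).length +
      1 : ℕ) + (1 + (scheduleTime κ + (1 + (17 + 16))))) ≤ rescheduleTime κ := by
    rw [rescheduleTime]
    simp only [List.length_map, List.length_range]
    push_cast
    rw [show (1 : ℝ≥0∞) + (2 * (κ + 1) + 1 + (1 + (scheduleTime κ + (1 + (17 + 16))))) =
      scheduleTime κ + 2 * κ + 39 by ring]
  refine Runs.mono ?_ hcost
  have hi0 : (s.reg 0).toNat ≤ n := by rw [h0, toNat_ofNat_of_lt (by omega)]; omega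
  obtain ⟨h1, h2, h3, h4, h5⟩ := foldl_loadDigits (κ := κ) s hi0 (κ + 1) le_rfl
  refine Runs.seq (Runs.block (by simp [Instr.deterministic]) ?_)
  generalize ((List.range (κ + 1)).map fun j => load (j + 1) j 0).foldl Instr.apply s = s₁ at *
  have hf₁ : MemFrame κ n (scratch κ) s s₁ := by
    refine ⟨fun r hr => h2 r ?_, fun a _ => by rw [h3], h4, h5⟩
    simp only [scratch, Set.mem_ofPred_eq, not_and_or, not_not] at hr
    have := le_var κ size
    have := le_var κ Var.clock
    have := le_var κ old
    omega
  have hvar : ∀ v, s₁.reg (var κ v) = s.reg (var κ v) := fun v => h2 _ (by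
    have := le_var κ v; omega)
  have hs := runs_schedule (s := s₁) hn hc hα (fun j hj => by rw [h1 j (by omega), h0, hd j hj])
    (by rw [hvar, hsize]) (by rw [hvar, hclock])
  refine Runs.seq ?_
  rw [← PMF.bind_pure (nextLaw n c α)]
  refine Runs.append (l₁ := [_]) (l₂ := [_]) hs ?_
  intro x hx s₂ ⟨hf₂, htime₂⟩
  have hxn := nextLaw_le hc.le x hx
  have hu := runs_unlink (κ := κ) (s := s₂) (τ := τ) hn hi hit
    (by rw [hf₂.reg 0 (notMem_vars (by omega) _), h2 0 (Or.inl rfl), h0])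
    (by rw [hf₂.reg _ (by simp [scheduleVars]), hvar, hsize])
    (by rw [hf₂.mem, h3]; exact hL)
  refine Runs.seq (Runs.append_pure (l₁ := [_]) (l₂ := [_]) hu ?_)
  intro s₃ ⟨hf₃, hL₃⟩
  have hl := runs_link (κ := κ) (s := s₃) (i := i) (t := x) hn hi (by simp) hxn
    (by rw [hf₃.reg 0 (notMem_vars (by omega) _), hf₂.reg 0 (notMem_vars (by omega) _),
      h2 0 (Or.inl rfl), h0])
    (by rw [hf₃.reg _ (by simp), hf₂.reg _ (by simp [scheduleVars]), hvar, hsize])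
    (by rw [hf₃.reg _ (by simp), htime₂]) hL₃
  refine (hl.map (fun _ => x) ?_ le_rfl).mono le_rfl |> fun h => by rwa [PMF.pure_map] at h
  intro _ _ s₄ ⟨hf₄, hL₄⟩
  refine ⟨((hf₁.trans (hf₂.memFrame.mono (vars_subset_scratch ?_ ?_ ?_))).trans
    (hf₃.mono (vars_subset_scratch ?_ ?_ ?_))).trans (hf₄.mono (vars_subset_scratch ?_ ?_ ?_)), ?_⟩
  any_goals simp [scheduleVars]
  simpa using hL₄

end Reschedule

/-! ## The program: the three operations -/

section Operations
variable {κ n w : ℕ} {α : I} {p : Fin n → I} {c : ℕ} {τ : Fin n → ℕ} {s s' : Core w}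

/-- A function on `Fin n`, extended by `n + 1`. -/
def ext (τ : Fin n → ℕ) (i : ℕ) : ℕ := if h : i < n then τ ⟨i, h⟩ else n + 1

@[simp] theorem ext_val (τ : Fin n → ℕ) (i : Fin n) : ext τ i = τ i := by simp [ext]

theorem ext_update (τ : Fin n → ℕ) (i : Fin n) (x : ℕ) :
    ext (Function.update τ i x) = Function.update (ext τ) i x := by
  funext j
  by_cases hj : j < n
  · by_cases hji : j = i
    · subst hji; simp
    · have : (⟨j, hj⟩ : Fin n) ≠ i := fun h => hji (congrArg Fin.val h)
      simp [ext, hj, hji, this]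
  · have : j ≠ i := by rintro rfl; exact hj i.2
    simp [ext, hj, this]

/-- The machine represents the state of the algorithm with the vector `p`, the relative time
`c + 1` and the sample times `τ i + 1`. -/
structure Rep (κ : ℕ) (p : Fin n → I) (c : ℕ) (τ : Fin n → ℕ) (s : Core w) : Prop where
  valid : ∀ i, Valid κ w (p i)
  digits : ∀ j ≤ κ, ∀ i : Fin n, s.store.mem j (BitVec.ofNat w i) = digit w (p i) j
  size : s.reg (var κ size) = BitVec.ofNat w n
  clock : s.reg (var κ Var.clock) = BitVec.ofNat w c
  le : ∀ i, τ i ≤ n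
  lists : Lists κ n (ext τ) s.store.mem
  touched : s.touched ⊆ cells κ n w

theorem Rep.frame (h : Rep κ p c τ s) {W : Set ℕ} (hf : MemFrame κ n W s s')
    (hmem : s'.store.mem = s.store.mem) (h1 : var κ Var.size ∉ W) (h2 : var κ Var.clock ∉ W) :
    Rep κ p c τ s' :=
  ⟨h.valid, by rw [hmem]; exact h.digits, (hf.reg _ h1).trans h.size, (hf.reg _ h2).trans h.clock,
    h.le, by rw [hmem]; exact h.lists, hf.touched h.touched⟩

theorem Rep.reschedule (h : Rep κ p c τ s) (hn : n < 2 ^ w) (hc : c < n) (i : Fin n)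
    (h0 : s.reg 0 = BitVec.ofNat w i) :
    Runs [reschedule κ] s (nextLaw n c (p i)) (fun x s' => MemFrame κ n (scratch κ) s s' ∧
      Rep κ p c (Function.update τ i x) s') (rescheduleTime κ) := by
  refine (runs_reschedule hn i.2 hc (h.valid i) h0 (fun j hj => h.digits j hj i) h.size h.clock
    h.lists (by simpa using h.le i)).conseq (fun x hx s' ⟨hf, hL⟩ => ⟨hf, ?_⟩) le_rfl
  refine ⟨h.valid, fun j hj i => ?_, ?_, ?_, fun k => ?_, ?_, hf.touched h.touched⟩
  · rw [hf.mem j hj, h.digits j hj]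
  · rw [hf.reg _ (by simp [scratch]), h.size]
  · rw [hf.reg _ (by simp [scratch]), h.clock]
  · rw [Function.update_apply]
    split_ifs
    · exact nextLaw_le hc.le x hx
    · exact h.le k
  · rw [ext_update]; exact hL

end Operations

/-- Store the probability in the registers `1, …, κ + 1` for the element in register `0`. -/
def storeDigits (κ : ℕ) : Code :=
  block ((List.range (κ + 1)).map fun j => store j 0 (j + 1))

/-- Increase register `0`. -/
def next (κ : ℕ) : Code := block [const (var κ one) 1, bin BinOp.add 0 0 (var κ one)]

/-- Draw new sample times for the elements from the one in register `0` on. -/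
def rescheduleAll (κ : ℕ) : Code :=
  Code.while (Test.lt 0 (var κ size)) (Code.seq (reschedule κ) (next κ))

/-- The operation `init`. -/
def initCode (κ : ℕ) : Code :=
  Code.seq (block [move (var κ size) 0, const (var κ Var.clock) 0, const 0 0]) <|
  Code.seq (Code.while (Test.lt 0 (var κ size))
    (Code.seq (block [store (arr κ Arr.head) 0 (var κ size)]) (next κ))) <|
  Code.seq (block [store (arr κ Arr.head) 0 (var κ size), const 0 0,
    move (var κ time) (var κ size)]) <|
  Code.seq (Code.while (Test.lt 0 (var κ size)) (Code.seq (link κ) (next κ))) <|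
  Code.seq (block [const 0 0]) (rescheduleAll κ)

/-- The operation `set`. -/
def setCode (κ : ℕ) : Code := Code.seq (storeDigits κ) (reschedule κ)

/-- Return the elements of the slot `old` and draw new sample times for them. -/
def popCode (κ : ℕ) : Code :=
  Code.seq (block [load 0 (arr κ Arr.head) (var κ old)]) <|
  Code.while (Test.lt 0 (var κ size)) <|
    Code.seq (block [emit 0]) <| Code.seq (reschedule κ) <|
    block [load 0 (arr κ Arr.head) (var κ old)]

/-- Return the elements of the slot `old`, from the one in register `0` on. -/
def scanCode (κ : ℕ) : Code :=
  Code.while (Test.lt 0 (var κ size)) <|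
    Code.seq (block [load (var κ slot) (arr κ Arr.slot) 0]) <|
    Code.seq (Code.ite (Test.eq (var κ slot) (var κ old)) (block [emit 0]) Code.skip) (next κ)

/-- The operation `sample`. -/
def sampleCode (κ : ℕ) : Code :=
  Code.seq (block [move (var κ old) (var κ Var.clock), const (var κ one) 1,
    bin BinOp.add (var κ Var.clock) (var κ Var.clock) (var κ one), const 0 0]) <|
  Code.ite (Test.lt (var κ Var.clock) (var κ size)) (popCode κ) <|
    Code.seq (scanCode κ) <| Code.seq (block [const (var κ Var.clock) 0, const 0 0]) <|
    rescheduleAll κ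

section Operations
variable {κ n w : ℕ} {α : I} {p : Fin n → I} {c : ℕ} {τ : Fin n → ℕ} {s s' : Core w}

theorem zero_ne_var (v : Var) : (0 : ℕ) ≠ var κ v := by
  have := le_var κ v
  omega

theorem runs_next {m : ℕ} (h0 : s.reg 0 = BitVec.ofNat w m) :
    Runs [next κ] s (PMF.pure ()) (fun _ s' => Frame ({0, var κ one} : Set ℕ) s s' ∧
      s'.reg 0 = BitVec.ofNat w (m + 1)) 5 := by
  refine (Runs.block rfl (Runs.nil ⟨⟨fun r hr => ?_, rfl, rfl, rfl⟩, ?_⟩)).mono (by simp)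
  · simp at hr
    simp [Instr.apply, hr]
  · simp [Instr.apply, BinOp.eval, zero_ne_var, h0, BitVec.ofNat_add]

theorem lt_size_iff {m : ℕ} (hn : n < 2 ^ w) (hm : m ≤ n) (h0 : s.reg 0 = BitVec.ofNat w m)
    (hsize : s.reg (var κ size) = BitVec.ofNat w n) :
    (Test.lt 0 (var κ size)).eval s.store ↔ m < n := by
  rw [Test.eval_lt, h0, hsize, toNat_ofNat_of_lt hn, toNat_ofNat_of_lt (by omega)]

/-- The elements that are not smaller than `m`. -/
def tail (n m : ℕ) : Finset (Fin n) := Finset.univ.filter fun i => m ≤ i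

theorem tail_zero : tail n 0 = Finset.univ := by simp [tail]

theorem tail_self : tail n n = ∅ := by
  ext i
  simp [tail]

theorem tail_eq_insert {m : ℕ} (hm : m < n) : tail n m = insert ⟨m, hm⟩ (tail n (m + 1)) := by
  ext i
  simp only [tail, Finset.mem_filter, Finset.mem_univ, true_and, Finset.mem_insert, Fin.ext_iff]
  omega

theorem runs_rescheduleAll (hn : n < 2 ^ w) (hc : c < n) : ∀ (d m : ℕ) (τ : Fin n → ℕ)
    (s : Core w), n = m + d → Rep κ p c τ s → s.reg 0 = BitVec.ofNat w m →
    Runs [rescheduleAll κ] s (resample (fun i => nextLaw n c (p i)) (tail n m) τ)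
      (fun τ' s' => Rep κ p c τ' s' ∧ s'.out = s.out)
      ((rescheduleTime κ + 7) * d + 1) := by
  intro d
  induction d with
  | zero =>
    intro m τ s hm h h0
    obtain rfl : m = n := by omega
    rw [tail_self, resample_empty]
    refine (Runs.while_neg ?_ (Runs.nil ⟨h, rfl⟩)).mono (by simp)
    rw [lt_size_iff hn le_rfl h0 h.size]
    omega
  | succ d ih =>
    intro m τ s hm h h0
    have hmn : m < n := by omega
    have hcost : (1 : ℝ≥0∞) + (1 + (rescheduleTime κ + (5 + ((rescheduleTime κ + 7) * d + 1)))) ≤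
        (rescheduleTime κ + 7) * (d + 1 : ℕ) + 1 := by
      push_cast
      apply le_of_eq; ring
    refine Runs.mono ?_ hcost
    rw [tail_eq_insert hmn, resample_insert _ (by simp [tail])]
    refine Runs.while_pos ((lt_size_iff hn hmn.le h0 h.size).2 hmn) (Runs.seq ?_)
    refine Runs.append (l₁ := [_]) (l₂ := [_, _]) (h.reschedule hn hc ⟨m, hmn⟩ h0) ?_
    intro x hx s₁ ⟨hf₁, h₁⟩
    have h01 : s₁.reg 0 = BitVec.ofNat w m := by rw [hf₁.reg _ (by simp [scratch]), h0]
    refine Runs.append_pure (l₁ := [_]) (l₂ := [_]) (runs_next h01) ?_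
    intro s₂ ⟨hf₂, h02⟩
    have h₂ := h₁.frame hf₂.memFrame hf₂.mem (by simp [(zero_ne_var _).symm])
      (by simp [(zero_ne_var _).symm])
    refine (ih (m + 1) _ s₂ (by omega) h₂ h02).conseq (fun τ' _ s' ⟨h', ho⟩ => ⟨h', ?_⟩) le_rfl
    rw [ho, hf₂.out, hf₁.out]

theorem foldl_storeDigits (s : Core w) (h0 : (s.reg 0).toNat ≤ n) : ∀ m ≤ κ + 1,
    let s' := ((List.range m).map fun j => store j 0 (j + 1)).foldl Instr.apply s
    s'.store.reg = s.store.reg ∧ s'.out = s.out ∧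
      (∀ j, s'.store.mem j = if j < m then
        Function.update (s.store.mem j) (s.reg 0) (s.reg (j + 1)) else s.store.mem j) ∧
      (s.touched ⊆ cells κ n w → s'.touched ⊆ cells κ n w) := by
  intro m
  induction m with
  | zero =>
    intro _
    simp
  | succ m ih =>
    intro hm
    obtain ⟨h1, h2, h3, h4⟩ := ih (by omega)
    simp only [List.range_succ, List.map_append, List.map_cons, List.map_nil, List.foldl_append,
      List.foldl_cons, List.foldl_nil]
    generalize ((List.range m).map fun j => store j 0 (j + 1)).foldl Instr.apply s = s' at *
    refine ⟨h1, h2, fun j => ?_, fun ht => ?_⟩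
    · simp only [Instr.apply, Store.setMem_mem, h1]
      by_cases hjm : j = m
      · subst hjm
        simp [h3]
      · rw [Function.update_of_ne hjm, h3]
        have : j < m ↔ j < m + 1 := by omega
        simp only [this]
    · simp only [Instr.apply, h1]
      exact Finset.insert_subset (mem_cells (by omega) h0) (h4 ht)

/-- A bound for the expected time of `set`. -/
def setTime (κ : ℕ) : ℕ := rescheduleTime κ + 2 * κ + 4

theorem Rep.runs_set (h : Rep κ p c τ s) (hn : n < 2 ^ w) (hc : c < n) (i : Fin n)
    (h0 : s.reg 0 = BitVec.ofNat w i) (hα : Valid κ w α)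
    (hd : ∀ j ≤ κ, s.reg (j + 1) = digit w α j) :
    Runs [setCode κ] s (nextLaw n c α) (fun x s' =>
      Rep κ (Function.update p i α) c (Function.update τ i x) s') (setTime κ) := by
  have hin : (s.reg 0).toNat ≤ n := by
    have := i.2
    rw [h0, toNat_ofNat_of_lt (by omega)]
    omega
  have hcost : (1 : ℝ≥0∞) + ((2 * ((List.range (κ + 1)).map fun j => store j 0 (j + 1)).length +
      1 : ℕ) + rescheduleTime κ) ≤ setTime κ := by
    rw [setTime]
    simp only [List.length_map, List.length_range]
    push_cast
    apply le_of_eq; ring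
  refine Runs.mono ?_ hcost
  obtain ⟨h1, h2, h3, h4⟩ := foldl_storeDigits (κ := κ) s hin (κ + 1) le_rfl
  refine Runs.seq (Runs.block (by simp [Instr.deterministic]) ?_)
  generalize ((List.range (κ + 1)).map fun j => store j 0 (j + 1)).foldl Instr.apply s = s₁ at *
  have hreg : ∀ r, s₁.reg r = s.reg r := fun r => congrFun h1 r
  have h₁ : Rep κ (Function.update p i α) c τ s₁ := by
    refine ⟨fun k => ?_, fun j hj k => ?_, by rw [hreg, h.size], by rw [hreg, h.clock], h.le, ?_,
      h4 h.touched⟩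
    · rw [Function.update_apply]
      split_ifs
      · exact hα
      · exact h.valid k
    · rw [h3, if_pos (by omega), h0, Function.update_apply, Function.update_apply]
      have : BitVec.ofNat w k = BitVec.ofNat w i ↔ k = i := by
        rw [← BitVec.toNat_inj, toNat_ofNat_of_lt (k.2.trans hn), toNat_ofNat_of_lt (i.2.trans hn),
          Fin.ext_iff]
      simp only [this]
      split_ifs
      · exact hd j hj
      · exact h.digits j hj k
    · have hread : ∀ a, readArray n s₁.store.mem (arr κ a) = readArray n s.store.mem (arr κ a) := by
        intro a
        funext x
        rw [readArray, readArray, h3,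
          if_neg (show ¬ arr κ a < κ + 1 by rw [arr]; omega)]
      exact ⟨by rw [hread, hread, hread]; exact h.lists.linked,
        by rw [hread]; exact h.lists.slot⟩
  have := h₁.reschedule hn hc i (by rw [hreg, h0])
  rw [Function.update_self] at this
  exact this.conseq (fun x _ s' hs => hs.2) le_rfl

/-- `out` lists the elements of `T`. -/
def Enumerates (T : Finset (Fin n)) (out : List (BitVec w)) : Prop :=
  ∃ L : List (Fin n), L.Nodup ∧ (∀ i, i ∈ L ↔ i ∈ T) ∧ out = L.map fun i : Fin n => BitVec.ofNat w i

theorem Enumerates.nil : Enumerates (∅ : Finset (Fin n)) ([] : List (BitVec w)) :=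
  ⟨[], by simp⟩

theorem Enumerates.cons {T : Finset (Fin n)} {out : List (BitVec w)} (h : Enumerates T out)
    {i : Fin n} (hi : i ∉ T) : Enumerates (insert i T) (BitVec.ofNat w i :: out) := by
  obtain ⟨L, h1, h2, rfl⟩ := h
  refine ⟨i :: L, List.nodup_cons.2 ⟨by rwa [h2], h1⟩, fun j => ?_, rfl⟩
  rw [List.mem_cons, Finset.mem_insert, h2]

theorem nextLaw_ge : ∀ x ∈ (nextLaw n c α).support, c ≤ x := by
  intro x hx
  rw [nextLaw, PMF.mem_support_map_iff] at hx
  obtain ⟨g, _, rfl⟩ := hx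
  omega

/-- Between `s` and `s'`, the elements of `T` are returned. -/
def Emits (T : Finset (Fin n)) (s s' : Core w) : Prop :=
  ∃ out, Enumerates T out ∧ s'.out = s.out ++ out

/-- One memory access decides whether a slot is empty; by `Linked.head_ne` a nonempty one cannot
carry the end marker. -/
theorem Rep.head (h : Rep κ p c τ s) {t : ℕ} (ht : t ≤ n) :
    (due t τ = ∅ ∧ s.store.mem (arr κ Arr.head) (BitVec.ofNat w t) = BitVec.ofNat w n) ∨
      ∃ i : Fin n, i ∈ due t τ ∧
        s.store.mem (arr κ Arr.head) (BitVec.ofNat w t) = BitVec.ofNat w i := by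
  have hread : readArray n s.store.mem (arr κ Arr.head) t =
      (s.store.mem (arr κ Arr.head) (BitVec.ofNat w t)).toNat := by rw [readArray, if_pos ht]
  have heq : ∀ m, readArray n s.store.mem (arr κ Arr.head) t = m →
      s.store.mem (arr κ Arr.head) (BitVec.ofNat w t) = BitVec.ofNat w m := by
    intro m hm
    rw [← hm, hread]
    simp
  rcases h.lists.linked.head t ht with h1 | ⟨h1, h2, _⟩
  · refine Or.inl ⟨?_, heq n h1⟩
    by_contra hne
    obtain ⟨i, hi⟩ := Finset.nonempty_iff_ne_empty.2 hne
    have hit : τ i = t := by simpa [due] using hi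
    refine h.lists.linked.head_ne i.2 (by simpa using h.le i) ?_
    rw [ext_val, hit, h1]
  · refine Or.inr ⟨⟨_, h1⟩, ?_, heq _ rfl⟩
    simpa [due, ext, h1] using h2

/-- A bound for the expected time of an iteration of `popCode`. -/
def popTime (κ : ℕ) : ℕ := rescheduleTime κ + 9

/-- New times are at least `c`, hence later than `t`, so a popped element does not return to the
list and each iteration removes exactly one. The head is read anew every time, and the order of the
elements is irrelevant by `resample_insert`. -/
theorem runs_pop_loop {t : ℕ} (hn : n < 2 ^ w) (hc : c < n) (ht : t < c) : ∀ (d : ℕ)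
    (τ : Fin n → ℕ) (s : Core w), (due t τ).card = d → Rep κ p c τ s →
    s.reg (var κ old) = BitVec.ofNat w t →
    s.reg 0 = s.store.mem (arr κ Arr.head) (BitVec.ofNat w t) →
    Runs [Code.while (Test.lt 0 (var κ size)) (Code.seq (block [emit 0]) (Code.seq (reschedule κ)
      (block [load 0 (arr κ Arr.head) (var κ old)])))] s
      (resample (fun i => nextLaw n c (p i)) (due t τ) τ)
      (fun τ' s' => Rep κ p c τ' s' ∧ Emits (due t τ) s s') (popTime κ * d + 1) := by
  intro d
  induction d with
  | zero =>
    intro τ s hd h hold h0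
    rw [Finset.card_eq_zero] at hd
    rcases h.head (show t ≤ n by omega) with ⟨_, h2⟩ | ⟨i, hi, _⟩
    · rw [h2] at h0
      rw [hd, resample_empty]
      refine (Runs.while_neg ?_ (Runs.nil ⟨h, [], Enumerates.nil, by simp⟩)).mono (by simp)
      rw [lt_size_iff hn le_rfl h0 h.size]
      omega
    · simp [hd] at hi
  | succ d ih =>
    intro τ s hd h hold h0
    have hcost : (1 : ℝ≥0∞) + (1 + ((3 : ℕ) + (1 + (rescheduleTime κ + ((3 : ℕ) +
        (popTime κ * d + 1)))))) ≤ popTime κ * (d + 1 : ℕ) + 1 := by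
      rw [popTime]
      push_cast
      apply le_of_eq; ring
    rcases h.head (show t ≤ n by omega) with ⟨h1, _⟩ | ⟨i, hi, h2⟩
    · simp [h1] at hd
    rw [h2] at h0
    have hdue : due t τ = insert i ((due t τ).erase i) := (Finset.insert_erase hi).symm
    refine Runs.mono ?_ hcost
    refine Runs.while_pos ((lt_size_iff hn i.2.le h0 h.size).2 i.2) (Runs.seq (Runs.block rfl ?_))
    simp only [List.foldl, Instr.apply]
    generalize hs₁ : (Core.mk s.store _ s.touched : Core w) = s₁
    have hstore : s₁.store = s.store := by subst hs₁; rfl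
    have hreg : ∀ r, s₁.reg r = s.reg r := fun r => by rw [Core.reg, hstore]
    have hout₁ : s₁.out = s.out ++ [BitVec.ofNat w i] := by subst hs₁; simp [← h0]
    have h₁ : Rep κ p c τ s₁ := by
      refine ⟨h.valid, ?_, ?_, ?_, h.le, ?_, ?_⟩
      · rw [hstore]; exact h.digits
      · rw [hreg, h.size]
      · rw [hreg, h.clock]
      · rw [hstore]; exact h.lists
      · subst hs₁; exact h.touched
    refine Runs.seq ?_
    rw [hdue, resample_insert _ (Finset.notMem_erase _ _)]
    refine Runs.append (l₁ := [_]) (l₂ := [_, _]) (h₁.reschedule hn hc i (by rw [hreg, h0])) ?_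
    intro x hx s₂ ⟨hf₂, h₂⟩
    have hold₂ : s₂.reg (var κ old) = BitVec.ofNat w t := by
      rw [hf₂.reg _ (by simp [scratch]), hreg, hold]
    refine Runs.block rfl ?_
    simp only [List.foldl, Instr.apply]
    generalize hs₃ : (Core.mk _ s₂.out _ : Core w) = s₃
    have hf₃ : MemFrame κ n ({0} : Set ℕ) s₂ s₃ := by
      subst hs₃
      refine ⟨fun r hr => ?_, fun a _ => rfl, rfl, fun hT => insert_subset_cells hT _ ?_⟩
      · simp at hr
        simp [hr]
      · change (s₂.reg _).toNat ≤ n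
        rw [hold₂, toNat_ofNat_of_lt (by omega)]
        omega
    have hmem₃ : s₃.store.mem = s₂.store.mem := by subst hs₃; rfl
    have h₃ := h₂.frame hf₃ hmem₃ (by simp [(zero_ne_var _).symm]) (by simp [(zero_ne_var _).symm])
    have hdue' : due t (Function.update τ i x) = (due t τ).erase i := by
      have hxc := nextLaw_ge x hx
      ext k
      by_cases hk : k = i
      · subst hk
        simp [due]; omega
      · simp [due, hk]
    have hold₃ : s₃.reg (var κ old) = BitVec.ofNat w t := by
      rw [hf₃.reg _ (by simp [(zero_ne_var _).symm]), hold₂]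
    have h0₃ : s₃.reg 0 = s₃.store.mem (arr κ Arr.head) (BitVec.ofNat w t) := by
      rw [hmem₃, ← hold₂]
      subst hs₃
      simp
    have := ih _ s₃ (by rw [hdue', Finset.card_erase_of_mem hi, hd]; rfl) h₃ hold₃ h0₃
    rw [hdue'] at this
    refine this.conseq (fun τ' _ s' ⟨h', out, he, ho⟩ => ⟨h', _, he.cons (Finset.notMem_erase _ _),
      ?_⟩) le_rfl
    rw [ho, hf₃.out, hf₂.out, hout₁]
    simp

theorem runs_pop {t : ℕ} (hn : n < 2 ^ w) (hc : c < n) (ht : t < c) (h : Rep κ p c τ s)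
    (hold : s.reg (var κ old) = BitVec.ofNat w t) :
    Runs [popCode κ] s (resample (fun i => nextLaw n c (p i)) (due t τ) τ)
      (fun τ' s' => Rep κ p c τ' s' ∧ Emits (due t τ) s s')
      (popTime κ * (due t τ).card + 5) := by
  refine Runs.mono (t₁ := 1 + ((3 : ℕ) + (popTime κ * (due t τ).card + 1))) ?_ ?_
  · refine Runs.seq (Runs.block rfl ?_)
    simp only [List.foldl, Instr.apply]
    generalize hs₁ : (Core.mk _ s.out _ : Core w) = s₁
    have hf₁ : MemFrame κ n ({0} : Set ℕ) s s₁ := by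
      subst hs₁
      refine ⟨fun r hr => ?_, fun a _ => rfl, rfl, fun hT => insert_subset_cells hT _ ?_⟩
      · simp at hr
        simp [hr]
      · change (s.reg _).toNat ≤ n
        rw [hold, toNat_ofNat_of_lt (by omega)]
        omega
    have hmem₁ : s₁.store.mem = s.store.mem := by subst hs₁; rfl
    have h₁ := h.frame hf₁ hmem₁ (by simp [(zero_ne_var _).symm]) (by simp [(zero_ne_var _).symm])
    refine (runs_pop_loop hn hc ht _ τ s₁ rfl h₁ ?_ ?_).conseq
      (fun τ' _ s' ⟨h', out, he, ho⟩ => ⟨h', out, he, by rw [ho, hf₁.out]⟩) le_rfl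
    · rw [hf₁.reg _ (by simp [(zero_ne_var _).symm]), hold]
    · rw [hmem₁, ← hold]
      subst hs₁
      simp
  · push_cast
    apply le_of_eq; ring

/-- At a rebuild the new times start from zero and may fall into the slot being returned, so popping
could meet an element twice. The slot is therefore listed by a scan before anything is redrawn; the
rebuild takes linear time anyway. -/
theorem runs_scan {t : ℕ} (hn : n < 2 ^ w) (ht : t ≤ n) : ∀ (d m : ℕ) (s : Core w), n = m + d →
    Rep κ p c τ s → s.reg 0 = BitVec.ofNat w m → s.reg (var κ old) = BitVec.ofNat w t →
    Runs [scanCode κ] s (PMF.pure ()) (fun _ s' => Rep κ p c τ s' ∧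
      Emits ((due t τ).filter fun i : Fin n => m ≤ i) s s') (15 * d + 1) := by
  intro d
  induction d with
  | zero =>
    intro m s hm h h0 hold
    refine (Runs.while_neg ?_ (Runs.nil ⟨h, [], ?_, by simp⟩)).mono (by simp)
    · rw [lt_size_iff hn (by omega) h0 h.size]
      omega
    · rw [Finset.filter_eq_empty_iff.2 fun i _ => by have := i.2; omega]
      exact Enumerates.nil
  | succ d ih =>
    intro m s hm h h0 hold
    have hmn : m < n := by omega
    have hcost : (1 : ℝ≥0∞) + (1 + ((3 : ℕ) + (1 + ((1 + (3 : ℕ)) + (5 + (15 * d + 1)))))) ≤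
        15 * (d + 1 : ℕ) + 1 := by
      push_cast
      rw [show (1 : ℝ≥0∞) + (1 + (3 + (1 + ((1 + 3) + (5 + (15 * d + 1)))))) = 15 * d + 16 by ring,
        mul_add, add_assoc]
      gcongr
      norm_num
    refine Runs.mono ?_ hcost
    refine Runs.while_pos ((lt_size_iff hn hmn.le h0 h.size).2 hmn) (Runs.seq (Runs.block rfl ?_))
    simp only [List.foldl, Instr.apply]
    generalize hs₁ : (Core.mk _ s.out _ : Core w) = s₁
    have hf₁ : MemFrame κ n (vars κ [Var.slot]) s s₁ := by
      subst hs₁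
      refine ⟨fun r hr => ?_, fun a _ => rfl, rfl, fun hT => insert_subset_cells hT _ ?_⟩
      · simp [vars] at hr
        simp [hr]
      · change (s.reg _).toNat ≤ n
        rw [h0, toNat_ofNat_of_lt (by omega)]
        omega
    have hmem₁ : s₁.store.mem = s.store.mem := by subst hs₁; rfl
    have h₁ := h.frame hf₁ hmem₁ (by simp) (by simp)
    have hslot : s₁.reg (var κ Var.slot) = BitVec.ofNat w (τ ⟨m, hmn⟩) := by
      have h2 := h.lists.slot m hmn (by simpa [ext, hmn] using h.le ⟨m, hmn⟩)
      rw [readArray, if_pos hmn.le, ← h0] at h2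
      have h3 : ext τ m = τ ⟨m, hmn⟩ := by simp [ext, hmn]
      rw [← h3, ← h2]
      subst hs₁
      simp
    have h0₁ : s₁.reg 0 = BitVec.ofNat w m := by rw [hf₁.reg _ (notMem_vars (by omega) _), h0]
    have hold₁ : s₁.reg (var κ old) = BitVec.ofNat w t := by rw [hf₁.reg _ (by simp), hold]
    have htest : (Test.eq (var κ Var.slot) (var κ old)).eval s₁.store ↔ τ ⟨m, hmn⟩ = t := by
      have := h.le ⟨m, hmn⟩
      rw [Test.eval_eq, hslot, hold₁, ← BitVec.toNat_inj, toNat_ofNat_of_lt (by omega),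
        toNat_ofNat_of_lt (by omega)]
    have hmid : Runs [Code.ite (Test.eq (var κ Var.slot) (var κ old)) (block [emit 0]) Code.skip]
        s₁ (PMF.pure ()) (fun _ s₂ => s₂.store = s₁.store ∧ s₂.touched = s₁.touched ∧
          s₂.out = s₁.out ++ if τ ⟨m, hmn⟩ = t then [BitVec.ofNat w m] else []) (1 + (3 : ℕ)) := by
      refine Runs.ite (fun h => ?_) (fun h => ?_)
      · rw [htest] at h
        refine (Runs.block rfl (Runs.nil ⟨rfl, rfl, ?_⟩)).mono (by simp)
        simp only [List.foldl, Instr.apply]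
        rw [if_pos h, ← h0₁]
      · rw [htest] at h
        refine (Runs.skip (Runs.nil ⟨rfl, rfl, ?_⟩)).mono (by norm_num)
        simp [h]
    refine Runs.seq (Runs.append_pure (l₁ := [_]) (l₂ := [_, _]) hmid ?_)
    intro s₂ ⟨hst₂, ht₂, hout₂⟩
    have hreg₂ : ∀ r, s₂.reg r = s₁.reg r := fun r => by rw [Core.reg, hst₂]
    refine Runs.append_pure (l₁ := [_]) (l₂ := [_]) (runs_next (κ := κ) (m := m)
      (by rw [hreg₂, h0₁])) ?_
    intro s₃ ⟨hf₃, h0₃⟩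
    have h₃ : Rep κ p c τ s₃ := by
      have hmem₃ : s₃.store.mem = s₁.store.mem := by rw [hf₃.mem, hst₂]
      refine ⟨h.valid, ?_, ?_, ?_, h.le, ?_, ?_⟩
      · rw [hmem₃]; exact h₁.digits
      · rw [hf₃.reg _ (by simp [(zero_ne_var _).symm]), hreg₂, h₁.size]
      · rw [hf₃.reg _ (by simp [(zero_ne_var _).symm]), hreg₂, h₁.clock]
      · rw [hmem₃]; exact h₁.lists
      · rw [hf₃.touched, ht₂]; exact h₁.touched
    refine (ih (m + 1) s₃ (by omega) h₃ h0₃ (by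
      rw [hf₃.reg _ (by simp [(zero_ne_var _).symm]), hreg₂, hold₁])).conseq
      (fun _ _ s' ⟨h', out, he, ho⟩ => ⟨h', ?_⟩) le_rfl
    by_cases hmt : τ ⟨m, hmn⟩ = t
    · have hset : (due t τ).filter (fun i : Fin n => m ≤ i) =
          insert ⟨m, hmn⟩ ((due t τ).filter fun i : Fin n => m + 1 ≤ i) := by
        ext i
        simp only [due, Finset.mem_filter, Finset.mem_univ, true_and, Finset.mem_insert,
          Fin.ext_iff]
        constructor
        · rintro ⟨h1, h2⟩
          by_cases h3 : (i : ℕ) = m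
          · exact Or.inl h3
          · exact Or.inr ⟨h1, by omega⟩
        · rintro (h1 | ⟨h1, h2⟩)
          · have : i = ⟨m, hmn⟩ := Fin.ext h1
            subst this
            exact ⟨hmt, le_rfl⟩
          · exact ⟨h1, by omega⟩
      rw [hset]
      refine ⟨_, he.cons (by simp), ?_⟩
      rw [ho, hf₃.out, hout₂, if_pos hmt, hf₁.out]
      simp
    · have hset : (due t τ).filter (fun i : Fin n => m ≤ i) = (due t τ).filter fun i : Fin n => m + 1 ≤ i := by
        ext i
        simp only [due, Finset.mem_filter, Finset.mem_univ, true_and]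
        refine and_congr_right fun h1 => ⟨fun h2 => ?_, fun h2 => by omega⟩
        rcases Nat.eq_or_lt_of_le h2 with h3 | h3
        · exfalso
          apply hmt
          have : i = ⟨m, hmn⟩ := Fin.ext h3.symm
          rw [← this, h1]
        · exact h3
      rw [hset]
      refine ⟨out, he, ?_⟩
      rw [ho, hf₃.out, hout₂, if_neg hmt, hf₁.out]
      simp

/-- A constant in the bound for the expected time of `sample`. -/
def sampleTime (κ : ℕ) : ℕ := rescheduleTime κ + 45

/-- A bound for the expected time of a call of `sample`. -/
def sampleBound (κ : ℕ) (c : ℕ) (τ : Fin n → ℕ) : ℕ :=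
  sampleTime κ * (1 + if c + 1 < n then (due c τ).card else n)

theorem Rep.runs_sample (h : Rep κ p c τ s) (hn : n < 2 ^ w) (hc : c < n) :
    Runs [sampleCode κ] s (refresh p c τ) (fun τ' s' => Rep κ p ((c + 1) % n) τ' s' ∧
      Emits (due c τ) s s') (sampleBound κ c τ) := by
  have hstart : ∀ (Q : (Fin n → ℕ) → Core w → Prop) (t : ℝ≥0∞),
      (∀ s₁ : Core w, Rep κ p (c + 1) τ s₁ → s₁.reg (var κ Var.old) = BitVec.ofNat w c →
        s₁.reg 0 = 0#w → s₁.out = s.out →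
        Runs [Code.ite (Test.lt (var κ Var.clock) (var κ Var.size)) (popCode κ) <|
          Code.seq (scanCode κ) <| Code.seq (block [const (var κ Var.clock) 0, const 0 0]) <|
          rescheduleAll κ] s₁ (refresh p c τ) Q t) →
      Runs [sampleCode κ] s (refresh p c τ) Q (1 + ((9 : ℕ) + t)) := by
    intro Q t hQ
    refine Runs.seq (Runs.block rfl ?_)
    simp only [List.foldl, Instr.apply]
    generalize hs₁ : (Core.mk _ s.out s.touched : Core w) = s₁
    have hvar := fun v => (zero_ne_var (κ := κ) v).symm
    have hclock := h.clock
    refine hQ s₁ ⟨h.valid, ?_, ?_, ?_, h.le, ?_, ?_⟩ ?_ ?_ ?_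
    · subst hs₁; exact h.digits
    · have := h.size
      subst hs₁; simpa [hvar] using this
    · subst hs₁; simp [hvar, BinOp.eval, hclock, BitVec.ofNat_add]
    · subst hs₁; exact h.lists
    · subst hs₁; exact h.touched
    · subst hs₁; simpa [hvar] using hclock
    · subst hs₁; simp
    · subst hs₁; rfl
  have htest : ∀ s₁ : Core w, Rep κ p (c + 1) τ s₁ →
      ((Test.lt (var κ Var.clock) (var κ Var.size)).eval s₁.store ↔ c + 1 < n) := by
    intro s₁ h₁
    rw [Test.eval_lt, h₁.clock, h₁.size, toNat_ofNat_of_lt hn, toNat_ofNat_of_lt (by omega)]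
  by_cases hcn : c + 1 < n
  · rw [Nat.mod_eq_of_lt hcn]
    refine (hstart _ (1 + (popTime κ * (due c τ).card + 5)) fun s₁ h₁ hold _ hout => ?_).mono ?_
    · refine Runs.ite_pos ((htest s₁ h₁).2 hcn) ?_
      rw [refresh, if_pos hcn]
      refine (runs_pop hn hcn (Nat.lt_succ_self c) h₁ hold).conseq
        (fun τ' _ s' ⟨h', out, he, ho⟩ => ⟨h', out, he, by rw [ho, hout]⟩) le_rfl
    · rw [sampleBound, if_pos hcn]
      norm_cast
      have : popTime κ ≤ sampleTime κ := by simp [popTime, sampleTime]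
      have h2 := Nat.mul_le_mul_right (due c τ).card this
      have h3 : 45 ≤ sampleTime κ := by simp [sampleTime]
      rw [mul_add]
      omega
  · have hcn' : c + 1 = n := by omega
    rw [show (c + 1) % n = 0 by rw [hcn', Nat.mod_self]]
    refine (hstart _ (1 + (1 + ((15 * n + 1) + (1 + ((5 : ℕ) +
      ((rescheduleTime κ + 7) * n + 1)))))) fun s₁ h₁ hold h0 hout => ?_).mono ?_
    · refine Runs.ite_neg (by rw [htest s₁ h₁]; exact hcn) (Runs.seq ?_)
      refine Runs.append_pure (l₁ := [_]) (l₂ := [_])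
        (runs_scan (m := 0) hn hc.le n s₁ (by simp) h₁ h0 hold) ?_
      intro s₂ ⟨h₂, hout₂⟩
      refine Runs.seq (Runs.block rfl ?_)
      simp only [List.foldl, Instr.apply]
      generalize hs₃ : (Core.mk _ s₂.out s₂.touched : Core w) = s₃
      have h₃ : Rep κ p 0 τ s₃ := by
        have hsize := h₂.size
        refine ⟨h.valid, ?_, ?_, ?_, h.le, ?_, ?_⟩
        · subst hs₃; exact h₂.digits
        · subst hs₃; simpa [(zero_ne_var _).symm] using hsize
        · subst hs₃; simp [(zero_ne_var _).symm]
        · subst hs₃; exact h₂.lists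
        · subst hs₃; exact h₂.touched
      have h0₃ : s₃.reg 0 = BitVec.ofNat w 0 := by subst hs₃; simp
      rw [refresh, if_neg hcn, ← resample_univ _ τ, ← tail_zero]
      refine (runs_rescheduleAll hn (by omega) n 0 τ s₃ (by simp) h₃ h0₃).conseq
        (fun τ' _ s' ⟨h', ho⟩ => ⟨h', ?_⟩) le_rfl
      obtain ⟨out, he, ho₂⟩ := hout₂
      refine ⟨out, by simpa using he, ?_⟩
      have : s₃.out = s₂.out := by subst hs₃; rfl
      rw [ho, this, ho₂, hout]
    · rw [sampleBound, if_neg hcn, sampleTime]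
      norm_cast
      have h1 : 1 ≤ n := by omega
      ring_nf
      nlinarith

end Operations

-- Building the lists from arbitrary memory contents

section Initialization
variable {κ n w : ℕ} {p : Fin n → I} {s : Core w}

theorem runs_clear (hn : n < 2 ^ w) : ∀ (d m : ℕ) (s : Core w), n = m + d →
    s.reg 0 = BitVec.ofNat w m → s.reg (var κ size) = BitVec.ofNat w n →
    (∀ t < m, s.store.mem (arr κ Arr.head) (BitVec.ofNat w t) = BitVec.ofNat w n) →
    Runs [Code.while (Test.lt 0 (var κ size))
      (Code.seq (block [store (arr κ Arr.head) 0 (var κ size)]) (next κ))] s (PMF.pure ())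
      (fun _ s' => MemFrame κ n {0, var κ one} s s' ∧ s'.reg 0 = BitVec.ofNat w n ∧
        ∀ t < n, s'.store.mem (arr κ Arr.head) (BitVec.ofNat w t) = BitVec.ofNat w n)
      (10 * d + 1) := by
  intro d
  induction d with
  | zero =>
    intro m s hm h0 hsize hhead
    obtain rfl : m = n := by omega
    refine (Runs.while_neg ?_ (Runs.nil ⟨⟨fun _ _ => rfl, fun _ _ => rfl, rfl, id⟩, h0,
      hhead⟩)).mono (by simp)
    rw [lt_size_iff hn le_rfl h0 hsize]
    omega
  | succ d ih =>
    intro m s hm h0 hsize hhead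
    have hmn : m < n := by omega
    have hcost : (1 : ℝ≥0∞) + (1 + ((3 : ℕ) + (5 + (10 * d + 1)))) ≤ 10 * (d + 1 : ℕ) + 1 := by
      push_cast
      apply le_of_eq; ring
    refine Runs.mono ?_ hcost
    refine Runs.while_pos ((lt_size_iff hn hmn.le h0 hsize).2 hmn) (Runs.seq (Runs.block rfl ?_))
    simp only [List.foldl, Instr.apply]
    generalize hs₁ : (Core.mk _ s.out _ : Core w) = s₁
    have hf₁ : MemFrame κ n {0, var κ one} s s₁ := by
      subst hs₁
      refine ⟨fun _ _ => rfl, fun a ha => ?_, rfl, fun hT => insert_subset_cells hT _ ?_⟩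
      · simp [update_arr_of_le ha]
      · change (s.reg 0).toNat ≤ n
        rw [h0, toNat_ofNat_of_lt (by omega)]
        omega
    have h0₁ : s₁.reg 0 = BitVec.ofNat w m := by subst hs₁; exact h0
    have hsize₁ : s₁.reg (var κ size) = BitVec.ofNat w n := by subst hs₁; exact hsize
    have hhead₁ : ∀ t < m + 1,
        s₁.store.mem (arr κ Arr.head) (BitVec.ofNat w t) = BitVec.ofNat w n := by
      intro t ht
      subst hs₁
      simp only [Store.setMem_mem, Function.update_self]
      rw [Function.update_apply]
      split_ifs with h
      · exact hsize
      · refine hhead t ?_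
        have : t ≠ m := by
          rintro rfl
          exact h h0.symm
        omega
    refine Runs.append_pure (l₁ := [_]) (l₂ := [_]) (runs_next h0₁) ?_
    intro s₂ ⟨hf₂, h0₂⟩
    refine (ih (m + 1) s₂ (by omega) h0₂ ?_ ?_).conseq
      (fun _ _ s' ⟨hf, h⟩ => ⟨(hf₁.trans hf₂.memFrame).trans hf, h⟩) le_rfl
    · rw [hf₂.reg _ (by simp [(zero_ne_var _).symm]), hsize₁]
    · rw [hf₂.mem]; exact hhead₁

/-- All elements first enter the list of slot `n`, so that the following redraw can unlink them like
any others. -/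
theorem runs_linkAll (hn : n < 2 ^ w) : ∀ (d m : ℕ) (s : Core w), n = m + d →
    s.reg 0 = BitVec.ofNat w m → s.reg (var κ size) = BitVec.ofNat w n →
    s.reg (var κ time) = BitVec.ofNat w n →
    Lists κ n (fun i => if i < m then n else n + 1) s.store.mem →
    Runs [Code.while (Test.lt 0 (var κ size)) (Code.seq (link κ) (next κ))] s (PMF.pure ())
      (fun _ s' => MemFrame κ n (insert 0 (vars κ [one, succ])) s s' ∧
        Lists κ n (ext fun _ : Fin n => n) s'.store.mem) (23 * d + 1) := by
  intro d
  induction d with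
  | zero =>
    intro m s hm h0 hsize htime hL
    obtain rfl : m = n := by omega
    refine (Runs.while_neg ?_ (Runs.nil ⟨⟨fun _ _ => rfl, fun _ _ => rfl, rfl, id⟩,
      ?_⟩)).mono (by simp)
    · rw [lt_size_iff hn le_rfl h0 hsize]
      omega
    · have : (ext fun _ : Fin m => m) = fun i => if i < m then m else m + 1 := by
        funext i
        by_cases hi : i < m <;> simp [ext, hi]
      rw [this]
      exact hL
  | succ d ih =>
    intro m s hm h0 hsize htime hL
    have hmn : m < n := by omega
    have hcost : (1 : ℝ≥0∞) + (1 + (16 + (5 + (23 * d + 1)))) ≤ 23 * (d + 1 : ℕ) + 1 := by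
      push_cast
      apply le_of_eq; ring
    refine Runs.mono ?_ hcost
    refine Runs.while_pos ((lt_size_iff hn hmn.le h0 hsize).2 hmn) (Runs.seq ?_)
    refine Runs.append_pure (l₁ := [_]) (l₂ := [_, _])
      (runs_link hn hmn (by simp) le_rfl h0 hsize htime hL) ?_
    intro s₁ ⟨hf₁, hL₁⟩
    have hW : vars κ [succ] ⊆ insert 0 (vars κ [one, succ]) :=
      (vars_mono (by simp)).trans (Set.subset_insert _ _)
    have h0₁ : s₁.reg 0 = BitVec.ofNat w m := by rw [hf₁.reg _ (notMem_vars (by omega) _), h0]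
    refine Runs.append_pure (l₁ := [_]) (l₂ := [_]) (runs_next h0₁) ?_
    intro s₂ ⟨hf₂, h0₂⟩
    have hW' : ({0, var κ one} : Set ℕ) ⊆ insert 0 (vars κ [one, succ]) := by
      rintro r (rfl | rfl) <;> simp
    refine (ih (m + 1) s₂ (by omega) h0₂ ?_ ?_ ?_).conseq
      (fun _ _ s' ⟨hf, h⟩ => ⟨((hf₁.mono hW).trans (hf₂.memFrame.mono hW')).trans hf, h⟩) le_rfl
    · rw [hf₂.reg _ (by simp [(zero_ne_var _).symm]), hf₁.reg _ (by simp), hsize]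
    · rw [hf₂.reg _ (by simp [(zero_ne_var _).symm]), hf₁.reg _ (by simp), htime]
    · rw [hf₂.mem]
      convert hL₁ using 1
      funext i
      rw [Function.update_apply]
      split_ifs <;> first | rfl | omega

/-- A constant in the bound for the expected time of `init`. -/
def initTime (κ : ℕ) : ℕ := rescheduleTime κ + 66

theorem runs_init (hn : n < 2 ^ w) (hn' : 1 ≤ n) (hp : ∀ i, Valid κ w (p i))
    (hd : ∀ j ≤ κ, ∀ i : Fin n, s.store.mem j (BitVec.ofNat w i) = digit w (p i) j)
    (h0 : s.reg 0 = BitVec.ofNat w n) (ht : s.touched ⊆ cells κ n w) :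
    Runs [initCode κ] s (piLaw fun i => nextLaw n 0 (p i)) (fun τ s' => Rep κ p 0 τ s')
      (initTime κ * n : ℕ) := by
  have hcost : (1 : ℝ≥0∞) + ((7 : ℕ) + (1 + ((10 * n + 1) + (1 + ((7 : ℕ) + (1 + ((23 * n + 1) +
      (1 + ((3 : ℕ) + ((rescheduleTime κ + 7) * n + 1)))))))))) ≤ (initTime κ * n : ℕ) := by
    rw [initTime]
    norm_cast
    nlinarith
  refine Runs.mono ?_ hcost
  have hvar := fun v => (zero_ne_var (κ := κ) v).symm
  refine Runs.seq (Runs.block rfl ?_)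
  simp only [List.foldl, Instr.apply]
  generalize hs₁ : (Core.mk _ s.out s.touched : Core w) = s₁
  have hsize₁ : s₁.reg (var κ size) = BitVec.ofNat w n := by subst hs₁; simp [hvar, ← h0]
  have hclock₁ : s₁.reg (var κ Var.clock) = BitVec.ofNat w 0 := by subst hs₁; simp [hvar]
  have h0₁ : s₁.reg 0 = BitVec.ofNat w 0 := by subst hs₁; simp
  have hmem₁ : s₁.store.mem = s.store.mem := by subst hs₁; rfl
  have ht₁ : s₁.touched = s.touched := by subst hs₁; rfl
  refine Runs.seq (Runs.append_pure (l₁ := [_]) (l₂ := [_])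
    (runs_clear hn n 0 s₁ (by simp) h0₁ hsize₁ (by simp)) ?_)
  intro s₂ ⟨hf₂, h0₂, hhead₂⟩
  have hsize₂ : s₂.reg (var κ size) = BitVec.ofNat w n := by
    rw [hf₂.reg _ (by simp [hvar]), hsize₁]
  refine Runs.seq (Runs.block rfl ?_)
  simp only [List.foldl, Instr.apply]
  generalize hs₃ : (Core.mk _ s₂.out _ : Core w) = s₃
  have hf₃ : MemFrame κ n (insert 0 (vars κ [time])) s₂ s₃ := by
    subst hs₃
    refine ⟨fun r hr => ?_, fun a ha => ?_, rfl, fun hT => insert_subset_cells hT _ ?_⟩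
    · simp [vars] at hr
      simp [hr]
    · simp [update_arr_of_le ha]
    · change (s₂.reg 0).toNat ≤ n
      rw [h0₂, toNat_ofNat_of_lt hn]
  have hsize₃ : s₃.reg (var κ size) = BitVec.ofNat w n := by
    rw [hf₃.reg _ (by simp [hvar]), hsize₂]
  have htime₃ : s₃.reg (var κ time) = BitVec.ofNat w n := by
    subst hs₃
    simpa [hvar] using hsize₂
  have h0₃ : s₃.reg 0 = BitVec.ofNat w 0 := by subst hs₃; simp [zero_ne_var]
  have hhead₃ : ∀ t ≤ n, readArray n s₃.store.mem (arr κ Arr.head) t = n := by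
    intro t htn
    rw [readArray, if_pos htn]
    have hst : s₃.store.mem (arr κ Arr.head) (BitVec.ofNat w t) = BitVec.ofNat w n := by
      subst hs₃
      simp only [Store.setMem_mem, Store.setReg_mem, Function.update_self]
      rw [Function.update_apply]
      split_ifs with h
      · exact hsize₂
      · refine hhead₂ t ?_
        have : t ≠ n := by
          rintro rfl
          exact h h0₂.symm
        omega
    rw [hst, toNat_ofNat_of_lt hn]
  -- No element is in a list yet, so the cleared heads are the only condition and the other arrays
  -- may contain anything.
  have hL₃ : Lists κ n (fun i => if i < 0 then n else n + 1) s₃.store.mem := by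
    refine ⟨⟨fun i _ h => ?_, fun i _ h => ?_, fun t h => Or.inl (hhead₃ t h), fun _ => 0,
      fun i _ h => ?_⟩, fun i _ h => ?_⟩ <;> simp at h
  refine Runs.seq (Runs.append_pure (l₁ := [_]) (l₂ := [_])
    (runs_linkAll hn n 0 s₃ (by simp) h0₃ hsize₃ htime₃ hL₃) ?_)
  intro s₄ ⟨hf₄, hL₄⟩
  refine Runs.seq (Runs.block rfl ?_)
  simp only [List.foldl, Instr.apply]
  generalize hs₅ : (Core.mk _ s₄.out s₄.touched : Core w) = s₅
  have hreg : ∀ v, v = Var.size ∨ v = Var.clock → s₅.reg (var κ v) = s₁.reg (var κ v) := by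
    intro v hv
    have h5 : s₅.reg (var κ v) = s₄.reg (var κ v) := by subst hs₅; simp [hvar]
    rcases hv with rfl | rfl <;>
      rw [h5, hf₄.reg _ (by simp [hvar]), hf₃.reg _ (by simp [hvar]), hf₂.reg _ (by simp [hvar])]
  have hmem₅ : s₅.store.mem = s₄.store.mem := by subst hs₅; rfl
  have h₅ : Rep κ p 0 (fun _ => n) s₅ := by
    refine ⟨hp, fun j hj i => ?_, ?_, ?_, fun _ => le_rfl, ?_, ?_⟩
    · rw [hmem₅, hf₄.mem j hj, hf₃.mem j hj, hf₂.mem j hj, hmem₁, hd j hj]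
    · rw [hreg _ (Or.inl rfl), hsize₁]
    · rw [hreg _ (Or.inr rfl), hclock₁]
    · rw [hmem₅]; exact hL₄
    · subst hs₅
      exact hf₄.touched (hf₃.touched (hf₂.touched (by rw [ht₁]; exact ht)))
  rw [← resample_univ _ fun _ => n, ← tail_zero]
  exact (runs_rescheduleAll hn (by omega) n 0 _ s₅ (by simp) h₅ (by subst hs₅; simp)).conseq
    (fun τ _ s' h => h.1) le_rfl

end Initialization

/-! ## Reading the state of the algorithm off the machine -/

section Decoding
variable {κ n w : ℕ} {α : I} {p : Fin n → I} {c : ℕ} {τ : Fin n → ℕ} {s : Core w}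

/-- Each floor is `2 ^ w` times the previous one plus the next digit, so the sum telescopes.
Positive `w` ensures that the integer part, which may be `1`, fits into a word. -/
theorem sum_digit (hw : 1 ≤ w) (α : I) : ∀ m : ℕ,
    ∑ j ∈ Finset.range (m + 1), ((digit w α j).toNat : ℝ) / 2 ^ (w * j) =
      (⌊(α : ℝ) * 2 ^ (w * m)⌋₊ : ℝ) / 2 ^ (w * m)
  | 0 => by
    have h1 : ⌊(α : ℝ)⌋₊ ≤ 1 := Nat.floor_le_of_le (by simpa using α.2.2)
    have h2 := Nat.one_lt_two_pow (n := w) (by omega)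
    have h3 : (digit w α 0).toNat = ⌊(α : ℝ)⌋₊ := by
      rw [digit, mul_zero, pow_zero, mul_one, toNat_ofNat_of_lt (by omega)]
    simp [h3]
  | m + 1 => by
    rw [Finset.sum_range_succ, sum_digit hw α m]
    have h1 : ⌊(α : ℝ) * 2 ^ (w * (m + 1))⌋₊ / 2 ^ w = ⌊(α : ℝ) * 2 ^ (w * m)⌋₊ := by
      rw [← Nat.floor_div_natCast]
      congr 1
      push_cast
      rw [mul_add, mul_one, pow_add]
      field_simp
    have h2 := Nat.div_add_mod ⌊(α : ℝ) * 2 ^ (w * (m + 1))⌋₊ (2 ^ w)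
    rw [h1] at h2
    have h3 : (digit w α (m + 1)).toNat = ⌊(α : ℝ) * 2 ^ (w * (m + 1))⌋₊ % 2 ^ w := by
      rw [digit, BitVec.toNat_ofNat]
    rw [h3]
    have h4 : (⌊(α : ℝ) * 2 ^ (w * (m + 1))⌋₊ : ℝ) = 2 ^ w * (⌊(α : ℝ) * 2 ^ (w * m)⌋₊ : ℝ) +
        (⌊(α : ℝ) * 2 ^ (w * (m + 1))⌋₊ % 2 ^ w : ℕ) := by exact_mod_cast h2.symm
    rw [h4, mul_add w m 1, mul_one, pow_add]
    field_simp

/-- The state of the algorithm that a store represents. -/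
def decode (κ n : ℕ) (m : Store w) : State n :=
  mkState (fun i => Set.projIcc 0 1 zero_le_one
      (∑ j ∈ Finset.range (κ + 1), ((m.mem j (BitVec.ofNat w i)).toNat : ℝ) / 2 ^ (w * j)))
    (m.reg (var κ Var.clock)).toNat
    fun i => (m.mem (arr κ Arr.slot) (BitVec.ofNat w i)).toNat

/-- By the precision assumption the last floor in `sum_digit` is exact, so the digits determine `p`;
clock and slot array give the rest. -/
theorem Rep.decode (h : Rep κ p c τ s) (hn : n < 2 ^ w) (hc : c < n) :
    decode κ n s.store = mkState p c τ := by
  have hw : 1 ≤ w := by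
    by_contra hw
    obtain rfl : w = 0 := by omega
    omega
  have h1 : (s.store.reg (var κ Var.clock)).toNat = c := by
    have := h.clock
    rw [Core.reg] at this
    rw [this, toNat_ofNat_of_lt (by omega)]
  have h2 : (fun i : Fin n => (s.store.mem (arr κ Arr.slot) (BitVec.ofNat w i)).toNat) = τ := by
    funext i
    have := h.lists.slot i i.2 (by simpa using h.le i)
    rwa [readArray, if_pos i.2.le, ext_val] at this
  rw [SetSampler.decode, h1, h2]
  congr 1
  funext i
  have h3 : ∑ j ∈ Finset.range (κ + 1),
      ((s.store.mem j (BitVec.ofNat w i)).toNat : ℝ) / 2 ^ (w * j) = p i := by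
    rw [Finset.sum_congr rfl fun j hj => by
      rw [h.digits j (by simpa [Nat.lt_succ_iff] using hj) i], sum_digit hw]
    obtain ⟨a, ha⟩ := (h.valid i).2
    rw [ha, Nat.floor_natCast, ← ha]
    field_simp
  rw [h3, Set.projIcc_val]

end Decoding

/-! ## The laws of the calls -/

/-- The implementation of the algorithm on the word RAM. -/
def program (κ : ℕ) : Program := ⟨initCode κ, setCode κ, sampleCode κ⟩

/-- The machine between two calls. -/
def Session.core {w : ℕ} (s : Session w) : Core w := ⟨s.store, [], s.touched⟩

theorem map_congr_of_support {A B : Type*} (μ : PMF A) {f g : A → B}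
    (h : ∀ x ∈ μ.support, f x = g x) : μ.map f = μ.map g :=
  bind_congr_of_support μ _ _ fun x hx => by simp [h x hx]

section Calls
variable {κ n w : ℕ} {α : I} {p : Fin n → I} {c : ℕ} {τ : Fin n → ℕ} {s : Session w}

/-- The machine at the start of a call. -/
def callCore (args : List (BitVec w)) (m : Store w) (T : Finset (ℕ × BitVec w)) : Core w :=
  ⟨{ m with reg := fun r => (args[r]?).getD (m.reg r) }, [], T⟩

theorem Rep.core {s' : Core w} (h : Rep κ p c τ s') (t : ℕ) :
    Rep κ p c τ (Session.core ⟨s'.store, s'.touched, t⟩) :=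
  ⟨h.valid, h.digits, h.size, h.clock, h.le, h.lists, h.touched⟩

theorem callCore_reg_var {args : List (BitVec w)} (ha : args.length ≤ κ + 2) (m : Store w)
    (T : Finset (ℕ × BitVec w)) (v : Var) : (callCore args m T).reg (var κ v) = m.reg (var κ v) := by
  have := le_var κ v
  simp [callCore, List.getElem?_eq_none (show args.length ≤ var κ v by omega)]

theorem Rep.call (h : Rep κ p c τ s.core) {args : List (BitVec w)} (ha : args.length ≤ κ + 2) :
    Rep κ p c τ (callCore args s.store s.touched) :=
  ⟨h.valid, h.digits, (callCore_reg_var ha _ _ _).trans h.size,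
    (callCore_reg_var ha _ _ _).trans h.clock, h.le, h.lists, h.touched⟩

theorem readSet_of_enumerates (hn : n < 2 ^ w) {T : Finset (Fin n)} {out : List (BitVec w)}
    (h : Enumerates T out) : readSet n out = some T := by
  obtain ⟨L, h1, h2, rfl⟩ := h
  have hinj : Function.Injective fun i : Fin n => BitVec.ofNat w i := by
    intro i j hij
    have := congrArg BitVec.toNat hij
    simp only at this
    rw [toNat_ofNat_of_lt (i.2.trans hn), toNat_ofNat_of_lt (j.2.trans hn)] at this
    exact Fin.ext this
  rw [readSet, if_pos]
  · congr 1
    ext i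
    rw [Finset.mem_filter, ← h2]
    simp only [Finset.mem_univ, true_and]
    exact List.mem_map_of_injective hinj
  · refine ⟨h1.map hinj, fun x hx => ?_⟩
    obtain ⟨i, _, rfl⟩ := List.mem_map.1 hx
    have := i.2
    rw [toNat_ofNat_of_lt (by omega)]
    exact i.2

theorem runs_initCall (hn : n < 2 ^ w) (hn' : 1 ≤ n) (hp : ∀ i, Valid κ w (p i)) {m : Store w}
    (hm : HoldsInput κ p m) :
    Runs [initCode κ] (callCore [BitVec.ofNat w n] m ∅) (piLaw fun i => nextLaw n 0 (p i))
      (fun τ s' => Rep κ p 0 τ s') (initTime κ * n : ℕ) :=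
  runs_init hn hn' hp hm (by simp [callCore]) (by simp [callCore])

theorem Rep.runs_setCall (h : Rep κ p c τ s.core) (hn : n < 2 ^ w) (hc : c < n) (i : Fin n)
    (hα : Valid κ w α) :
    Runs [setCode κ] (callCore (BitVec.ofNat w i :: SetSampler.digits κ w α) s.store s.touched)
      (nextLaw n c α) (fun x s' =>
        Rep κ (Function.update p i α) c (Function.update τ i x) s') (setTime κ) := by
  refine (h.call (by simp [SetSampler.digits])).runs_set hn hc i (by simp [callCore]) hα
    fun j hj => ?_
  simp [callCore, SetSampler.digits, Nat.lt_succ_iff.2 hj]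

theorem Rep.runs_sampleCall (h : Rep κ p c τ s.core) (hn : n < 2 ^ w) (hc : c < n) :
    Runs [sampleCode κ] (callCore [] s.store s.touched) (refresh p c τ)
      (fun τ' s' => Rep κ p ((c + 1) % n) τ' s' ∧ Enumerates (due c τ) s'.out)
      (sampleBound κ c τ) := by
  refine ((h.call (by simp)).runs_sample hn hc).conseq (fun τ' _ s' ⟨h', out, he, ho⟩ => ⟨h', ?_⟩)
    le_rfl
  rw [ho]
  simpa [callCore] using he

theorem ram_start (hn : n < 2 ^ w) (hn' : 1 ≤ n) (hp : ∀ i, Valid κ w (p i)) {m : Store w}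
    (hm : HoldsInput κ p m) : ∃ ρ : PMF ((Fin n → ℕ) × Session w),
      ρ.map Prod.fst = (piLaw fun i => nextLaw n 0 (p i)) ∧
      (∀ x ∈ ρ.support, Rep κ p 0 x.1 x.2.core ∧ x.2.sampleTime = 0) ∧
      (ram (program κ) κ n m).start = ρ.map fun x => some x.2 := by
  obtain ⟨ρ, h1, h2, -, h3⟩ := (runs_initCall hn hn' hp hm).runLaw_eq
  refine ⟨ρ.map fun x => (x.1, ⟨x.2.1.store, x.2.1.touched, 0⟩), ?_, ?_, ?_⟩
  · rw [PMF.map_comp]; exact h1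
  · intro y hy
    rw [PMF.mem_support_map_iff] at hy
    obtain ⟨x, hx, rfl⟩ := hy
    exact ⟨(h2 x hx).core 0, rfl⟩
  · change (runLaw _).map _ = _
    rw [PMF.map_comp]
    have h3 : runLaw (callConfig (program κ).init [BitVec.ofNat w n] m ∅) = _ := h3
    rw [h3, PMF.map_comp]
    rfl

theorem Rep.ram_set (h : Rep κ p c τ s.core) (hn : n < 2 ^ w) (hc : c < n) (m : Store w)
    (i : Fin n) (hα : Valid κ w α) : ∃ ρ : PMF (ℕ × Session w),
      ρ.map Prod.fst = nextLaw n c α ∧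
      (∀ x ∈ ρ.support, Rep κ (Function.update p i α) c (Function.update τ i x.1) x.2.core ∧
        x.2.sampleTime = s.sampleTime) ∧
      (ram (program κ) κ n m).set i α (some s) = ρ.map fun x => some x.2 := by
  obtain ⟨ρ, h1, h2, -, h3⟩ := (h.runs_setCall hn hc i hα).runLaw_eq
  refine ⟨ρ.map fun x => (x.1, ⟨x.2.1.store, x.2.1.touched, s.sampleTime⟩), ?_, ?_, ?_⟩
  · rw [PMF.map_comp]; exact h1
  · intro y hy
    rw [PMF.mem_support_map_iff] at hy
    obtain ⟨x, hx, rfl⟩ := hy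
    exact ⟨(h2 x hx).core _, rfl⟩
  · change (runLaw _).map _ = _
    rw [PMF.map_comp]
    have h3 : runLaw (callConfig (program κ).set (BitVec.ofNat w i :: SetSampler.digits κ w α)
      s.store s.touched) = _ := h3
    rw [h3, PMF.map_comp]
    rfl

theorem Rep.ram_sample (h : Rep κ p c τ s.core) (hn : n < 2 ^ w) (hc : c < n) (m : Store w) :
    ∃ ρ : PMF ((Fin n → ℕ) × Session w),
      ρ.map Prod.fst = refresh p c τ ∧
      (∀ x ∈ ρ.support, Rep κ p ((c + 1) % n) x.1 x.2.core) ∧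
      mean ρ (fun x => (x.2.sampleTime : ℝ≥0∞)) ≤ s.sampleTime + sampleBound κ c τ ∧
      (ram (program κ) κ n m).sample (some s) = ρ.map fun x => (due c τ, some x.2) := by
  obtain ⟨ρ, h1, h2, h4, h3⟩ := (h.runs_sampleCall hn hc).runLaw_eq
  refine ⟨ρ.map fun x => (x.1, ⟨x.2.1.store, x.2.1.touched, s.sampleTime + x.2.2⟩), ?_, ?_, ?_, ?_⟩
  · rw [PMF.map_comp]; exact h1
  · intro y hy
    rw [PMF.mem_support_map_iff] at hy
    obtain ⟨x, hx, rfl⟩ := hy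
    exact (h2 x hx).1.core _
  · rw [mean_map]
    simp only [Nat.cast_add]
    rw [mean_add, mean_const]
    gcongr
  · change (runLaw _).map _ = _
    have h3 : runLaw (callConfig (program κ).sample [] s.store s.touched) = _ := h3
    rw [h3, PMF.map_comp, PMF.map_comp]
    refine map_congr_of_support ρ fun x hx => ?_
    have hr := readSet_of_enumerates hn (h2 x hx).2
    simp only [Function.comp_apply, Core.config, hr]

end Calls

/-! ## The interaction of the machine with an adversary -/

/-- An amortized estimate averaged without subtraction, which `ℝ≥0∞` does not support well: the
witness `e` is the expected increase of the work, and the potential grows by at most `K` times as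
much. -/
theorem exists_drift {A B : Type*} (μ : PMF A) (ν : A → PMF B) {a b : A → ℝ≥0∞}
    {f g : B → ℝ≥0∞} {K : ℝ≥0∞}
    (h : ∀ x ∈ μ.support, ∃ e, mean (ν x) f ≤ a x + K * e ∧ b x + e ≤ mean (ν x) g) :
    ∃ e, mean (μ.bind ν) f ≤ mean μ a + K * e ∧ mean μ b + e ≤ mean (μ.bind ν) g := by
  choose! e h1 h2 using h
  refine ⟨mean μ e, ?_, ?_⟩
  · rw [mean_bind, ← mean_const_mul, ← mean_add]
    exact mean_mono μ h1
  · rw [mean_bind, ← mean_add]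
    exact mean_mono μ h2

section Interaction
variable {κ n w : ℕ} {p : Fin n → I}

/-- The machine represents some state of the algorithm. -/
def Good (κ n : ℕ) (s : Session w) : Prop :=
  ∃ (p : Fin n → I) (c : ℕ) (τ : Fin n → ℕ), c < n ∧ Rep κ p c τ s.core

/-- The accumulated time of `sample`, and the time saved for the next rebuild. -/
def potential (κ : ℕ) : Option (Session w) → ℝ≥0∞
  | none => ⊤
  | some s => s.sampleTime + sampleTime κ * (s.store.reg (var κ Var.clock)).toNat

theorem Rep.potential_eq {c : ℕ} {τ : Fin n → ℕ} {s : Session w} (h : Rep κ p c τ s.core)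
    (hn : n < 2 ^ w) (hc : c < n) :
    potential κ (some s) = s.sampleTime + sampleTime κ * c := by
  have : (s.store.reg (var κ Var.clock)).toNat = c := by
    have := h.clock
    change s.store.reg _ = _ at this
    rw [this, toNat_ofNat_of_lt (by omega)]
  simp only [potential, this]

/-- The joint law of state and transcript after answering a request. -/
def answer {S : Type} (D : Sampler n S) (x : S × List (Event n)) :
    Op n → PMF (S × List (Event n))
  | Op.set i α => (D.set i α x.1).map fun s => (s, Event.set i α :: x.2)
  | Op.sample => (D.sample x.1).map fun y => (y.2, Event.sample y.1 :: x.2)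

theorem play_succ {S : Type} (D : Sampler n S) (adv : Adversary n) (k : ℕ) :
    D.play adv (k + 1) = (D.play adv k).bind fun x => (adv x.2).bind (answer D x) := by
  rw [Sampler.play]
  congr 1

/-- Replace the state of the machine by the state of the algorithm that it represents. -/
def view (κ : ℕ) (x : Option (Session w) × List (Event n)) : Option (State n) × List (Event n) :=
  (x.1.map fun s => decode κ n s.store, x.2)

/-- One round of the interaction. The witness `e` is zero for `set` and `1 + |T|` for `sample`; the
returned set `T` is a function of the state before the call. -/
theorem answer_ram (hn : n < 2 ^ w) {s : Session w} (hs : Good κ n s) (m : Store w)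
    (p₀ : Fin n → I) (h : List (Event n)) (o : Op n)
    (ho : ∀ i α, o = Op.set i α → Valid κ w α) :
    let μ := answer (ram (program κ) κ n m) (some s, h) o
    (μ.map (view κ) = (answer (algorithm n p₀) (decode κ n s.store, h) o).map
      fun x => (some x.1, x.2)) ∧
    (∀ x ∈ μ.support, ∃ s', x.1 = some s' ∧ Good κ n s') ∧
    ∃ e, mean μ (fun x => potential κ x.1) ≤ potential κ (some s) + (2 * sampleTime κ : ℕ) * e ∧
      (sampleWork h : ℝ≥0∞) + e ≤ mean μ fun x => (sampleWork x.2 : ℝ≥0∞) := by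
  obtain ⟨p, c, τ, hc, hr⟩ := hs
  intro μ
  have hdec : decode κ n s.store = mkState p c τ := hr.decode hn hc
  cases o with
  | set i α =>
    obtain ⟨ρ, h1, h2, h3⟩ := hr.ram_set hn hc m i (ho i α rfl)
    have hμ : μ = ρ.map fun x => (some x.2, Event.set i α :: h) := by
      change ((ram (program κ) κ n m).set i α (some s)).map _ = _
      rw [h3, PMF.map_comp]
      rfl
    refine ⟨?_, ?_, 0, ?_, ?_⟩
    · change _ = ((State.set i α (decode κ n s.store)).map _).map _
      rw [hdec, set_mkState _ _ _ hc.le, ← h1, hμ]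
      simp only [PMF.map_comp]
      refine map_congr_of_support ρ fun x hx => ?_
      have := (h2 x hx).1.decode hn hc
      change decode κ n x.2.store = _ at this
      simp [view, this]
    · intro x hx
      rw [hμ, PMF.mem_support_map_iff] at hx
      obtain ⟨y, hy, rfl⟩ := hx
      exact ⟨_, rfl, _, _, _, hc, (h2 y hy).1⟩
    · rw [hμ, mean_map, mul_zero, add_zero]
      refine mean_le_of_forall ρ fun x hx => ?_
      rw [(h2 x hx).1.potential_eq hn hc, hr.potential_eq hn hc, (h2 x hx).2]
    · rw [hμ, mean_map, add_zero]
      exact (mean_const ρ _).ge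
  | sample =>
    obtain ⟨ρ, h1, h2, h4, h3⟩ := hr.ram_sample hn hc m
    have hμ : μ = ρ.map fun x => (some x.2, Event.sample (due c τ) :: h) := by
      change ((ram (program κ) κ n m).sample (some s)).map _ = _
      rw [h3, PMF.map_comp]
      rfl
    have hc' : (c + 1) % n < n := Nat.mod_lt _ (by omega)
    refine ⟨?_, ?_, ((1 + (due c τ).card : ℕ) : ℝ≥0∞), ?_, ?_⟩
    · change _ = ((State.sample (decode κ n s.store)).map _).map _
      rw [hdec, sample_mkState _ hc, ← h1, hμ]
      simp only [PMF.map_comp]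
      refine map_congr_of_support ρ fun x hx => ?_
      have := (h2 x hx).decode hn hc'
      change decode κ n x.2.store = _ at this
      simp [view, this]
    · intro x hx
      rw [hμ, PMF.mem_support_map_iff] at hx
      obtain ⟨y, hy, rfl⟩ := hx
      exact ⟨_, rfl, _, _, _, hc', h2 y hy⟩
    · rw [hμ, mean_map, hr.potential_eq hn hc]
      have h5 : mean ρ (fun x => potential κ (some x.2)) ≤
          mean ρ fun x => (x.2.sampleTime : ℝ≥0∞) + sampleTime κ * ((c + 1) % n : ℕ) :=
        mean_mono ρ fun x hx => ((h2 x hx).potential_eq hn hc').le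
      refine h5.trans ?_
      rw [mean_add, mean_const]
      refine (add_le_add_left h4 _).trans ?_
      rw [add_assoc, add_assoc]
      refine add_le_add_right ?_ _
      norm_cast
      rw [sampleBound]
      -- Let `K = sampleTime κ`. An ordinary call costs `K * (1 + |T|)` and adds `K` to the
      -- potential of the clock. A rebuild costs `K * (1 + n) = K * c + 2 * K`, of which `K * c` has
      -- been saved. Both amount to at most `2 * K * (1 + |T|)`.
      by_cases hcn : c + 1 < n
      · rw [if_pos hcn, Nat.mod_eq_of_lt hcn]
        nlinarith [Nat.zero_le (sampleTime κ * (due c τ).card)]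
      · have hcn' : c + 1 = n := by omega
        have hmul : sampleTime κ * n = sampleTime κ * c + sampleTime κ := by rw [← hcn']; ring
        rw [if_neg hcn, hcn', Nat.mod_self]
        nlinarith [Nat.zero_le (sampleTime κ * (due c τ).card)]
    · rw [hμ, mean_map]
      refine le_trans ?_ (mean_const ρ (sampleWork (Event.sample (due c τ) :: h) : ℝ≥0∞)).ge
      change (sampleWork h : ℝ≥0∞) + _ ≤ ((1 + (due c τ).card + sampleWork h : ℕ) : ℝ≥0∞)
      norm_cast
      omega

/-- The claims go through the induction together: that all reachable states are good is what allows
`answer_ram` to be applied in the next round. -/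
theorem play_ram (hn : n < 2 ^ w) (hn' : 1 ≤ n) (hp : ∀ i, Valid κ w (p i)) {m : Store w}
    (hm : HoldsInput κ p m) (adv : Adversary n)
    (hadv : ∀ h i α, Op.set i α ∈ (adv h).support → Valid κ w α) : ∀ k : ℕ,
    let μ := (ram (program κ) κ n m).play adv k
    (μ.map (view κ) = ((algorithm n p).play adv k).map fun x => (some x.1, x.2)) ∧
    (∀ x ∈ μ.support, ∃ s, x.1 = some s ∧ Good κ n s) ∧
    mean μ (fun x => potential κ x.1) ≤ (2 * sampleTime κ : ℕ) * mean μ fun x =>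
      (sampleWork x.2 : ℝ≥0∞)
  | 0 => by
    intro μ
    obtain ⟨ρ, h1, h2, h3⟩ := ram_start hn hn' hp hm
    have hμ : μ = ρ.map fun x => (some x.2, []) := by
      change ((ram (program κ) κ n m).start).map _ = _
      rw [h3, PMF.map_comp]
      rfl
    refine ⟨?_, ?_, ?_⟩
    · change _ = ((State.init p).map _).map _
      rw [init_eq, ← h1, hμ]
      simp only [PMF.map_comp]
      refine map_congr_of_support ρ fun x hx => ?_
      have := (h2 x hx).1.decode hn hn'
      change decode κ n x.2.store = _ at this
      simp [view, this]
    · intro x hx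
      rw [hμ, PMF.mem_support_map_iff] at hx
      obtain ⟨y, hy, rfl⟩ := hx
      exact ⟨_, rfl, _, _, _, hn', (h2 y hy).1⟩
    · rw [hμ, mean_map]
      refine (mean_le_of_forall ρ (c := 0) fun x hx => ?_).trans zero_le
      rw [(h2 x hx).1.potential_eq hn hn', (h2 x hx).2]
      simp
  | k + 1 => by
    obtain ⟨h1, h2, h3⟩ := play_ram hn hn' hp hm adv hadv k
    intro μ
    have hμ : μ = ((ram (program κ) κ n m).play adv k).bind fun x =>
        (adv x.2).bind (answer (ram (program κ) κ n m) x) := play_succ _ _ _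
    refine ⟨?_, ?_, ?_⟩
    -- One round of the algorithm, extended to `none` arbitrarily. Since `view` keeps the
    -- transcript, on which the request depends, a round of the machine becomes a round of `G`.
    · let G : Option (State n) × List (Event n) → PMF (Option (State n) × List (Event n)) :=
        fun y => match y.1 with
          | none => PMF.pure y
          | some t => ((adv y.2).bind (answer (algorithm n p) (t, y.2))).map fun x => (some x.1, x.2)
      have hG : μ.map (view κ) = (((ram (program κ) κ n m).play adv k).map (view κ)).bind G := by
        rw [hμ, PMF.map_bind, PMF.bind_map]
        refine bind_congr_of_support _ _ _ fun x hx => ?_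
        obtain ⟨s, hs, hgood⟩ := h2 x hx
        obtain ⟨o, h⟩ := x
        obtain rfl : o = some s := hs
        change _ = ((adv h).bind (answer (algorithm n p) (decode κ n s.store, h))).map _
        rw [PMF.map_bind, PMF.map_bind]
        refine bind_congr_of_support _ _ _ fun o ho => ?_
        exact (answer_ram hn hgood m p h o fun i α hi => hadv h i α (hi ▸ ho)).1
      rw [hG, h1, PMF.bind_map, play_succ, PMF.map_bind]
      rfl
    · intro y hy
      rw [hμ, PMF.mem_support_bind_iff] at hy
      obtain ⟨x, hx, hy⟩ := hy
      rw [PMF.mem_support_bind_iff] at hy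
      obtain ⟨o, ho, hy⟩ := hy
      obtain ⟨s, hs, hgood⟩ := h2 x hx
      obtain ⟨o', h⟩ := x
      obtain rfl : o' = some s := hs
      exact (answer_ram hn hgood m p h o fun i α hi => hadv h i α (hi ▸ ho)).2.1 y hy
    · obtain ⟨e, he1, he2⟩ := exists_drift ((ram (program κ) κ n m).play adv k)
        (fun x => (adv x.2).bind (answer (ram (program κ) κ n m) x))
        (a := fun x => potential κ x.1) (b := fun x => (sampleWork x.2 : ℝ≥0∞))
        (f := fun x => potential κ x.1) (g := fun x => (sampleWork x.2 : ℝ≥0∞))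
        (K := (2 * sampleTime κ : ℕ)) fun x hx => by
          obtain ⟨s, hs, hgood⟩ := h2 x hx
          obtain ⟨o', h⟩ := x
          obtain rfl : o' = some s := hs
          have := exists_drift (adv h) (answer (ram (program κ) κ n m) (some s, h))
            (a := fun _ => potential κ (some s)) (b := fun _ => (sampleWork h : ℝ≥0∞))
            (f := fun x => potential κ x.1) (g := fun x => (sampleWork x.2 : ℝ≥0∞))
            (K := (2 * sampleTime κ : ℕ)) fun o ho =>
              (answer_ram hn hgood m p h o fun i α hi => hadv h i α (hi ▸ ho)).2.2
          rwa [mean_const, mean_const] at this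
      rw [hμ]
      refine he1.trans ((add_le_add_left h3 _).trans ?_)
      rw [← mul_add]
      exact mul_le_mul_right he2 _

end Interaction

end SetSampler

end

-- Assembling the theorem and its constant

theorem theorem4p7 :
    -- the algorithm is a dynamic set sampler, against every output-adaptive adversary
    (∀ (n : ℕ), 1 ≤ n → ∀ (p : Fin n → unitInterval) (adv : SetSampler.Adversary n) (k : ℕ),
      ((SetSampler.algorithm n p).play adv k).map Prod.snd =
        ((SetSampler.ideal n p).play adv k).map Prod.snd) ∧
    -- and it has an efficient implementation on the word RAM
    ∀ κ : ℕ, ∃ (P : SetSampler.Program) (C : ℕ), ∀ (w n : ℕ), 1 ≤ n → n < 2 ^ w →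
      ∃ decode : SetSampler.Store w → SetSampler.State n,
      ∀ pmin : ℝ, 0 < pmin → Real.logb 2 (1 / pmin) ≤ κ * w →
      ∀ p : Fin n → unitInterval,
        (∀ i, pmin ≤ (p i : ℝ) ∧ SetSampler.HasPrecision κ w (p i)) →
      ∀ m : SetSampler.Store w, SetSampler.HoldsInput κ p m →
        -- `init`
        SetSampler.meanTime (SetSampler.initLaw P n m) ≤ (C : ENNReal) * n ∧
        ∀ adv : SetSampler.Adversary n,
          (∀ h i α, SetSampler.Op.set i α ∈ (adv h).support →
            pmin ≤ (α : ℝ) ∧ SetSampler.HasPrecision κ w α) →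
        ∀ k : ℕ,
          -- the program implements the algorithm
          ((SetSampler.ram P κ n m).play adv k).map
              (fun x => (x.1.map fun s => decode s.store, x.2)) =
            ((SetSampler.algorithm n p).play adv k).map (fun x => (some x.1, x.2)) ∧
          -- amortized time of `sample`
          SetSampler.meanSampleTime ((SetSampler.ram P κ n m).play adv k) ≤
            C * SetSampler.meanSampleWork ((SetSampler.ram P κ n m).play adv k) ∧
          ∀ s h, (some s, h) ∈ ((SetSampler.ram P κ n m).play adv k).support →
            -- space
            s.touched.card ≤ C * n ∧
            -- `set`
            (∀ (i : Fin n) (α : unitInterval), pmin ≤ (α : ℝ) → SetSampler.HasPrecision κ w α →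
              SetSampler.meanTime (SetSampler.setLaw P κ i α s) ≤ C) ∧
            -- a single call of `sample`, which returns the set `slot now`;
            -- the data structure is rebuilt in the call at relative time `n`
            SetSampler.meanTime (SetSampler.sampleLaw P s) ≤
              C * (1 + ((decode s.store).slot (decode s.store).now).card +
                if (decode s.store).now = n then n else 0) := by
  refine ⟨fun n hn p adv k => SetSampler.transcript_law hn p adv k, fun κ => ?_⟩
  obtain ⟨C, hinit, hset, hsample, hspace⟩ : ∃ C, SetSampler.initTime κ ≤ C ∧
      SetSampler.setTime κ ≤ C ∧ 2 * SetSampler.sampleTime κ ≤ C ∧ 2 * (κ + 5) ≤ C :=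
    ⟨max (max (SetSampler.initTime κ) (SetSampler.setTime κ))
      (max (2 * SetSampler.sampleTime κ) (2 * (κ + 5))), by simp, by simp, by simp, by simp⟩
  refine ⟨SetSampler.program κ, C, fun w n hn' hn => ⟨SetSampler.decode κ n, ?_⟩⟩
  intro pmin hpmin _ p hp m hm
  have hvalid : ∀ i, SetSampler.Valid κ w (p i) := fun i => ⟨hpmin.trans_le (hp i).1, (hp i).2⟩
  refine ⟨?_, fun adv hadv k => ?_⟩
  · refine (SetSampler.runs_initCall hn hn' hvalid hm).meanTime_le.trans ?_
    rw [← Nat.cast_mul]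
    exact Nat.cast_le.2 (Nat.mul_le_mul_right _ hinit)
  obtain ⟨h1, h2, h3⟩ := SetSampler.play_ram hn hn' hvalid hm adv
    (fun h i α hα => ⟨hpmin.trans_le (hadv h i α hα).1, (hadv h i α hα).2⟩) k
  refine ⟨h1, ?_, fun s h hs => ?_⟩
  -- The potential is the accumulated time plus the savings of the clock, and the latter are
  -- dropped.
  · refine le_trans (SetSampler.mean_mono _ fun x hx => ?_) (h3.trans ?_)
    · obtain ⟨s, hs, -⟩ := h2 x hx
      rw [hs]
      exact le_self_add
    · exact mul_le_mul_left (Nat.cast_le.2 hsample) _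
  obtain ⟨s', hs', q, c, τ, hc, hr⟩ := h2 _ hs
  obtain rfl : s = s' := Option.some.inj hs'
  refine ⟨?_, fun i α hα hκ => ?_, ?_⟩
  · refine (Finset.card_le_card hr.touched).trans ((SetSampler.card_cells_le κ n w).trans ?_)
    calc (κ + 5) * (n + 1) ≤ (κ + 5) * (2 * n) := Nat.mul_le_mul_left _ (by omega)
      _ = 2 * (κ + 5) * n := by ring
      _ ≤ _ := Nat.mul_le_mul_right _ hspace
  · exact (hr.runs_setCall hn hc i ⟨hpmin.trans_le hα, hκ⟩).meanTime_le.trans (Nat.cast_le.2 hset)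
  · have hdec : SetSampler.decode κ n s.store = SetSampler.mkState q c τ := hr.decode hn hc
    rw [hdec, SetSampler.slot_mkState q hc]
    refine (hr.runs_sampleCall hn hc).meanTime_le.trans ?_
    have hnow : (SetSampler.mkState q c τ).now = c + 1 := rfl
    rw [SetSampler.sampleBound, hnow]
    norm_cast
    refine Nat.mul_le_mul (by omega) ?_
    split_ifs <;> omega
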